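/- Let $r=r(n)$ be a sequence of integers with $1\le r(n)\le n$ for all $n\ge 1$. For every $n$ let $X_1,\dots,X_{r+1}$ be independent random points in $\mathbb R^n$, all with the same distribution, which is that of one of the following models: * the Gaussian model: the standard normal distribution on $\mathbb R^n$; * the Beta model with a fixed parameter $\nu>0$: the distribution on the open unit ball with density $\pi^{-n/2}\,\frac{\Gamma((n+\nu)/2)}{\Gamma(\nu/2)}\,(1-|x|^2)^{(\nu-2)/2}$, $|x|<1$; * the spherical model: the uniform distribution on the unit sphere of $\mathbb R^n$ (regarded as the case $\nu=0$ of the Beta model). Let $\mathcal V_{n,r}$ be the $r$-dimensional volume of the simplex with vertices $X_1,\dots,X_{r+1}$ and put $\mathcal L_{n,r}=\log(r!\,\mathcal V_{n,r})$. For a real random variable $Y$ with $\mathbb E|Y|^m<\infty$ let $c^m(Y)=(-i)^m\frac{d^m}{dt^m}\log\mathbb E[e^{itY}]\big|_{t=0}$ be its $m$-th cumulant. All asymptotic relations are for $n\to\infty$, and $a_n\sim b_n$ means $a_n/b_n\to1$. (a) In the Gaussian model, for all $n\ge1$, $\mathcal V_{n,r}>0$ almost surely and $\mathcal L_{n,r}$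 has finite absolute moments of all orders. For every such sequence $r$, $$\mathbb E\mathcal L_{n,r}\sim\frac r2\log n .$$ Moreover, $$\operatorname{Var}\mathcal L_{n,r}\sim\begin{cases}\frac{r}{2n}&\text{if } r=o(n),\\[2pt] \frac12\log\frac1{1-\alpha}&\text{if } r\sim\alpha n \text{ with }\alpha\in(0,1),\\[2pt] \frac12\log\frac{n}{n-r+1}&\text{if } n-r=o(n).\end{cases}$$ If $r=o(n)$ or $r\sim\alpha n$ for some $\alpha\in(0,1)$, then there is a constant $C\in(0,\infty)$, not depending on $n$ and $m$ (it may depend on the sequence $r$), such that for all $n\ge1$ and $m\ge3$ $$|c^m(\mathcal L_{n,r})|\le C^m\,(m-1)!\,r\,n^{1-m}.$$ For arbitrary $r$, for all $n\ge1$ and $m\ge3$, $$|c^m(\mathcal L_{n,r})|\le 2\,(m-1)!.$$ (b) In the Beta model ($\nu>0$) and in the spherical model ($\nu=0$), for all $n\ge4$, $\mathcal V_{n,r}>0$ almost surely and $\mathcal L_{n,r}$ has finite absolute moments of all orders. If $r(n)<n$ for all sufficiently large $n$, then $$\operatorname{Var}\mathcal L_{n,r}\sim\frac12\log\frac n{n-r}-\frac{r^2}{2n(r+1)}.$$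 Moreover (here $r(n)=n$ is allowed), $$\operatorname{Var}\mathcal L_{n,r}\sim\begin{cases}\frac{r}{2(r+1)n}&\text{if } r=o(\sqrt n),\\[2pt] \frac12\log\frac1{1-\alpha}-\frac\alpha2&\text{if } r\sim\alpha n\text{ with }\alpha\in(0,1),\\[2pt] \frac12\log\frac n{n-r+1}&\text{if } n-r=o(n).\end{cases}$$ If $r=o(n)$ or $r\sim\alpha n$ for some $\alpha\in(0,1)$, then there is a constant $C\in(0,\infty)$, not depending on $n$, $m$ and $\nu$ (it may depend on the sequence $r$), such that for all $n\ge4$ and $m\ge3$ $$|c^m(\mathcal L_{n,r})|\le C^m\,m!\,r\,n^{1-m}.$$ For arbitrary $r$, for all $n\ge4$ and $m\ge3$, $$|c^m(\mathcal L_{n,r})|\le 2\cdot4^m\,m!.$$ -/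

import Mathlib

open MeasureTheory ProbabilityTheory Filter Asymptotics Topology

noncomputable section

namespace RandomSimplex

/-- The Beta distribution with parameter `ν > 0` on the open unit ball of `ℝⁿ`, with density
`π ^ (-n/2) * Γ((n+ν)/2) / Γ(ν/2) * (1 - |x|²) ^ ((ν-2)/2)` for `|x| < 1`. -/
def betaModel (n : ℕ) (ν : ℝ) : Measure (EuclideanSpace ℝ (Fin n)) :=
  (volume.restrict (Metric.ball 0 1)).withDensity fun x =>
    ENNReal.ofReal
      (1 / Real.pi ^ ((n : ℝ) / 2) * (Real.Gamma ((n + ν) / 2) / Real.Gamma (ν / 2)) *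
        (1 - ‖x‖ ^ 2) ^ ((ν - 2) / 2))

/-- The uniform distribution on the unit sphere of `ℝⁿ` (meaningful for `n ≥ 1`): the normalized
surface measure, seen as a measure on `ℝⁿ`. -/
def sphericalModel (n : ℕ) : Measure (EuclideanSpace ℝ (Fin n)) :=
  ((volume : Measure (EuclideanSpace ℝ (Fin n))).toSphere Set.univ)⁻¹ •
    (volume : Measure (EuclideanSpace ℝ (Fin n))).toSphere.map Subtype.val

/-- The Beta model for `ν > 0`, and the spherical model as its member `ν = 0`. -/
def betaSphericalModel (n : ℕ) (ν : ℝ) : Measure (EuclideanSpace ℝ (Fin n)) :=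
  open Classical in if ν = 0 then sphericalModel n else betaModel n ν

/-- `X 0, X 1, …` are independent random points, each with distribution `μ`. -/
structure IsIIDSample {Ω E ι : Type*} [MeasurableSpace Ω] [MeasurableSpace E]
    (P : Measure Ω) (μ : Measure E) (X : ι → Ω → E) : Prop where
  indep : iIndepFun X P
  law : ∀ i, HasLaw (X i) μ P

/-- The `r`-dimensional volume of the simplex with vertices `x 0, …, x r` in `ℝⁿ`: the
`r`-dimensional Hausdorff measure, normalized to agree with Lebesgue measure in dimension `r`,
of the convex hull of the vertices. -/
def simplexVolume {n r : ℕ} (x : Fin (r + 1) → EuclideanSpace ℝ (Fin n)) : ℝ :=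
  (Measure.euclideanHausdorffMeasure r (convexHull ℝ (Set.range x))).toReal

/-- The random variable `log (r! V)`, where `V` is the `r`-dimensional volume of the simplex with
random vertices `X 0, …, X r`. -/
def logVolume {Ω : Type*} {n r : ℕ} (X : Fin (r + 1) → Ω → EuclideanSpace ℝ (Fin n))
    (ω : Ω) : ℝ :=
  Real.log ((r.factorial : ℝ) * simplexVolume fun i => X i ω)

/-- The `m`-th cumulant `(-i) ^ m * (d/dt) ^ m log E[exp (i t Y)]` at `t = 0` of a real random
variable `Y`. -/
def cumulant {Ω : Type*} [MeasurableSpace Ω] (m : ℕ) (Y : Ω → ℝ) (P : Measure Ω) : ℂ :=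
  (-Complex.I) ^ m *
    iteratedDeriv m (fun t : ℝ => Complex.log (∫ ω, Complex.exp (Complex.I * t * Y ω) ∂P)) 0

end RandomSimplex

end

/-!
By the Gram formula (`RandomSimplex.simplexVolume_eq`), `(r! V)²` is the Gram determinant `G` of
the edges of the simplex at one vertex, so `L = log (r! V) = (1/2) log G`. The moments `E G ^ σ` of
small negative order `σ` determine everything else: if `E G ^ (s/2) = exp (Φ s - Φ 0)` for small
`s < 0`, where `Φ` is analytic at `0` and the moment generating function of `L` is finite near `0`,
then the identity theorem gives this equation in a neighbourhood of `0`. Hence `L` has moments of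
all orders, and its mean, variance and cumulants are the derivatives of `Φ` at `0`; finiteness of a
negative moment also shows that `G > 0` almost surely
(`RandomSimplex.hasCumulantFunction_of_lintegral`,
`RandomSimplex.IsIIDSample.hasCumulantFunction_logVolume`). Only negative orders are needed, and
these are the ones for which the integral formulas below are simple.

*Gaussian moments.* Adding vectors one at a time multiplies the Gram determinant by the squared
distance of the new vector to the span of the previous ones. For Gaussian vectors these distances
are independent chi variables with `n, n - 1, …, n - r + 1` degrees of freedom
(`RandomSimplex.lintegral_gramDet_stdGaussian`). An orthogonal mixing of `r + 1` independent
Gaussian vectors by a matrix whose first column is `√w / √(∑ w)` reduces the simplex with vertices `z_i / √w_i`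
to such a Gram determinant; the weights contribute the factor `(∑ w) / ∏ w`
(`RandomSimplex.simplexGram_mixed`, `RandomSimplex.lintegral_simplexGram_stdGaussian`). Equal
weights give the Gaussian model.

*Beta and spherical moments.* The weights in the previous formula are used as Laplace variables. In
polar coordinates it says that the Laplace transform, in the squared distances of the vertices from
the origin, of the moment of order `-κ` over uniform independent directions is an explicit multiple
of `(∑ w) ^ (-κ) * ∏ w_i ^ (κ - n/2)` (`RandomSimplex.laplace_radialMoment`). This is also the
transform of `∫ t ^ (κ - 1) ∏ (ρ_i² - t)₊ ^ (n/2 - κ - 1) dt`, suitably normalised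
(`RandomSimplex.laplace_radialDensity`), so by uniqueness of the Laplace transform the two
functions of the radii agree almost everywhere (`RandomSimplex.radialMoment_ae_eq`). Integration
against the radial weights of the Beta distribution leads to Beta integrals
(`RandomSimplex.lintegral_simplexGram_betaModel`). The spherical model is the point where all radii
are one. It is reached by approximation with radii at which the identity holds; a bounded moment of
slightly higher order prevents a loss of mass in the limit (`RandomSimplex.radialMoment_unitRadii`,
`RandomSimplex.lintegral_simplexGram_sphericalModel`).

*Asymptotics.* Up to a linear term, `Φ` is in every model a finite combination of `log Γ` at affine
functions, so the cumulants of order at least two are finite combinations of the sums `∑ 1 / (x + k) ^ m`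
(`RandomSimplex.iteratedDeriv_gaussCumulantFun`, `RandomSimplex.iteratedDeriv_betaCumulantFun`).
The bounds `1 / x ≤ ψ'(x) ≤ 1 / x + 1 / x²` and a comparison of harmonic sums with logarithms give
the variance up to a constant times `r / (n (n - r + 1))`
(`RandomSimplex.abs_variance_gauss_sub_le`, `RandomSimplex.abs_variance_beta_sub_le`). In the Beta
model this error has to be compared with a leading term which is itself a difference of two close
quantities; `RandomSimplex.div_le_betaVarianceTerm` does this uniformly in `r`. The mean is
estimated by `log x - 1 / x ≤ ψ(x) ≤ log x`, a consequence of the convexity of `log Γ`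
(`RandomSimplex.abs_deriv_gaussCumulantFun_sub_le`), and the higher cumulants by summing
`∑ 1 / (x + k) ^ (j + 1) ≤ 1 / x ^ (j + 1) + 1 / (j x ^ j)` over `x = (n - j') / 2`.
-/

/-! ### Volume of a simplex and Gram determinants -/

namespace RandomSimplex

/-- The simplex `{x ≥ 0, ∑ x_i ≤ t}` cut off from the positive orthant. -/
def cornerSimplex (r : ℕ) (t : ℝ) : Set (Fin r → ℝ) := {x | (∀ i, 0 ≤ x i) ∧ ∑ i, x i ≤ t}

lemma measurableSet_cornerSimplex (r : ℕ) (t : ℝ) : MeasurableSet (cornerSimplex r t) := by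
  have : cornerSimplex r t = (⋂ i, {x | 0 ≤ x i}) ∩ {x | ∑ i, x i ≤ t} := by
    ext x; simp [cornerSimplex]
  rw [this]
  exact (MeasurableSet.iInter fun i => measurableSet_le measurable_const (measurable_pi_apply i)).inter
    (measurableSet_le (by fun_prop) measurable_const)

lemma volume_cornerSimplex (r : ℕ) {t : ℝ} (ht : 0 ≤ t) :
    volume (cornerSimplex r t) = ENNReal.ofReal (t ^ r / r.factorial) := by
  induction r generalizing t with
  | zero =>
    have : cornerSimplex 0 t = Set.univ := by ext x; simp [cornerSimplex, ht]
    simp [this, volume_pi]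
  | succ r ih =>
    let e := MeasurableEquiv.piFinSuccAbove (fun _ : Fin (r + 1) => ℝ) 0
    have he : MeasurePreserving e := volume_preserving_piFinSuccAbove (fun _ : Fin (r + 1) => ℝ) 0
    let S : Set (ℝ × (Fin r → ℝ)) := {p | 0 ≤ p.1 ∧ (∀ i, 0 ≤ p.2 i) ∧ p.1 + ∑ i, p.2 i ≤ t}
    have hS : MeasurableSet S := by
      have : S = {p | 0 ≤ p.1} ∩ ((⋂ i, {p | 0 ≤ p.2 i}) ∩ {p | p.1 + ∑ i, p.2 i ≤ t}) := by
        ext x; simp [S]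
      rw [this]
      refine (measurableSet_le measurable_const measurable_fst).inter
        ((MeasurableSet.iInter fun i => measurableSet_le measurable_const ?_).inter
        (measurableSet_le ?_ measurable_const)) <;> fun_prop
    have hpre : cornerSimplex (r + 1) t = e ⁻¹' S := by
      ext x
      simp only [cornerSimplex, Set.mem_ofPred_eq, Set.mem_preimage, S, e,
        MeasurableEquiv.piFinSuccAbove_apply, Fin.insertNthEquiv_zero, Fin.consEquiv_symm_apply,
        Fin.forall_fin_succ, Fin.sum_univ_succ]
      simp [Fin.tail, and_assoc]
    rw [hpre, he.measure_preimage hS.nullMeasurableSet, Measure.volume_eq_prod,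
      Measure.prod_apply hS]
    have hsec : ∀ s : ℝ, volume (Prod.mk s ⁻¹' S) =
        (Set.Icc 0 t).indicator (fun s => ENNReal.ofReal ((t - s) ^ r / r.factorial)) s := by
      intro s
      by_cases hs : s ∈ Set.Icc 0 t
      · rw [Set.indicator_of_mem hs, ← ih (sub_nonneg.2 hs.2)]
        congr 1
        ext y
        simp only [S, Set.mem_preimage, Set.mem_ofPred_eq, cornerSimplex, hs.1, true_and]
        constructor <;> rintro ⟨h1, h2⟩ <;> exact ⟨h1, by linarith⟩
      · rw [Set.indicator_of_notMem hs]
        convert measure_empty (μ := (volume : Measure (Fin r → ℝ)))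
        ext y
        simp only [S, Set.mem_preimage, Set.mem_ofPred_eq, Set.mem_empty_iff_false, iff_false]
        rintro ⟨h1, h2, h3⟩
        exact hs ⟨h1, by linarith [Finset.sum_nonneg fun i (_ : i ∈ Finset.univ) => h2 i]⟩
    simp_rw [hsec]
    rw [lintegral_indicator measurableSet_Icc, ← ofReal_integral_eq_lintegral_ofReal,
      integral_Icc_eq_integral_Ioc, ← intervalIntegral.integral_of_le ht]
    · congr 1
      rw [intervalIntegral.integral_div,
        intervalIntegral.integral_comp_sub_left (fun x => x ^ r) t, integral_pow,
        Nat.factorial_succ]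
      push_cast
      simp only [sub_self, sub_zero]
      rw [div_div, zero_pow (by omega), sub_zero]
    · exact (Continuous.integrableOn_Icc (by fun_prop))
    · filter_upwards [ae_restrict_mem measurableSet_Icc] with s hs
      exact div_nonneg (pow_nonneg (sub_nonneg.2 hs.2) _) (Nat.cast_nonneg _)

/-- The Gram determinant of a family of vectors: the squared volume of the parallelepiped they
span. -/
noncomputable def gramDet {F : Type*} [NormedAddCommGroup F] [InnerProductSpace ℝ F] {r : ℕ}
    (v : Fin r → F) : ℝ :=
  (Matrix.gram ℝ v).det

/-- The Gram determinant of the edge vectors at the vertex `x 0`: the square of `r!` times the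
volume of the simplex with vertices `x 0, …, x r`. -/
noncomputable def simplexGram {F : Type*} [NormedAddCommGroup F] [InnerProductSpace ℝ F] {r : ℕ}
    (x : Fin (r + 1) → F) : ℝ :=
  gramDet fun i : Fin r => x i.succ - x 0

section Gram

variable {F : Type*} [NormedAddCommGroup F] [InnerProductSpace ℝ F] {r : ℕ}

lemma gramDet_nonneg (v : Fin r → F) : 0 ≤ gramDet v :=
  (Matrix.posSemidef_gram ℝ v).det_nonneg

lemma gramDet_ne_zero_iff (v : Fin r → F) : gramDet v ≠ 0 ↔ LinearIndependent ℝ v :=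
  Matrix.det_gram_ne_zero_iff_linearIndependent

lemma continuous_gramDet : Continuous (gramDet : (Fin r → F) → ℝ) := by
  unfold gramDet
  refine Continuous.matrix_det (continuous_matrix fun i j => ?_)
  simp only [Matrix.gram_apply]
  fun_prop

lemma continuous_simplexGram : Continuous (simplexGram : (Fin (r + 1) → F) → ℝ) :=
  continuous_gramDet.comp (by fun_prop)

lemma simplexGram_nonneg (x : Fin (r + 1) → F) : 0 ≤ simplexGram x := gramDet_nonneg _

/-- A linear change of the vectors multiplies the Gram determinant by the squared determinant. -/
lemma gramDet_linear (B : Matrix (Fin r) (Fin r) ℝ) (v : Fin r → F) :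
    gramDet (fun i => ∑ j, B i j • v j) = B.det ^ 2 * gramDet v := by
  have : Matrix.gram ℝ (fun i => ∑ j, B i j • v j) = B * Matrix.gram ℝ v * B.transpose := by
    ext i k
    simp only [Matrix.gram_apply, Matrix.mul_apply, Matrix.transpose_apply, sum_inner, inner_sum,
      real_inner_smul_left, real_inner_smul_right, Finset.sum_mul]
    refine Finset.sum_congr rfl fun j _ => Finset.sum_congr rfl fun l _ => by ring
  rw [gramDet, this, Matrix.det_mul, Matrix.det_mul, Matrix.det_transpose, gramDet]
  ring

lemma gramDet_cons_of_orthogonal (q : F) (v : Fin r → F) (h : ∀ i, inner ℝ q (v i) = 0) :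
    gramDet (Fin.cons q v : Fin (r + 1) → F) = ‖q‖ ^ 2 * gramDet v := by
  rw [gramDet, Matrix.det_succ_row_zero, Fin.sum_univ_succ]
  simp only [Matrix.gram_apply, Fin.cons_zero, Fin.cons_succ, h, mul_zero, zero_mul,
    Finset.sum_const_zero, add_zero, real_inner_self_eq_norm_sq]
  simp [gramDet]
  left
  congr 1

/-- Appending a vector multiplies the Gram determinant by its squared distance to the span. -/
lemma gramDet_cons_add (p q : F) (v : Fin r → F) (h : ∀ i, inner ℝ q (v i) = 0)
    (hp : p ∈ Submodule.span ℝ (Set.range v)) :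
    gramDet (Fin.cons (p + q) v : Fin (r + 1) → F) = ‖q‖ ^ 2 * gramDet v := by
  rw [← gramDet_cons_of_orthogonal q v h]
  obtain ⟨c, rfl⟩ := (Submodule.mem_span_range_iff_exists_fun ℝ).1 hp
  let B : Matrix (Fin (r + 1)) (Fin (r + 1)) ℝ :=
    Fin.cons (Fin.cons 1 c) (fun i => Fin.cons 0 (fun j => if i = j then 1 else 0))
  have hB : B.det = 1 := by
    rw [Matrix.det_of_isUpperTriangular, Fin.prod_univ_succ]
    · simp [B]
    · intro i j hij
      induction i using Fin.cases with
      | zero => simp at hij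
      | succ i =>
        induction j using Fin.cases with
        | zero => simp [B]
        | succ j =>
          have : j < i := by simpa using hij
          simp [B, this.ne']
  have := gramDet_linear B (Fin.cons q v : Fin (r + 1) → F)
  rw [hB, one_pow, one_mul] at this
  rw [← this]
  congr 1
  ext i
  induction i using Fin.cases with
  | zero => simp [B, Fin.sum_univ_succ, add_comm]
  | succ i => simp [B, Fin.sum_univ_succ]

end Gram

/-- The volume of a non-degenerate simplex is `√G / r!`, where `G` is the Gram determinant of its
edges at one vertex: a linear isometry carries it to the image of the corner simplex under a square
matrix `S` with `(det S)² = G`. -/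
lemma simplexVolume_eq {n r : ℕ} (x : Fin (r + 1) → EuclideanSpace ℝ (Fin n))
    (hx : 0 < simplexGram x) :
    simplexVolume x = √(simplexGram x) / r.factorial := by
  set v : Fin r → EuclideanSpace ℝ (Fin n) := fun i => x i.succ - x 0 with hv
  have hli : LinearIndependent ℝ v := (gramDet_ne_zero_iff v).1 hx.ne'
  let W := Submodule.span ℝ (Set.range v)
  have hW : Module.finrank ℝ W = r := by
    simp [W, finrank_span_eq_card hli]
  let b : OrthonormalBasis (Fin r) ℝ W :=
    (stdOrthonormalBasis ℝ W).reindex (finCongr hW)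
  let u : Fin r → EuclideanSpace ℝ (Fin r) := fun i =>
    b.repr ⟨v i, Submodule.subset_span (Set.mem_range_self i)⟩
  let ι : EuclideanSpace ℝ (Fin r) →ₗᵢ[ℝ] EuclideanSpace ℝ (Fin n) :=
    W.subtypeₗᵢ.comp b.repr.symm.toLinearIsometry
  have hιu : ∀ i, ι (u i) = v i := by intro i; simp [ι, u]
  let S : EuclideanSpace ℝ (Fin r) →ₗ[ℝ] EuclideanSpace ℝ (Fin r) :=
    (EuclideanSpace.basisFun (Fin r) ℝ).toBasis.constr ℝ u
  have hSb : ∀ i, S (EuclideanSpace.basisFun (Fin r) ℝ i) = u i := by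
    intro i
    simp [S]
  have hSapp : ∀ y, S y = ∑ i, y i • u i := by
    intro y
    simp [S, Module.Basis.constr_apply_fintype]
  have hdet : |LinearMap.det S| = √(simplexGram x) := by
    rw [← Real.norm_eq_abs, ← LinearMap.normDet_eq_norm_det, eq_comm,
      Real.sqrt_eq_iff_eq_sq (simplexGram_nonneg x) (LinearMap.normDet_nonneg _)]
    have := LinearMap.normDet_sq_eq_det_gram S (EuclideanSpace.basisFun (Fin r) ℝ)
    simp only [RCLike.ofReal_real_eq_id, id] at this
    rw [this, simplexGram, gramDet]
    congr 1
    ext i j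
    simp only [Matrix.gram_apply, hSb]
    rw [← ι.inner_map_map, hιu, hιu]
  let Δ : Set (EuclideanSpace ℝ (Fin r)) := WithLp.ofLp ⁻¹' cornerSimplex r 1
  have hvol : volume Δ = ENNReal.ofReal (1 / r.factorial) := by
    have := (EuclideanSpace.volume_preserving_symm_measurableEquiv_toLp (Fin r)).measure_preimage
      (measurableSet_cornerSimplex r 1).nullMeasurableSet
    rw [volume_cornerSimplex r zero_le_one, one_pow] at this
    exact this
  have hconv : Convex ℝ Δ := by
    intro y hy z hz a c ha hc hac
    refine ⟨fun i => ?_, ?_⟩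
    · have h1 := hy.1 i
      have h2 := hz.1 i
      simp only [WithLp.ofLp_add, WithLp.ofLp_smul, Pi.add_apply, Pi.smul_apply, smul_eq_mul]
      positivity
    · have h1 := hy.2
      have h2 := hz.2
      simp only [WithLp.ofLp_add, WithLp.ofLp_smul, Pi.add_apply, Pi.smul_apply, smul_eq_mul,
        Finset.sum_add_distrib, ← Finset.mul_sum]
      nlinarith
  have hhull : convexHull ℝ (Set.range x) = (fun z => x 0 + z) '' (ι '' (S '' Δ)) := by
    have himg : ∀ y, x 0 + ι (S y) = x 0 + ∑ i, y i • v i := by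
      intro y; rw [hSapp, map_sum]; simp [hιu]
    apply Set.Subset.antisymm
    · refine convexHull_min ?_ ?_
      · rintro _ ⟨i, rfl⟩
        induction i using Fin.cases with
        | zero =>
          refine ⟨_, ⟨_, ⟨0, ⟨?_, ?_⟩, rfl⟩, rfl⟩, ?_⟩ <;> simp
        | succ i =>
          refine ⟨_, ⟨_, ⟨EuclideanSpace.basisFun (Fin r) ℝ i, ⟨?_, ?_⟩, rfl⟩, rfl⟩, ?_⟩
          · intro j
            by_cases h : j = i <;> simp [h]
          · simp
          · simp only [hSb, hιu, hv]; abel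
      · exact (((hconv.linear_image S).linear_image ι.toLinearMap)).translate (x 0)
    · rintro _ ⟨_, ⟨_, ⟨y, hy, rfl⟩, rfl⟩, rfl⟩
      simp only [himg]
      have hsum : x 0 + ∑ i, y i • v i =
          ∑ i, (Fin.cons (1 - ∑ i, y i) y.ofLp : Fin (r + 1) → ℝ) i • x i := by
        rw [Fin.sum_univ_succ]
        simp only [Fin.cons_zero, Fin.cons_succ, hv, smul_sub, Finset.sum_sub_distrib,
          ← Finset.sum_smul, sub_smul, one_smul]
        abel
      rw [hsum]
      refine (convex_convexHull ℝ _).sum_mem ?_ ?_ ?_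
      · intro i _
        induction i using Fin.cases with
        | zero => simpa using hy.2
        | succ i => simpa using hy.1 i
      · simp [Fin.sum_univ_succ]
      · exact fun i _ => subset_convexHull ℝ _ (Set.mem_range_self i)
  rw [simplexVolume, hhull, (isometry_add_left (x 0)).euclideanHausdorffMeasure_image,
    ι.isometry.euclideanHausdorffMeasure_image,
    EuclideanSpace.euclideanHausdorffMeasure_eq_volume, Measure.addHaar_image_linearMap, hvol,
    hdet, ← ENNReal.ofReal_mul (Real.sqrt_nonneg _),
    ENNReal.toReal_ofReal (by positivity)]
  ring

end RandomSimplex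

/-! ### Derivatives of `log Γ` -/

namespace RandomSimplex

/-- The series `∑ₖ 1 / (x + k) ^ m`, which is, up to sign and a factorial, the `m`-th derivative of
`log Γ` for `m ≥ 2`. -/
noncomputable def polySum (m : ℕ) (x : ℝ) : ℝ := ∑' k : ℕ, 1 / (x + k) ^ m

lemma summable_polySum {m : ℕ} (hm : 2 ≤ m) {x : ℝ} (hx : 0 < x) :
    Summable fun k : ℕ => 1 / (x + k) ^ m := by
  have h := (Real.summable_one_div_nat_add_rpow x m).2 (by exact_mod_cast hm)
  refine h.congr fun k => ?_
  rw [abs_of_pos (by positivity), Real.rpow_natCast, add_comm]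

lemma polySum_nonneg (m : ℕ) {x : ℝ} (hx : 0 < x) : 0 ≤ polySum m x :=
  tsum_nonneg fun k => by positivity

lemma hasDerivAt_polySum {m : ℕ} (hm : 2 ≤ m) {x : ℝ} (hx : 0 < x) :
    HasDerivAt (polySum m) (-m * polySum (m + 1) x) x := by
  have hd : ∀ k : ℕ, ∀ y ∈ Set.Ioi (x / 2),
      HasDerivAt (fun y : ℝ => 1 / (y + k) ^ m) (-m * (1 / (y + k) ^ (m + 1))) y := by
    intro k y hy
    have hy0 : 0 < y + k := by
      have h1 : x / 2 < y := hy
      have h2 : (0 : ℝ) ≤ k := Nat.cast_nonneg k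
      linarith
    have h1 : HasDerivAt (fun y : ℝ => (y + k) ^ m) (m * (y + k) ^ (m - 1) * 1) y :=
      ((hasDerivAt_id y).add_const (k : ℝ)).pow m
    have h2 := h1.inv (by positivity)
    simp only [one_div]
    convert! h2 using 1
    obtain ⟨j, rfl⟩ : ∃ j, m = j + 1 := ⟨m - 1, by omega⟩
    simp only [Nat.add_sub_cancel]
    field_simp
    ring
  have hsum : Summable fun k : ℕ => (m : ℝ) * (1 / (x / 2 + k) ^ (m + 1)) :=
    (summable_polySum (by omega) (by positivity)).mul_left _
  have h := hasDerivAt_tsum_of_isPreconnected hsum isOpen_Ioi isPreconnected_Ioi hd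
    (fun k y hy => ?_) (y₀ := x) (by simp [hx]) (summable_polySum hm hx) (y := x) (by simp [hx])
  · rw [tsum_mul_left] at h
    exact h
  · have hy' : x / 2 < y := hy
    have : 0 < y := by linarith
    rw [norm_mul, norm_neg, Real.norm_natCast, Real.norm_of_nonneg (by positivity)]
    gcongr

/-- The derivative of `log Γ` on the positive axis. -/
noncomputable def digammaReal (x : ℝ) : ℝ := deriv (fun x => Real.log (Real.Gamma x)) x

lemma log_succ_sub_bounds (k : ℕ) :
    1 / ((k : ℝ) + 2) ≤ Real.log (k + 2) - Real.log (k + 1) ∧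
      Real.log (k + 2) - Real.log (k + 1) ≤ 1 / ((k : ℝ) + 1) := by
  have hk : (0 : ℝ) ≤ k := Nat.cast_nonneg k
  rw [← Real.log_div (by positivity) (by positivity)]
  constructor
  · refine le_trans (le_of_eq ?_) (Real.one_sub_inv_le_log_of_pos (by positivity))
    field_simp; ring
  · refine (Real.log_le_sub_one_of_pos (by positivity)).trans (le_of_eq ?_)
    field_simp; ring

/-- The terms of the Weierstrass series of `log Γ(x) + log x`. -/
noncomputable def logGammaTerm (k : ℕ) (x : ℝ) : ℝ :=
  x * (Real.log (k + 2) - Real.log (k + 1)) - (Real.log (x + (k + 1)) - Real.log (k + 1))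

/-- The derivatives of the terms of the Weierstrass series of `log Γ(x) + log x`. -/
noncomputable def digammaTerm (k : ℕ) (x : ℝ) : ℝ :=
  Real.log (k + 2) - Real.log (k + 1) - 1 / (x + (k + 1))

lemma hasDerivAt_logGammaTerm (k : ℕ) {x : ℝ} (hx : 0 < x) :
    HasDerivAt (logGammaTerm k) (digammaTerm k x) x := by
  have h0 : x + ((k : ℝ) + 1) ≠ 0 := by positivity
  have h1 : HasDerivAt (fun x : ℝ => Real.log (x + (k + 1))) (1 / (x + (k + 1))) x :=
    ((hasDerivAt_id x).add_const ((k : ℝ) + 1)).log h0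
  have h2 := ((hasDerivAt_id x).mul_const (Real.log (k + 2) - Real.log (k + 1))).sub
    (h1.sub_const (Real.log (k + 1)))
  rw [one_mul] at h2
  exact h2

lemma hasDerivAt_digammaTerm (k : ℕ) {x : ℝ} (hx : 0 < x) :
    HasDerivAt (digammaTerm k) (1 / (x + (k + 1)) ^ 2) x := by
  have h0 : x + ((k : ℝ) + 1) ≠ 0 := by positivity
  have h1 := (((hasDerivAt_id x).add_const ((k : ℝ) + 1)).inv h0).const_sub
    (Real.log (k + 2) - Real.log (k + 1))
  unfold digammaTerm
  simp only [one_div]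
  convert! h1 using 1
  simp only [id]
  field_simp

lemma abs_digammaTerm_le (k : ℕ) {x R : ℝ} (hx : 0 < x) (hxR : x < R) (hR : 1 ≤ R) :
    ‖digammaTerm k x‖ ≤ R * (1 / ((1 : ℝ) + k) ^ 2) := by
  have hk : (0 : ℝ) ≤ k := Nat.cast_nonneg k
  obtain ⟨h1, h2⟩ := log_succ_sub_bounds k
  have h3 : 1 / (R + ((k : ℝ) + 1)) ≤ 1 / (x + (k + 1)) := by gcongr
  have h4 : 1 / (x + ((k : ℝ) + 1)) ≤ 1 / (k + 1) :=
    one_div_le_one_div_of_le (by positivity) (by linarith)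
  have h5 : 1 / (R + ((k : ℝ) + 1)) ≤ 1 / (k + 2) :=
    one_div_le_one_div_of_le (by positivity) (by linarith)
  have h6 : 1 / ((k : ℝ) + 1) - 1 / (R + (k + 1)) ≤ R * (1 / ((1 : ℝ) + k) ^ 2) := by
    rw [div_sub_div _ _ (by positivity) (by positivity), mul_one_div,
      div_le_div_iff₀ (by positivity) (by positivity)]
    have : 0 ≤ R * R * (1 + k) := by positivity
    nlinarith
  rw [Real.norm_eq_abs, digammaTerm, abs_le]
  constructor <;> linarith

lemma summable_logGammaTerm_one : Summable fun k : ℕ => logGammaTerm k 1 := by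
  have : ∀ k : ℕ, logGammaTerm k 1 = 0 := by
    intro k
    rw [logGammaTerm, show (1 : ℝ) + (k + 1) = k + 2 by ring]; ring
  simp [this]

lemma summable_logGammaTerm {x : ℝ} (hx : 0 < x) : Summable fun k => logGammaTerm k x :=
  summable_of_summable_hasDerivAt_of_isPreconnected
    ((summable_polySum le_rfl one_pos).mul_left (max x 1 + 1))
    isOpen_Ioo isPreconnected_Ioo
    (fun k _ hy => hasDerivAt_logGammaTerm k hy.1)
    (fun k _ hy => abs_digammaTerm_le k hy.1 hy.2 (by linarith [le_max_right x 1]))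
    (y₀ := 1) ⟨one_pos, by linarith [le_max_right x 1]⟩ summable_logGammaTerm_one
    ⟨hx, by linarith [le_max_left x 1]⟩

/-- The Weierstrass series of `log Γ`, from the limit in the Bohr–Mollerup theorem. The telescoping
logarithms in `logGammaTerm` replace Euler's constant. -/
lemma log_Gamma_eq_tsum {x : ℝ} (hx : 0 < x) :
    Real.log (Real.Gamma x) = -Real.log x + ∑' k, logGammaTerm k x := by
  have h1 := (summable_logGammaTerm hx).hasSum.tendsto_sum_nat
  have h2 := Real.BohrMollerup.tendsto_log_gamma hx
  have h3 : Tendsto (fun n : ℕ => x * (Real.log (n + 1) - Real.log n)) atTop (𝓝 (x * 0)) := by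
    refine Tendsto.const_mul x ?_
    refine squeeze_zero' (g := fun n : ℕ => 1 / (n : ℝ)) ?_ ?_ tendsto_one_div_atTop_nhds_zero_nat
    · filter_upwards [eventually_ge_atTop 1] with n hn
      have : (1 : ℝ) ≤ n := by exact_mod_cast hn
      exact sub_nonneg.2 (Real.log_le_log (by linarith) (by linarith))
    · filter_upwards [eventually_ge_atTop 1] with n hn
      have := (log_succ_sub_bounds (n - 1)).2
      rw [Nat.cast_sub hn] at this
      convert this using 1 <;> [congr 2; congr 1] <;> push_cast <;> ring
  have h4 : ∀ n : ℕ, ∑ k ∈ Finset.range n, logGammaTerm k x =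
      Real.BohrMollerup.logGammaSeq x n + x * (Real.log (n + 1) - Real.log n) + Real.log x := by
    intro n
    have e1 : ∑ k ∈ Finset.range n, (Real.log ((k : ℝ) + 2) - Real.log (k + 1)) =
        Real.log (n + 1) := by
      have := Finset.sum_range_sub (fun k : ℕ => Real.log ((k : ℝ) + 1)) n
      simp only [Nat.cast_zero, zero_add, Real.log_one, sub_zero] at this
      rw [← this]
      refine Finset.sum_congr rfl fun k _ => ?_
      push_cast
      ring_nf
    have e2 : ∑ k ∈ Finset.range n, Real.log ((k : ℝ) + 1) = Real.log (n.factorial) := by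
      rw [← Finset.prod_range_add_one_eq_factorial, Nat.cast_prod, Real.log_prod]
      · push_cast; rfl
      · intro i _; positivity
    simp only [logGammaTerm, Finset.sum_sub_distrib, ← Finset.mul_sum,
      Real.BohrMollerup.logGammaSeq, Finset.sum_range_succ']
    rw [← Finset.sum_sub_distrib, e1, e2]
    push_cast
    ring_nf
  have h5 := (h2.add h3).add_const (Real.log x)
  simp only [← h4] at h5
  have := tendsto_nhds_unique h1 h5
  rw [this]; ring

lemma hasDerivAt_log_Gamma_aux {x : ℝ} (hx : 0 < x) :
    HasDerivAt (fun x => Real.log (Real.Gamma x)) (-(1 / x) + ∑' k, digammaTerm k x) x := by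
  have h := hasDerivAt_tsum_of_isPreconnected
    ((summable_polySum le_rfl one_pos).mul_left (max x 1 + 1))
    isOpen_Ioo isPreconnected_Ioo
    (fun k _ hy => hasDerivAt_logGammaTerm k hy.1)
    (fun k _ hy => abs_digammaTerm_le k hy.1 hy.2 (by linarith [le_max_right x 1]))
    (y₀ := 1) ⟨one_pos, by linarith [le_max_right x 1]⟩ summable_logGammaTerm_one (y := x)
    ⟨hx, by linarith [le_max_left x 1]⟩
  have h2 := ((Real.hasDerivAt_log hx.ne').neg.add h)
  rw [one_div]
  refine h2.congr_of_eventuallyEq ?_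
  filter_upwards [lt_mem_nhds hx] with y hy
  exact log_Gamma_eq_tsum hy

lemma hasDerivAt_log_Gamma {x : ℝ} (hx : 0 < x) :
    HasDerivAt (fun x => Real.log (Real.Gamma x)) (digammaReal x) x :=
  (hasDerivAt_log_Gamma_aux hx).differentiableAt.hasDerivAt

lemma hasDerivAt_digammaReal {x : ℝ} (hx : 0 < x) :
    HasDerivAt digammaReal (polySum 2 x) x := by
  have hs : Summable fun k : ℕ => digammaTerm k x := by
    refine Summable.of_norm_bounded
      ((summable_polySum le_rfl one_pos).mul_left (max x 1 + 1)) fun k => ?_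
    exact abs_digammaTerm_le k hx (by linarith [le_max_left x 1]) (by linarith [le_max_right x 1])
  have h := hasDerivAt_tsum_of_isPreconnected (summable_polySum le_rfl one_pos)
    isOpen_Ioi isPreconnected_Ioi
    (fun k y (hy : y ∈ Set.Ioi (0 : ℝ)) => hasDerivAt_digammaTerm k hy) (fun k y hy => ?_)
    (y₀ := x) hx hs (y := x) hx
  · have h2 := ((hasDerivAt_inv hx.ne').neg.add h)
    have e : polySum 2 x = -(-(x ^ 2)⁻¹) + ∑' k : ℕ, 1 / (x + (k + 1)) ^ 2 := by
      rw [polySum, (summable_polySum le_rfl hx).tsum_eq_zero_add]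
      simp
    rw [e]
    refine h2.congr_of_eventuallyEq ?_
    filter_upwards [lt_mem_nhds hx] with y hy
    rw [digammaReal, (hasDerivAt_log_Gamma_aux hy).deriv, one_div]
    rfl
  · have hy' : 0 < y := hy
    rw [Real.norm_of_nonneg (by positivity)]
    have : 1 + (k : ℝ) ≤ y + (k + 1) := by linarith
    gcongr

lemma analyticAt_log_Gamma {x : ℝ} (hx : 0 < x) :
    AnalyticAt ℝ (fun x => Real.log (Real.Gamma x)) x := by
  have h1 : AnalyticAt ℂ Complex.Gamma x := by
    refine DifferentiableOn.analyticAt (s := {z | 0 < z.re}) (fun z hz => ?_)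
      ((isOpen_lt continuous_const Complex.continuous_re).mem_nhds (by simpa using hx))
    refine (Complex.differentiableAt_Gamma z fun m h => ?_).differentiableWithinAt
    have : 0 < z.re := hz
    rw [h] at this
    simp at this
    linarith [(Nat.cast_nonneg m : (0 : ℝ) ≤ m)]
  have h2 : AnalyticAt ℝ Real.Gamma x := h1.re_ofReal
  exact h2.log (Real.Gamma_pos_of_pos hx)

/-- Derivatives of order at least two of `log Γ` along an affine function. -/
lemma iteratedDeriv_log_Gamma_affine (b c : ℝ) (m : ℕ) {s : ℝ} (hs : 0 < b + c * s) :
    iteratedDeriv (m + 2) (fun s => Real.log (Real.Gamma (b + c * s))) s =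
      c ^ (m + 2) * ((-1) ^ m * (m + 1).factorial * polySum (m + 2) (b + c * s)) := by
  have hlin : ∀ s : ℝ, HasDerivAt (fun s => b + c * s) c s := fun s => by
    simpa using ((hasDerivAt_id s).const_mul c).const_add b
  have hev : ∀ {s : ℝ}, 0 < b + c * s → ∀ᶠ t in 𝓝 s, 0 < b + c * t := fun {s} h =>
    (by fun_prop : ContinuousAt (fun s => b + c * s) s).eventually (lt_mem_nhds h)
  have h1 : ∀ {s : ℝ}, 0 < b + c * s → deriv (fun s => Real.log (Real.Gamma (b + c * s))) s =
      digammaReal (b + c * s) * c := by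
    intro s h
    exact ((hasDerivAt_log_Gamma h).comp s (hlin s)).deriv
  induction m generalizing s with
  | zero =>
    rw [iteratedDeriv_succ, iteratedDeriv_one]
    have : deriv (fun s => Real.log (Real.Gamma (b + c * s))) =ᶠ[𝓝 s]
        fun s => digammaReal (b + c * s) * c := by
      filter_upwards [hev hs] with t ht using h1 ht
    have hd := ((hasDerivAt_digammaReal hs).comp s (hlin s)).mul_const c
    rw [this.deriv_eq]
    refine hd.deriv.trans ?_
    simp; ring
  | succ m ih =>
    rw [iteratedDeriv_succ]
    have : iteratedDeriv (m + 2) (fun s => Real.log (Real.Gamma (b + c * s))) =ᶠ[𝓝 s]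
        fun s => c ^ (m + 2) * ((-1) ^ m * (m + 1).factorial * polySum (m + 2) (b + c * s)) := by
      filter_upwards [hev hs] with t ht using ih ht
    have hd := (((hasDerivAt_polySum (by omega : 2 ≤ m + 2) hs).comp s (hlin s)).const_mul
      ((-1) ^ m * (m + 1).factorial : ℝ)).const_mul (c ^ (m + 2))
    rw [this.deriv_eq]
    refine hd.deriv.trans ?_
    rw [Nat.factorial_succ (m + 1)]
    push_cast
    ring

lemma deriv_log_Gamma_affine (b c : ℝ) {s : ℝ} (hs : 0 < b + c * s) :
    deriv (fun s => Real.log (Real.Gamma (b + c * s))) s = c * digammaReal (b + c * s) := by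
  have hlin : HasDerivAt (fun s => b + c * s) c s := by
    simpa using ((hasDerivAt_id s).const_mul c).const_add b
  rw [mul_comm]
  exact ((hasDerivAt_log_Gamma hs).comp s hlin).deriv

lemma telescoping_lower {y : ℝ} (hy : 0 < y) : 1 / y - 1 / (y + 1) ≤ 1 / y ^ 2 := by
  rw [div_sub_div _ _ hy.ne' (by positivity), div_le_div_iff₀ (by positivity) (by positivity)]
  nlinarith [sq_nonneg y]

lemma telescoping_upper {y : ℝ} (hy : 0 < y) {j : ℕ} (hj : 1 ≤ j) :
    1 / (y + 1) ^ (j + 1) ≤ 1 / j * (1 / y ^ j) - 1 / j * (1 / (y + 1) ^ j) := by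
  have hj' : (0 : ℝ) < j := by exact_mod_cast hj
  have hb := one_add_mul_le_pow (a := 1 / y) (by have : 0 < 1 / y := by positivity
                                                 linarith) j
  have hb2 : y ^ j * (y + j) ≤ y * (y + 1) ^ j := by
    have e : (1 + 1 / y) ^ j = (y + 1) ^ j / y ^ j := by
      rw [← div_pow]; congr 1; field_simp
    rw [e, le_div_iff₀ (by positivity)] at hb
    have : (1 + j * (1 / y)) * y = y + j := by field_simp
    calc y ^ j * (y + j) = y * ((1 + j * (1 / y)) * y ^ j) := by rw [← this]; ring
      _ ≤ y * (y + 1) ^ j := by gcongr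
  rw [← mul_sub, div_sub_div _ _ (by positivity) (by positivity), one_div_mul_eq_div,
    div_div, div_le_div_iff₀ (by positivity) (by positivity)]
  have h3 : y ^ j * j ≤ (y + 1) * ((y + 1) ^ j - y ^ j) := by
    have : y ^ j ≤ (y + 1) ^ j := by gcongr; linarith
    nlinarith
  have h4 : 0 ≤ (y + 1) ^ j := by positivity
  calc 1 * (y ^ j * (y + 1) ^ j * j) = (y + 1) ^ j * (y ^ j * j) := by ring
    _ ≤ (y + 1) ^ j * ((y + 1) * ((y + 1) ^ j - y ^ j)) := by gcongr
    _ = _ := by ring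

lemma sum_telescope_le {f g : ℕ → ℝ} {B : ℝ} (h : ∀ k, f k ≤ g k - g (k + 1))
    (hg : ∀ k, 0 ≤ g k) (hf : ∀ k, 0 ≤ f k) (hB : g 0 ≤ B) : ∑' k, f k ≤ B := by
  refine Real.tsum_le_of_sum_range_le hf fun n => ?_
  calc ∑ k ∈ Finset.range n, f k ≤ ∑ k ∈ Finset.range n, (g k - g (k + 1)) :=
        Finset.sum_le_sum fun k _ => h k
    _ = g 0 - g n := Finset.sum_range_sub' g n
    _ ≤ B := by linarith [hg n]

/-- Integral comparison for the series, in the form of a telescoping majorant. -/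
lemma polySum_le {j : ℕ} (hj : 1 ≤ j) {x : ℝ} (hx : 0 < x) :
    polySum (j + 1) x ≤ 1 / x ^ (j + 1) + 1 / j * (1 / x ^ j) := by
  rw [polySum, (summable_polySum (by omega) hx).tsum_eq_zero_add]
  refine add_le_add (by simp) ?_
  refine sum_telescope_le (g := fun k : ℕ => 1 / (j : ℝ) * (1 / (x + k) ^ j)) (fun k => ?_)
    (fun k => by positivity) (fun k => by positivity) (by simp)
  have := telescoping_upper (y := x + k) (by positivity) hj
  push_cast
  rwa [← add_assoc]

lemma le_polySum_two {x : ℝ} (hx : 0 < x) : 1 / x ≤ polySum 2 x := by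
  have h1 := (summable_polySum le_rfl hx).hasSum.tendsto_sum_nat
  have h2 : Tendsto (fun n : ℕ => 1 / x - 1 / (x + n)) atTop (𝓝 (1 / x - 0)) := by
    refine tendsto_const_nhds.sub ?_
    simp only [one_div]
    exact (tendsto_atTop_add_const_left _ x tendsto_natCast_atTop_atTop).inv_tendsto_atTop
  rw [sub_zero] at h2
  refine le_of_tendsto_of_tendsto' h2 h1 fun n => ?_
  have := Finset.sum_range_sub' (fun k : ℕ => 1 / (x + k)) n
  simp only [Nat.cast_zero, add_zero] at this
  rw [← this]
  refine Finset.sum_le_sum fun k _ => ?_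
  have := telescoping_lower (y := x + k) (by positivity)
  push_cast
  rwa [← add_assoc]

lemma log_Gamma_add_one {x : ℝ} (hx : 0 < x) :
    Real.log (Real.Gamma (x + 1)) = Real.log x + Real.log (Real.Gamma x) := by
  rw [Real.Gamma_add_one hx.ne', Real.log_mul hx.ne' (Real.Gamma_pos_of_pos hx).ne']

lemma digammaReal_add_one {x : ℝ} (hx : 0 < x) :
    digammaReal (x + 1) = digammaReal x + 1 / x := by
  have h1 : HasDerivAt (fun y : ℝ => Real.log (Real.Gamma (y + 1))) (digammaReal (x + 1) * 1) x :=
    (hasDerivAt_log_Gamma (by positivity)).comp x ((hasDerivAt_id x).add_const 1)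
  have h2 : HasDerivAt (fun y : ℝ => Real.log (Real.Gamma (y + 1))) (x⁻¹ + digammaReal x) x := by
    refine ((Real.hasDerivAt_log hx.ne').add (hasDerivAt_log_Gamma hx)).congr_of_eventuallyEq ?_
    filter_upwards [lt_mem_nhds hx] with y hy using log_Gamma_add_one hy
  have := h1.unique h2
  rw [one_div]; linarith

/-- `log x - 1/x ≤ ψ(x) ≤ log x`: by convexity of `log Γ`, the increment `log x` of `log Γ` over
`[x, x + 1]` lies between `ψ(x)` and `ψ(x + 1) = ψ(x) + 1/x`. -/
lemma digammaReal_bounds {x : ℝ} (hx : 0 < x) :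
    Real.log x - 1 / x ≤ digammaReal x ∧ digammaReal x ≤ Real.log x := by
  have hc := Real.convexOn_log_Gamma
  have hslope : slope (Real.log ∘ Real.Gamma) x (x + 1) = Real.log x := by
    rw [slope_def_field]
    simp [log_Gamma_add_one hx]
  have hx1 : (0 : ℝ) < x + 1 := by positivity
  constructor
  · have := hc.slope_le_of_hasDerivAt (x := x) (y := x + 1) hx hx1 (by linarith)
      (hasDerivAt_log_Gamma hx1)
    rw [hslope, digammaReal_add_one hx] at this
    linarith
  · have := hc.le_slope_of_hasDerivAt (x := x) (y := x + 1) hx hx1 (by linarith)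
      (hasDerivAt_log_Gamma hx)
    rwa [hslope] at this

end RandomSimplex

/-! ### Product measures and polar coordinates -/

namespace RandomSimplex

section Products

variable {α : Type*} [MeasurableSpace α]

lemma lintegral_pi_cons {r : ℕ} (μ : Measure α) [SigmaFinite μ] {f : (Fin (r + 1) → α) → ENNReal}
    (hf : Measurable f) :
    ∫⁻ x, f x ∂Measure.pi (fun _ => μ) =
      ∫⁻ v, ∫⁻ z, f (Fin.cons z v) ∂μ ∂Measure.pi (fun _ : Fin r => μ) := by
  have he := measurePreserving_piFinSuccAbove (fun _ : Fin (r + 1) => μ) 0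
  rw [← he.symm.lintegral_comp_emb (MeasurableEquiv.measurableEmbedding _),
    lintegral_prod_symm]
  · simp only [MeasurableEquiv.piFinSuccAbove_symm_apply, Fin.insertNthEquiv_zero]
    rfl
  · exact (hf.comp (MeasurableEquiv.measurable _)).aemeasurable

lemma lintegral_pi_prod {r : ℕ} (μ : Fin r → Measure α) [∀ i, SigmaFinite (μ i)]
    {f : Fin r → α → ENNReal} (hf : ∀ i, Measurable (f i)) :
    ∫⁻ x, ∏ i, f i (x i) ∂Measure.pi μ = ∏ i, ∫⁻ x, f i x ∂μ i := by
  induction r with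
  | zero => simp
  | succ r ih =>
    have he := measurePreserving_piFinSuccAbove μ 0
    have hm : Measurable fun x : Fin (r + 1) → α => ∏ i, f i (x i) :=
      Finset.measurable_prod _ fun i _ => (hf i).comp (measurable_pi_apply i)
    have hm' : Measurable fun x : Fin r → α => ∏ i : Fin r, f i.succ (x i) :=
      Finset.measurable_prod _ fun i _ => (hf _).comp (measurable_pi_apply i)
    rw [← he.symm.lintegral_comp_emb (MeasurableEquiv.measurableEmbedding _),
      lintegral_prod_symm]
    · simp only [MeasurableEquiv.piFinSuccAbove_symm_apply, Fin.insertNthEquiv_zero,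
        Fin.consEquiv_apply, Fin.prod_univ_succ, Fin.cons_zero, Fin.cons_succ]
      simp_rw [lintegral_mul_const _ (hf 0)]
      rw [lintegral_const_mul _ hm', ← ih (fun i => μ i.succ) fun i => hf i.succ]
      simp
    · exact (hm.comp (MeasurableEquiv.measurable _)).aemeasurable

lemma pi_withDensity {r : ℕ} (μ : Fin r → Measure α) [∀ i, SigmaFinite (μ i)]
    {f : Fin r → α → ENNReal} (hf : ∀ i, Measurable (f i))
    [∀ i, SigmaFinite ((μ i).withDensity (f i))] :
    Measure.pi (fun i => (μ i).withDensity (f i)) =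
      (Measure.pi μ).withDensity fun x => ∏ i, f i (x i) := by
  refine Measure.pi_eq fun s hs => ?_
  rw [withDensity_apply _ (MeasurableSet.univ_pi hs), Measure.restrict_pi_pi,
    lintegral_pi_prod _ hf]
  exact Finset.prod_congr rfl fun i _ => (withDensity_apply _ (hs i)).symm

end Products

section Polar

variable {n : ℕ}

/-- The vector with given direction and length. -/
def polarVec (p : Metric.sphere (0 : EuclideanSpace ℝ (Fin n)) 1 × Set.Ioi (0 : ℝ)) :
    EuclideanSpace ℝ (Fin n) := p.2.1 • p.1.1

lemma continuous_polarVec : Continuous (polarVec (n := n)) := by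
  unfold polarVec; fun_prop

lemma map_polarVec (hn : 1 ≤ n) :
    ((volume : Measure (EuclideanSpace ℝ (Fin n))).toSphere.prod
      (Measure.volumeIoiPow (n - 1))).map polarVec = volume := by
  have : Nonempty (Fin n) := ⟨⟨0, hn⟩⟩
  have h := (volume : Measure (EuclideanSpace ℝ (Fin n))).measurePreserving_homeomorphUnitSphereProd
  rw [finrank_euclideanSpace, Fintype.card_fin] at h
  have h2 : polarVec (n := n) =
      Subtype.val ∘ (homeomorphUnitSphereProd (EuclideanSpace ℝ (Fin n))).symm := by
    ext1 p
    rfl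
  have h3 := (h.symm (homeomorphUnitSphereProd (EuclideanSpace ℝ (Fin n))).toMeasurableEquiv)
  rw [h2, ← Measure.map_map measurable_subtype_coe (Homeomorph.measurable _)]
  have h4 := h3.map_eq
  have h5 : (((volume : Measure (EuclideanSpace ℝ (Fin n))).toSphere.prod
      (Measure.volumeIoiPow (n - 1))).map
      (homeomorphUnitSphereProd (EuclideanSpace ℝ (Fin n))).symm) =
      Measure.comap Subtype.val volume := h4
  rw [h5, map_comap_subtype_coe (measurableSet_singleton _).compl,
    restrict_compl_singleton]

lemma lintegral_volumeIoiPow (k : ℕ) {g : ℝ → ENNReal} :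
    ∫⁻ ρ, g ρ.1 ∂Measure.volumeIoiPow k =
      ∫⁻ t in Set.Ioi (0 : ℝ), ENNReal.ofReal (t ^ k) * g t := by
  rw [Measure.volumeIoiPow, lintegral_withDensity_eq_lintegral_mul_non_measurable]
  · simp only [Pi.mul_apply]
    rw [← lintegral_subtype_comap measurableSet_Ioi
      (fun t : ℝ => ENNReal.ofReal (t ^ k) * g t)]
  · fun_prop
  · filter_upwards with x using ENNReal.ofReal_lt_top

lemma lintegral_polar (hn : 1 ≤ n) {f : EuclideanSpace ℝ (Fin n) → ENNReal} (hf : Measurable f) :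
    ∫⁻ x, f x = ∫⁻ ρ, ∫⁻ u, f (polarVec (u, ρ))
      ∂(volume : Measure (EuclideanSpace ℝ (Fin n))).toSphere
      ∂Measure.volumeIoiPow (n - 1) := by
  conv_lhs => rw [← map_polarVec hn]
  rw [lintegral_map hf continuous_polarVec.measurable, lintegral_prod_symm]
  exact (hf.comp continuous_polarVec.measurable).aemeasurable

lemma norm_polarVec (p : Metric.sphere (0 : EuclideanSpace ℝ (Fin n)) 1 × Set.Ioi (0 : ℝ)) :
    ‖polarVec p‖ = p.2.1 := by
  have := p.1.2
  have h2 : 0 < p.2.1 := p.2.2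
  simp only [mem_sphere_iff_norm, sub_zero] at this
  rw [polarVec, norm_smul, this, mul_one, Real.norm_of_nonneg h2.le]

/-- Polar coordinates in each factor of a product of Euclidean spaces. -/
lemma lintegral_pi_polar (hn : 1 ≤ n) {r : ℕ}
    {f : (Fin r → EuclideanSpace ℝ (Fin n)) → ENNReal} (hf : Measurable f) :
    ∫⁻ x, f x ∂Measure.pi (fun _ => volume) =
      ∫⁻ ρ, ∫⁻ u, f (fun i => polarVec (u i, ρ i))
        ∂Measure.pi fun _ => (volume : Measure (EuclideanSpace ℝ (Fin n))).toSphere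
        ∂Measure.pi fun _ => Measure.volumeIoiPow (n - 1) := by
  have : SigmaFinite (((volume : Measure (EuclideanSpace ℝ (Fin n))).toSphere.prod
      (Measure.volumeIoiPow (n - 1))).map polarVec) := by
    rw [map_polarVec hn]; infer_instance
  have hF : Measurable fun x : Fin r → Metric.sphere (0 : EuclideanSpace ℝ (Fin n)) 1 ×
      Set.Ioi (0 : ℝ) => fun i => polarVec (x i) :=
    measurable_pi_lambda _ fun i => continuous_polarVec.measurable.comp (measurable_pi_apply i)
  conv_lhs => rw [← map_polarVec hn]
  rw [← Measure.pi_map_pi fun _ => continuous_polarVec.aemeasurable, lintegral_map hf hF,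
    ← (measurePreserving_arrowProdEquivProdArrow _ _ (Fin r)
      (fun _ => (volume : Measure (EuclideanSpace ℝ (Fin n))).toSphere)
      (fun _ => Measure.volumeIoiPow (n - 1))).symm.lintegral_comp_emb
      (MeasurableEquiv.measurableEmbedding _), lintegral_prod_symm]
  · rfl
  · exact ((hf.comp hF).comp (MeasurableEquiv.measurable _)).aemeasurable

end Polar

end RandomSimplex

/-! ### Gram determinants of Gaussian vectors -/

namespace RandomSimplex

lemma integrableOn_rpow_mul_exp_neg {q b : ℝ} (hq : -1 < q) (hb : 0 < b) :
    IntegrableOn (fun x : ℝ => x ^ q * Real.exp (-b * x ^ (2 : ℝ))) (Set.Ioi 0) :=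
  integrableOn_rpow_mul_exp_neg_mul_rpow hq (by norm_num) hb

/-- The density of the standard Gaussian distribution. -/
lemma stdGaussian_eq_withDensity (n : ℕ) :
    stdGaussian (EuclideanSpace ℝ (Fin n)) = volume.withDensity fun x =>
      ENNReal.ofReal ((√(2 * Real.pi))⁻¹ ^ n * Real.exp (-(‖x‖ ^ 2 / 2))) := by
  rw [← map_pi_eq_stdGaussian]
  have h1 : gaussianReal 0 1 = volume.withDensity (gaussianPDF 0 1) :=
    gaussianReal_of_var_ne_zero 0 one_ne_zero
  have : SigmaFinite ((volume : Measure ℝ).withDensity (gaussianPDF 0 1)) := by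
    rw [← h1]; infer_instance
  rw [h1, pi_withDensity (fun _ => volume) fun _ => measurable_gaussianPDF 0 1]
  have hmp : MeasurePreserving (WithLp.toLp 2 : (Fin n → ℝ) → EuclideanSpace ℝ (Fin n)) :=
    PiLp.volume_preserving_toLp (Fin n)
  rw [← hmp.map_eq, ← volume_pi]
  have hm : Measurable fun x : EuclideanSpace ℝ (Fin n) =>
      ENNReal.ofReal ((√(2 * Real.pi))⁻¹ ^ n * Real.exp (-(‖x‖ ^ 2 / 2))) := by fun_prop
  ext s hs
  rw [Measure.map_apply hmp.measurable hs, withDensity_apply _ (hmp.measurable hs),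
    withDensity_apply _ hs, setLIntegral_map hs hm hmp.measurable]
  refine lintegral_congr fun x => ?_
  simp only [gaussianPDF]
  rw [← ENNReal.ofReal_prod_of_nonneg fun i _ => gaussianPDFReal_nonneg _ _ _]
  congr 1
  simp only [gaussianPDFReal, Finset.prod_mul_distrib, ← Real.exp_sum]
  simp [EuclideanSpace.real_norm_sq_eq, Finset.sum_div, neg_div]

/-- The moment `E ‖Z‖ ^ (2 σ)` of a standard Gaussian vector `Z` in dimension `d`. -/
noncomputable def gaussMoment (d : ℕ) (σ : ℝ) : ENNReal :=
  ∫⁻ z, ENNReal.ofReal (‖z‖ ^ 2) ^ σ ∂stdGaussian (EuclideanSpace ℝ (Fin d))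

/-- Up to a factor depending only on the dimension, `E ‖Z‖ ^ (2 σ)` is `2 ^ σ Γ(d / 2 + σ)`. -/
lemma gaussMoment_eq (d : ℕ) (hd : 1 ≤ d) : ∃ C : ℝ, 0 < C ∧ ∀ σ : ℝ, -(1 / 2) < σ →
    gaussMoment d σ = ENNReal.ofReal (C * 2 ^ σ * Real.Gamma (d / 2 + σ)) := by
  have : Nonempty (Fin d) := ⟨⟨0, hd⟩⟩
  set S := (volume : Measure (EuclideanSpace ℝ (Fin d))).toSphere Set.univ with hS
  have hS0 : S ≠ 0 := by
    rw [hS, ne_eq, Measure.measure_univ_eq_zero]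
    exact Measure.toSphere_ne_zero _
  have hSt : S ≠ ⊤ := measure_ne_top _ _
  have hd' : (1 : ℝ) ≤ d := by exact_mod_cast hd
  refine ⟨S.toReal * (√(2 * Real.pi))⁻¹ ^ d * (2 ^ ((d : ℝ) / 2) / 2), ?_, fun σ hσ => ?_⟩
  · have := ENNReal.toReal_pos hS0 hSt
    positivity
  have hm : Measurable fun x : EuclideanSpace ℝ (Fin d) =>
      ENNReal.ofReal ((√(2 * Real.pi))⁻¹ ^ d * Real.exp (-(‖x‖ ^ 2 / 2))) *
        ENNReal.ofReal (‖x‖ ^ 2) ^ σ := by fun_prop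
  rw [gaussMoment, stdGaussian_eq_withDensity,
    lintegral_withDensity_eq_lintegral_mul _ (by fun_prop)
    (by fun_prop)]
  simp only [Pi.mul_apply]
  rw [lintegral_polar hd hm]
  simp only [norm_polarVec, lintegral_const]
  rw [lintegral_mul_const' _ _ hSt, lintegral_volumeIoiPow (d - 1) (g := fun t =>
    ENNReal.ofReal ((√(2 * Real.pi))⁻¹ ^ d * Real.exp (-(t ^ 2 / 2))) *
        ENNReal.ofReal (t ^ 2) ^ σ)]
  have hint : ∀ t ∈ Set.Ioi (0 : ℝ), ENNReal.ofReal (t ^ (d - 1)) *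
      (ENNReal.ofReal ((√(2 * Real.pi))⁻¹ ^ d * Real.exp (-(t ^ 2 / 2))) *
        ENNReal.ofReal (t ^ 2) ^ σ) =
      ENNReal.ofReal ((√(2 * Real.pi))⁻¹ ^ d *
        (t ^ ((d : ℝ) - 1 + 2 * σ) * Real.exp (-(1 / 2) * t ^ (2 : ℝ)))) := by
    intro t ht
    have ht : 0 < t := ht
    rw [ENNReal.ofReal_rpow_of_pos (by positivity), ← ENNReal.ofReal_mul (by positivity),
      ← ENNReal.ofReal_mul (by positivity)]
    congr 1
    rw [Real.rpow_add ht, ← Real.rpow_natCast t 2, ← Real.rpow_mul ht.le,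
      ← Real.rpow_natCast t (d - 1), Nat.cast_sub hd]
    push_cast
    rw [show -(t ^ (2 : ℝ) / 2) = -(1 / 2) * t ^ (2 : ℝ) by ring]
    ring
  rw [setLIntegral_congr_fun measurableSet_Ioi hint, ← ofReal_integral_eq_lintegral_ofReal,
    integral_const_mul, integral_rpow_mul_exp_neg_mul_rpow (by norm_num) (by linarith)
      (by norm_num)]
  · rw [← ENNReal.ofReal_toReal hSt, ← ENNReal.ofReal_mul]
    · congr 1
      rw [ENNReal.toReal_ofReal ENNReal.toReal_nonneg,
        show ((d : ℝ) - 1 + 2 * σ + 1) / 2 = d / 2 + σ by ring,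
        show -((d : ℝ) - 1 + 2 * σ + 1) / 2 = -(d / 2 + σ) by ring, one_div, Real.inv_rpow
        (by norm_num), ← Real.rpow_neg (by norm_num), neg_neg, Real.rpow_add (by norm_num)]
      ring
    · have := Real.Gamma_pos_of_pos (s := (((d : ℝ) - 1 + 2 * σ + 1) / 2)) (by linarith)
      positivity
  · exact (integrableOn_rpow_mul_exp_neg (by linarith) (by norm_num)).const_mul _
  · filter_upwards [ae_restrict_mem measurableSet_Ioi] with t ht
    have ht : 0 < t := ht
    positivity

lemma gaussMoment_lt_top {d : ℕ} (hd : 1 ≤ d) {σ : ℝ} (hσ : -(1 / 2) < σ) :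
    gaussMoment d σ < ⊤ := by
  obtain ⟨C, -, h⟩ := gaussMoment_eq d hd
  rw [h σ hσ]; exact ENNReal.ofReal_lt_top

lemma lintegral_norm_stdGaussian (W : Type*) [NormedAddCommGroup W] [InnerProductSpace ℝ W]
    [FiniteDimensional ℝ W] [MeasurableSpace W] [BorelSpace W] (σ : ℝ) :
    ∫⁻ z, ENNReal.ofReal (‖z‖ ^ 2) ^ σ ∂stdGaussian W = gaussMoment (Module.finrank ℝ W) σ := by
  rw [gaussMoment, ← stdGaussian_map (stdOrthonormalBasis ℝ W).repr,
    lintegral_map (by fun_prop) (by fun_prop)]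
  simp

/-- The orthogonal projection of a standard Gaussian vector is standard Gaussian. -/
lemma map_orthogonalProjection_stdGaussian {E : Type*} [NormedAddCommGroup E]
    [InnerProductSpace ℝ E] [FiniteDimensional ℝ E] [MeasurableSpace E] [BorelSpace E]
    (W : Submodule ℝ E) :
    (stdGaussian E).map W.orthogonalProjectionOnto = stdGaussian W := by
  apply Measure.ext_of_charFun
  ext t
  rw [charFun_stdGaussian, charFun_apply, integral_map (by fun_prop) (by fun_prop)]
  have : ∀ x : E, inner ℝ (W.orthogonalProjectionOnto x) t = inner ℝ x (t : E) := by
    intro x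
    rw [← Submodule.inner_orthogonalProjectionOnto_eq_of_mem_right]
  simp only [this]
  rw [← charFun_apply, charFun_stdGaussian]
  simp

lemma measurable_gramDet {n r : ℕ} :
    Measurable (gramDet : (Fin r → EuclideanSpace ℝ (Fin n)) → ℝ) := continuous_gramDet.measurable

lemma measurable_simplexGram {n r : ℕ} :
    Measurable (simplexGram : (Fin (r + 1) → EuclideanSpace ℝ (Fin n)) → ℝ) :=
  continuous_simplexGram.measurable

/-- A finite negative moment forces positivity almost everywhere. -/
lemma ae_pos_of_lintegral_rpow_lt_top {α : Type*} [MeasurableSpace α] {μ : Measure α} {g : α → ℝ}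
    (hg : Measurable g) {σ : ℝ} (hσ : σ < 0)
    (h : ∫⁻ x, ENNReal.ofReal (g x) ^ σ ∂μ ≠ ⊤) : ∀ᵐ x ∂μ, 0 < g x := by
  filter_upwards [ae_lt_top (by fun_prop) h] with x hx
  by_contra hneg
  rw [ENNReal.ofReal_of_nonpos (not_lt.1 hneg), ENNReal.zero_rpow_of_neg hσ] at hx
  exact lt_irrefl _ hx

/-- The moments of the Gram determinant of independent standard Gaussian vectors: given the first
vectors, the distance of the next one to their span is the length of a standard Gaussian vector in
the orthogonal complement. -/
lemma lintegral_gramDet_stdGaussian {n r : ℕ} (hrn : r ≤ n) {σ : ℝ} (hσ : -(1 / 2) < σ) :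
    ∫⁻ v : Fin r → EuclideanSpace ℝ (Fin n), ENNReal.ofReal (gramDet v) ^ σ
      ∂Measure.pi (fun _ => stdGaussian (EuclideanSpace ℝ (Fin n))) =
      ∏ j ∈ Finset.range r, gaussMoment (n - j) σ := by
  induction r generalizing σ with
  | zero => simp [gramDet]
  | succ r ih =>
    -- The induction hypothesis at a negative order gives linear independence almost surely.
    have hae : ∀ᵐ v ∂Measure.pi (fun _ : Fin r => stdGaussian (EuclideanSpace ℝ (Fin n))),
        0 < gramDet v := by
      refine ae_pos_of_lintegral_rpow_lt_top measurable_gramDet (σ := -(1 / 4)) (by norm_num) ?_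
      rw [ih (by omega) (by norm_num)]
      refine ENNReal.prod_ne_top fun j hj => (gaussMoment_lt_top ?_ (by norm_num)).ne
      have := Finset.mem_range.1 hj
      omega
    rw [lintegral_pi_cons _ (measurable_gramDet.ennreal_ofReal.pow_const σ),
      Finset.prod_range_succ, ← ih (by omega) hσ, ← lintegral_mul_const]
    · refine lintegral_congr_ae ?_
      filter_upwards [hae] with v hv
      have hli := (gramDet_ne_zero_iff v).1 hv.ne'
      let W := (Submodule.span ℝ (Set.range v))ᗮ
      have hW : Module.finrank ℝ W = n - r := by
        refine Submodule.finrank_add_finrank_orthogonal' ?_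
        rw [finrank_span_eq_card hli, Fintype.card_fin, finrank_euclideanSpace, Fintype.card_fin]
        omega
      have hz : ∀ z : EuclideanSpace ℝ (Fin n),
          gramDet (Fin.cons z v : Fin (r + 1) → EuclideanSpace ℝ (Fin n)) =
            ‖W.orthogonalProjectionOnto z‖ ^ 2 * gramDet v := by
        intro z
        have h1 : z = (z - (W.orthogonalProjectionOnto z : EuclideanSpace ℝ (Fin n))) +
          (W.orthogonalProjectionOnto z : EuclideanSpace ℝ (Fin n)) := by abel
        conv_lhs => rw [h1]
        rw [gramDet_cons_add]
        · simp
        · intro i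
          rw [real_inner_comm]
          exact (W.orthogonalProjectionOnto z).2 _ (Submodule.subset_span (Set.mem_range_self i))
        · have h2 := W.sub_starProjection_mem_orthogonal z
          rwa [Submodule.orthogonal_orthogonal] at h2
      simp only [hz]
      rw [← hW, ← lintegral_norm_stdGaussian, ← map_orthogonalProjection_stdGaussian,
        lintegral_map (by fun_prop) (by fun_prop), ← lintegral_const_mul _ (by fun_prop)]
      refine lintegral_congr fun z => ?_
      rw [ENNReal.ofReal_mul (by positivity), ENNReal.mul_rpow_of_ne_top ENNReal.ofReal_ne_top
        ENNReal.ofReal_ne_top, mul_comm]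
    · exact measurable_gramDet.ennreal_ofReal.pow_const σ

/-- Independent standard Gaussian vectors are invariant under orthogonal mixing. -/
lemma map_orthogonal_pi_stdGaussian {n m : ℕ} (c : Fin m → Fin m → ℝ)
    (hc : ∀ i k, ∑ j, c i j * c k j = if i = k then 1 else 0) :
    (Measure.pi (fun _ : Fin m => stdGaussian (EuclideanSpace ℝ (Fin n)))).map
      (fun z i => ∑ j, c i j • z j) =
      Measure.pi (fun _ : Fin m => stdGaussian (EuclideanSpace ℝ (Fin n))) := by
  have hmeas : Measurable fun (z : Fin m → EuclideanSpace ℝ (Fin n)) (i : Fin m) =>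
      ∑ j, c i j • z j := by fun_prop
  have key : ((Measure.pi (fun _ : Fin m => stdGaussian (EuclideanSpace ℝ (Fin n)))).map
      (fun z i => ∑ j, c i j • z j)).map
        (WithLp.toLp 2 : _ → PiLp 2 fun _ : Fin m => EuclideanSpace ℝ (Fin n)) =
      (Measure.pi (fun _ : Fin m => stdGaussian (EuclideanSpace ℝ (Fin n)))).map
        (WithLp.toLp 2 : _ → PiLp 2 fun _ : Fin m => EuclideanSpace ℝ (Fin n)) := by
    apply Measure.ext_of_charFun
    ext t
    rw [charFun_pi]
    let t' : PiLp 2 fun _ : Fin m => EuclideanSpace ℝ (Fin n) :=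
      WithLp.toLp 2 fun j => ∑ i, c i j • t i
    have h1 : charFun (((Measure.pi (fun _ : Fin m => stdGaussian (EuclideanSpace ℝ (Fin n)))).map
        (fun z i => ∑ j, c i j • z j)).map
        (WithLp.toLp 2 : _ → PiLp 2 fun _ : Fin m => EuclideanSpace ℝ (Fin n))) t =
        charFun ((Measure.pi (fun _ : Fin m => stdGaussian (EuclideanSpace ℝ (Fin n)))).map
        (WithLp.toLp 2 : _ → PiLp 2 fun _ : Fin m => EuclideanSpace ℝ (Fin n))) t' := by
      rw [Measure.map_map (WithLp.measurable_toLp 2 _) hmeas, charFun_apply, charFun_apply,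
        integral_map ((WithLp.measurable_toLp 2 _).comp hmeas).aemeasurable (by fun_prop),
        integral_map (WithLp.measurable_toLp 2 _).aemeasurable (by fun_prop)]
      refine integral_congr_ae (ae_of_all _ fun z => ?_)
      simp only [Function.comp_apply]
      rw [PiLp.inner_apply, PiLp.inner_apply]
      simp only [t', sum_inner, inner_sum, real_inner_smul_left, real_inner_smul_right]
      rw [Finset.sum_comm]
    rw [h1, charFun_pi]
    simp only [charFun_stdGaussian, ← Complex.exp_sum]
    congr 1
    have h2 : ∑ j, ‖t' j‖ ^ 2 = ∑ i, ‖t i‖ ^ 2 := by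
      have : ∀ j, ‖t' j‖ ^ 2 = ∑ i, ∑ k, c i j * c k j * inner ℝ (t i) (t k) := by
        intro j
        simp only [← real_inner_self_eq_norm_sq, t', sum_inner, inner_sum,
          real_inner_smul_left, real_inner_smul_right]
        refine (Finset.sum_comm).trans
          (Finset.sum_congr rfl fun i _ => Finset.sum_congr rfl fun k _ => ?_)
        ring
      simp only [this]
      rw [Finset.sum_comm]
      refine Finset.sum_congr rfl fun i _ => ?_
      rw [Finset.sum_comm]
      simp [← Finset.sum_mul, hc]
    have h3 := congrArg (fun x : ℝ => (x : ℂ)) h2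
    push_cast at h3
    simp only [neg_div, Finset.sum_neg_distrib, ← Finset.sum_div]
    rw [h3]
  have h2 := congrArg (fun μ => Measure.map WithLp.ofLp μ) key
  simp only at h2
  rw [Measure.map_map (WithLp.measurable_ofLp 2 _) (WithLp.measurable_toLp 2 _),
    Measure.map_map (WithLp.measurable_ofLp 2 _) (WithLp.measurable_toLp 2 _)] at h2
  have h3 : (WithLp.ofLp : (PiLp 2 fun _ : Fin m => EuclideanSpace ℝ (Fin n)) → _) ∘
    (WithLp.toLp 2) = id := rfl
  rwa [h3, Measure.map_id, Measure.map_id] at h2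

/-- There is an orthogonal matrix with prescribed first column. -/
lemma exists_orthogonal_matrix {m : ℕ} (u : Fin (m + 1) → ℝ) (hu : ∑ i, u i ^ 2 = 1) :
    ∃ c : Fin (m + 1) → Fin (m + 1) → ℝ, (∀ i, c i 0 = u i) ∧
      ∀ i k, ∑ j, c i j * c k j = if i = k then 1 else 0 := by
  let v : Fin (m + 1) → EuclideanSpace ℝ (Fin (m + 1)) := fun _ => WithLp.toLp 2 u
  have hv : Orthonormal ℝ (({0} : Set (Fin (m + 1))).domRestrict v) := by
    refine ⟨fun i => ?_, fun i j hij => (hij (Subsingleton.elim _ _)).elim⟩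
    simpa [v, EuclideanSpace.norm_eq] using hu
  obtain ⟨b, hb⟩ := hv.exists_orthonormalBasis_extension_of_card_eq (by simp)
  refine ⟨fun i j => b j i, fun i => ?_, fun i k => ?_⟩
  · change b 0 i = u i
    rw [hb 0 rfl]
  · have := b.sum_inner_mul_inner (EuclideanSpace.single i (1 : ℝ)) (EuclideanSpace.single k 1)
    simp only [EuclideanSpace.inner_single_left, EuclideanSpace.inner_single_right] at this
    simpa [Pi.single_apply, eq_comm] using this

/-- After an orthogonal mixing adapted to the weights, the edge vectors of the simplex with vertices
`w_i ^ (-1/2) z_i` no longer involve the first mixed vector. -/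
lemma simplexGram_mixed {n r : ℕ} (w : Fin (r + 1) → ℝ) (hw : ∀ i, 0 < w i)
    (c : Fin (r + 1) → Fin (r + 1) → ℝ) (hc0 : ∀ i, c i 0 = √(w i) / √(∑ i, w i))
    (hc : ∀ i k, ∑ j, c i j * c k j = if i = k then 1 else 0)
    (z : Fin (r + 1) → EuclideanSpace ℝ (Fin n)) :
    simplexGram (fun i => (√(w i))⁻¹ • ∑ j, c i j • z j) =
      (∑ i, w i) / (∏ i, w i) * gramDet (fun j : Fin r => z j.succ) := by
  have hsq : ∀ i, 0 < √(w i) := fun i => Real.sqrt_pos.2 (hw i)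
  let B' : Fin r → Fin (r + 1) → ℝ := fun i j => (√(w i.succ))⁻¹ * c i.succ j - (√(w 0))⁻¹ * c 0 j
  let B : Matrix (Fin r) (Fin r) ℝ := Matrix.of fun i j => B' i j.succ
  have hB0 : ∀ i, B' i 0 = 0 := by
    intro i
    simp only [B', hc0]
    have := hsq i.succ
    have := hsq 0
    field_simp
    ring
  have h1 : simplexGram (fun i => (√(w i))⁻¹ • ∑ j, c i j • z j) =
      gramDet (fun i => ∑ j, B i j • z j.succ) := by
    rw [simplexGram]
    congr 1
    ext1 i
    have : (√(w i.succ))⁻¹ • ∑ j, c i.succ j • z j - (√(w 0))⁻¹ • ∑ j, c 0 j • z j =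
        ∑ j, B' i j • z j := by
      simp only [Finset.smul_sum, ← Finset.sum_sub_distrib, smul_smul, ← sub_smul, B']
    rw [this, Fin.sum_univ_succ, hB0, zero_smul, zero_add]
    rfl
  rw [h1, gramDet_linear]
  congr 1
  have hBB : B * B.transpose =
      Matrix.diagonal (fun i : Fin r => (w i.succ)⁻¹) *
        (1 + Matrix.replicateCol Unit (fun i : Fin r => w i.succ) *
          Matrix.replicateRow Unit (fun _ : Fin r => (w 0)⁻¹)) := by
    ext i k
    have e1 : (B * B.transpose) i k = ∑ j, B' i j * B' k j := by
      rw [Fin.sum_univ_succ, hB0, zero_mul, zero_add]; rfl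
    have e2 : ∑ j, B' i j * B' k j = (√(w i.succ))⁻¹ * (√(w k.succ))⁻¹ *
        (∑ j, c i.succ j * c k.succ j) - (√(w i.succ))⁻¹ * (√(w 0))⁻¹ * (∑ j, c i.succ j * c 0 j) -
        (√(w 0))⁻¹ * (√(w k.succ))⁻¹ * (∑ j, c 0 j * c k.succ j) +
        (√(w 0))⁻¹ * (√(w 0))⁻¹ * (∑ j, c 0 j * c 0 j) := by
      simp only [B', Finset.mul_sum, ← Finset.sum_sub_distrib, ← Finset.sum_add_distrib]
      refine Finset.sum_congr rfl fun j _ => by ring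
    have e3 : ∀ i, (√(w i))⁻¹ * (√(w i))⁻¹ = (w i)⁻¹ := fun i => by
      rw [← mul_inv, Real.mul_self_sqrt (hw i).le]
    rw [e1, e2, hc, hc, hc, hc, e3, Matrix.diagonal_mul, Matrix.add_apply, Matrix.mul_apply]
    simp only [Fin.succ_inj, Fin.succ_ne_zero, (Fin.succ_ne_zero _).symm, if_false, if_true,
      mul_zero, sub_zero, mul_one, Matrix.one_apply, Finset.univ_unique, Finset.sum_singleton,
      Matrix.replicateCol_apply, Matrix.replicateRow_apply]
    by_cases hik : i = k
    · subst hik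
      have := (hw i.succ).ne'
      simp only [if_true, mul_one, e3]
      field_simp
    · have := (hw i.succ).ne'
      simp only [hik, if_false]
      field_simp
      ring
  have hdet : B.det ^ 2 = (B * B.transpose).det := by
    rw [Matrix.det_mul, Matrix.det_transpose, sq]
  rw [hdet, hBB, Matrix.det_mul, Matrix.det_diagonal,
    Matrix.det_one_add_replicateCol_mul_replicateRow]
  rw [Fin.prod_univ_succ, Fin.sum_univ_succ, Finset.prod_inv_distrib]
  simp only [dotProduct, ← Finset.mul_sum]
  have := (hw 0).ne'
  have : (∏ i : Fin r, w i.succ) ≠ 0 := (Finset.prod_pos fun i _ => hw i.succ).ne'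
  field_simp

/-- The moments of the Gram determinant of the simplex whose vertices are independent centred
Gaussian vectors with variances `1 / w_i`. -/
lemma lintegral_simplexGram_stdGaussian {n r : ℕ} (hrn : r ≤ n) {σ : ℝ} (hσ : -(1 / 2) < σ)
    (w : Fin (r + 1) → ℝ) (hw : ∀ i, 0 < w i) :
    ∫⁻ y, ENNReal.ofReal (simplexGram fun i => (√(w i))⁻¹ • y i) ^ σ
      ∂Measure.pi (fun _ : Fin (r + 1) => stdGaussian (EuclideanSpace ℝ (Fin n))) =
      ENNReal.ofReal ((∑ i, w i) / ∏ i, w i) ^ σ *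
        ∏ j ∈ Finset.range r, gaussMoment (n - j) σ := by
  have hsum : 0 < ∑ i, w i := Finset.sum_pos (fun i _ => hw i) Finset.univ_nonempty
  obtain ⟨c, hc0, hc⟩ := exists_orthogonal_matrix (fun i => √(w i) / √(∑ i, w i)) (by
    simp only [div_pow, Real.sq_sqrt (hw _).le, Real.sq_sqrt hsum.le, ← Finset.sum_div]
    exact div_self hsum.ne')
  have hm : Measurable fun y : Fin (r + 1) → EuclideanSpace ℝ (Fin n) =>
      ENNReal.ofReal (simplexGram fun i => (√(w i))⁻¹ • y i) ^ σ :=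
    (measurable_simplexGram.comp (by fun_prop)).ennreal_ofReal.pow_const σ
  conv_lhs => rw [← map_orthogonal_pi_stdGaussian c hc]
  rw [lintegral_map hm (by fun_prop)]
  simp only [simplexGram_mixed w hw c hc0 hc]
  rw [← lintegral_gramDet_stdGaussian hrn hσ, lintegral_pi_cons]
  · simp only [Fin.cons_succ, lintegral_const, measure_univ, mul_one]
    rw [← lintegral_const_mul _ (measurable_gramDet.ennreal_ofReal.pow_const σ)]
    refine lintegral_congr fun z => ?_
    rw [ENNReal.ofReal_mul, ENNReal.mul_rpow_of_ne_top ENNReal.ofReal_ne_top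
        ENNReal.ofReal_ne_top]
    exact div_nonneg hsum.le (Finset.prod_nonneg fun i _ => (hw i).le)
  · exact ((measurable_gramDet.comp (by fun_prop)).const_mul _).ennreal_ofReal.pow_const σ

end RandomSimplex

/-! ### The radial Laplace transform -/

namespace RandomSimplex

/-- The bounded continuous function `exp (-ρ_i²)` of the vector of radii. -/
noncomputable def expNegSq {m : ℕ} (i : Fin m) :
    BoundedContinuousFunction (Fin m → Set.Ioi (0 : ℝ)) ℝ :=
  BoundedContinuousFunction.ofNormedAddCommGroup (fun ρ => Real.exp (-(ρ i).1 ^ 2)) (by fun_prop) 1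
    fun ρ => by
      rw [Real.norm_of_nonneg (Real.exp_pos _).le, Real.exp_le_one_iff]
      have := sq_nonneg (ρ i).1
      linarith

lemma expNegSq_apply {m : ℕ} (i : Fin m) (ρ : Fin m → Set.Ioi (0 : ℝ)) :
    expNegSq i ρ = Real.exp (-(ρ i).1 ^ 2) := rfl

/-- The Laplace kernel `∏ exp (-w_i ρ_i²)`. -/
noncomputable def laplaceKernel {m : ℕ} (w : Fin m → ℝ) (ρ : Fin m → Set.Ioi (0 : ℝ)) : ENNReal :=
  ∏ i, ENNReal.ofReal (Real.exp (-(w i) * (ρ i).1 ^ 2))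

lemma measurable_laplaceKernel {m : ℕ} (w : Fin m → ℝ) : Measurable (laplaceKernel w) := by
  unfold laplaceKernel; fun_prop

lemma laplaceKernel_add {m : ℕ} (v w : Fin m → ℝ) (ρ : Fin m → Set.Ioi (0 : ℝ)) :
    laplaceKernel (v + w) ρ = laplaceKernel v ρ * laplaceKernel w ρ := by
  rw [laplaceKernel, laplaceKernel, laplaceKernel, ← Finset.prod_mul_distrib]
  refine Finset.prod_congr rfl fun i _ => ?_
  rw [← ENNReal.ofReal_mul (Real.exp_pos _).le, ← Real.exp_add, Pi.add_apply]
  ring_nf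

lemma laplaceKernel_eq {m : ℕ} (w : Fin m → ℝ) (ρ : Fin m → Set.Ioi (0 : ℝ)) :
    laplaceKernel w ρ = ENNReal.ofReal (∏ i, Real.exp (-(w i) * (ρ i).1 ^ 2)) :=
  (ENNReal.ofReal_prod_of_nonneg fun _ _ => (Real.exp_pos _).le).symm

/-- Two functions of the radii whose Laplace transforms in the squared radii are finite and agree at
all vectors of positive integers agree almost everywhere: polynomials in the `exp (-ρ_i²)` separate
points. -/
lemma ae_eq_of_laplace_eq {m : ℕ} {μ : Measure (Fin m → Set.Ioi (0 : ℝ))} [SigmaFinite μ]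
    {f g : (Fin m → Set.Ioi (0 : ℝ)) → ENNReal} (hf : Measurable f) (hg : Measurable g)
    (hfin : ∫⁻ ρ, f ρ * laplaceKernel 1 ρ ∂μ ≠ ⊤)
    (h : ∀ w : Fin m → ℕ, ∫⁻ ρ, f ρ * laplaceKernel (fun i => (w i : ℝ) + 1) ρ ∂μ =
      ∫⁻ ρ, g ρ * laplaceKernel (fun i => (w i : ℝ) + 1) ρ ∂μ) : f =ᵐ[μ] g := by
  have : PolishSpace (Set.Ioi (0 : ℝ)) := isOpen_Ioi.polishSpace
  have hk1 : ∀ w : Fin m → ℕ, (fun i => (w i : ℝ) + 1) = (1 : Fin m → ℝ) + fun i => (w i : ℝ) :=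
    fun w => by ext i; simp [add_comm]
  have hfg1 : ∫⁻ ρ, f ρ * laplaceKernel 1 ρ ∂μ = ∫⁻ ρ, g ρ * laplaceKernel 1 ρ ∂μ := by
    have := h 0
    simp only [Pi.zero_apply, Nat.cast_zero, zero_add] at this
    exact this
  have hmf : Measurable fun ρ => f ρ * laplaceKernel 1 ρ := hf.mul (measurable_laplaceKernel _)
  have hmg : Measurable fun ρ => g ρ * laplaceKernel 1 ρ := hg.mul (measurable_laplaceKernel _)
  set Pf := μ.withDensity fun ρ => f ρ * laplaceKernel 1 ρ with hPf
  set Pg := μ.withDensity fun ρ => g ρ * laplaceKernel 1 ρ with hPg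
  have : IsFiniteMeasure Pf := isFiniteMeasure_withDensity hfin
  have : IsFiniteMeasure Pg := isFiniteMeasure_withDensity (hfg1 ▸ hfin)
  let A : StarSubalgebra ℝ (BoundedContinuousFunction (Fin m → Set.Ioi (0 : ℝ)) ℝ) :=
    { (MvPolynomial.aeval (R := ℝ) (expNegSq (m := m))).range with
      star_mem' := fun {a} ha => by
        have : star a = a := by ext x; simp
        rw [this]; exact ha }
  have hmon : ∀ u : Fin m →₀ ℕ, ∫ ρ, (∏ i, Real.exp (-(u i : ℝ) * (ρ i).1 ^ 2)) ∂Pf =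
      ∫ ρ, (∏ i, Real.exp (-(u i : ℝ) * (ρ i).1 ^ 2)) ∂Pg := by
    intro u
    rw [integral_eq_lintegral_of_nonneg_ae
        (ae_of_all _ fun ρ => Finset.prod_nonneg fun i _ => (Real.exp_pos _).le)
        (Measurable.aestronglyMeasurable (by fun_prop)),
      integral_eq_lintegral_of_nonneg_ae
        (ae_of_all _ fun ρ => Finset.prod_nonneg fun i _ => (Real.exp_pos _).le)
        (Measurable.aestronglyMeasurable (by fun_prop))]
    simp only [← laplaceKernel_eq fun i => (u i : ℝ)]
    rw [hPf, hPg, lintegral_withDensity_eq_lintegral_mul _ hmf (measurable_laplaceKernel _),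
      lintegral_withDensity_eq_lintegral_mul _ hmg (measurable_laplaceKernel _)]
    have := h u
    simp only [hk1, laplaceKernel_add, ← mul_assoc] at this
    simp only [Pi.mul_apply]
    rw [this]
  have hPP : Pf = Pg := by
    refine ext_of_forall_mem_subalgebra_integral_eq_of_polish (𝕜 := ℝ) (A := A) ?_ ?_
    · intro x y hxy
      obtain ⟨i, hi⟩ := Function.ne_iff.1 hxy
      refine ⟨_, ⟨_, ⟨expNegSq i, ⟨MvPolynomial.X i, ?_⟩, rfl⟩, rfl⟩, ?_⟩
      · exact MvPolynomial.aeval_X _ _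
      · change Real.exp (-(x i).1 ^ 2) ≠ Real.exp (-(y i).1 ^ 2)
        intro heq
        have h1 : (x i).1 ^ 2 = (y i).1 ^ 2 := by
          have := Real.exp_injective heq
          linarith
        have hx : 0 < (x i).1 := (x i).2
        have hy : 0 < (y i).1 := (y i).2
        exact hi (Subtype.ext ((sq_eq_sq₀ hx.le hy.le).1 h1))
    · rintro _ ⟨p, rfl⟩
      change ∫ x, (MvPolynomial.aeval (expNegSq (m := m)) p) x ∂Pf =
        ∫ x, (MvPolynomial.aeval (expNegSq (m := m)) p) x ∂Pg
      induction p using MvPolynomial.induction_on' with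
      | monomial u a =>
        have : ∀ x, (MvPolynomial.aeval (expNegSq (m := m)) (MvPolynomial.monomial u a)) x =
            a * ∏ i, Real.exp (-(u i : ℝ) * (x i).1 ^ 2) := by
          intro x
          have he : ∀ i, Real.exp (-(u i : ℝ) * (x i).1 ^ 2) = expNegSq i x ^ u i := by
            intro i
            rw [expNegSq_apply, ← Real.exp_nat_mul]
            ring_nf
          have hprod : ∀ s : Finset (Fin m),
              (∏ i ∈ s, expNegSq i ^ u i : BoundedContinuousFunction _ ℝ) x =
              ∏ i ∈ s, expNegSq i x ^ u i := by
            intro s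
            simp
          rw [MvPolynomial.aeval_monomial, Finsupp.prod_fintype _ _ (by simp)]
          simp only [he, ← hprod]
          simp [BoundedContinuousFunction.algebraMap_apply]
        simp only [this, integral_const_mul, hmon u]
      | add p q hp hq =>
        simp only [map_add, BoundedContinuousFunction.add_apply]
        rw [integral_add (BoundedContinuousFunction.integrable _ _)
          (BoundedContinuousFunction.integrable _ _),
          integral_add (BoundedContinuousFunction.integrable _ _)
          (BoundedContinuousFunction.integrable _ _), hp, hq]
  have hae := (withDensity_eq_iff_of_sigmaFinite hmf.aemeasurable hmg.aemeasurable).1 hPP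
  filter_upwards [hae] with ρ hρ
  have h0 : laplaceKernel 1 ρ ≠ 0 := by
    rw [laplaceKernel_eq]
    exact (ENNReal.ofReal_pos.2 (Finset.prod_pos fun i _ => Real.exp_pos _)).ne'
  have ht : laplaceKernel 1 ρ ≠ ⊤ := by
    rw [laplaceKernel_eq]; exact ENNReal.ofReal_ne_top
  exact (ENNReal.mul_left_inj h0 ht).1 hρ

/-- The negative moment of order `κ` of the squared simplex volume when the directions of the
vertices are independent and uniform on the sphere (with the non-normalized surface measure), as a
function of the distances of the vertices from the origin. -/
noncomputable def radialMoment {n r : ℕ} (κ : ℝ) (ρ : Fin (r + 1) → Set.Ioi (0 : ℝ)) : ENNReal :=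
  ∫⁻ u : Fin (r + 1) → Metric.sphere (0 : EuclideanSpace ℝ (Fin n)) 1,
    ENNReal.ofReal (simplexGram fun i => polarVec (u i, ρ i)) ^ (-κ)
    ∂Measure.pi fun _ => (volume : Measure (EuclideanSpace ℝ (Fin n))).toSphere

lemma measurable_polar_simplexGram {n r : ℕ} (κ : ℝ) :
    Measurable fun q : (Fin (r + 1) → Set.Ioi (0 : ℝ)) ×
      (Fin (r + 1) → Metric.sphere (0 : EuclideanSpace ℝ (Fin n)) 1) =>
      ENNReal.ofReal (simplexGram fun i => polarVec (q.2 i, q.1 i)) ^ (-κ) := by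
  refine Measurable.pow_const (Measurable.ennreal_ofReal (measurable_simplexGram.comp ?_)) _
  exact measurable_pi_lambda _ fun i => continuous_polarVec.measurable.comp (by fun_prop)

lemma measurable_polar_simplexGram_right {n r : ℕ} (κ : ℝ) (ρ : Fin (r + 1) → Set.Ioi (0 : ℝ)) :
    Measurable fun u : Fin (r + 1) → Metric.sphere (0 : EuclideanSpace ℝ (Fin n)) 1 =>
      ENNReal.ofReal (simplexGram fun i => polarVec (u i, ρ i)) ^ (-κ) := by
  refine Measurable.pow_const (Measurable.ennreal_ofReal (measurable_simplexGram.comp ?_)) _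
  exact measurable_pi_lambda _ fun i => continuous_polarVec.measurable.comp (by fun_prop)

lemma measurable_radialMoment {n r : ℕ} (κ : ℝ) :
    Measurable (radialMoment (n := n) (r := r) κ) :=
  (measurable_polar_simplexGram κ).lintegral_prod_right

/-- Rotation invariant weights are integrated against the radial moment. -/
lemma lintegral_simplexGram_radial {n r : ℕ} (hn : 1 ≤ n) (κ : ℝ) {f : Fin (r + 1) → ℝ → ENNReal}
    (hf : ∀ i, Measurable (f i)) :
    ∫⁻ x : Fin (r + 1) → EuclideanSpace ℝ (Fin n),
      ENNReal.ofReal (simplexGram x) ^ (-κ) * ∏ i, f i ‖x i‖ ∂Measure.pi (fun _ => volume) =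
      ∫⁻ ρ, radialMoment (n := n) κ ρ * ∏ i, f i (ρ i).1
        ∂Measure.pi fun _ => Measure.volumeIoiPow (n - 1) := by
  rw [lintegral_pi_polar hn]
  · refine lintegral_congr fun ρ => ?_
    simp only [norm_polarVec]
    have hmu := measurable_polar_simplexGram_right (n := n) κ ρ
    rw [radialMoment, lintegral_mul_const _ hmu]
  · exact (measurable_simplexGram.ennreal_ofReal.pow_const _).mul
      (Finset.measurable_prod _ fun i _ => (hf i).comp (by fun_prop))

/-- The distribution of a scaled standard Gaussian vector. -/
lemma map_smul_stdGaussian (n : ℕ) {c : ℝ} (hc : 0 < c) :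
    (stdGaussian (EuclideanSpace ℝ (Fin n))).map (fun y => c⁻¹ • y) =
      volume.withDensity fun x =>
        ENNReal.ofReal ((√(2 * Real.pi))⁻¹ ^ n * c ^ n * Real.exp (-(c ^ 2 / 2) * ‖x‖ ^ 2)) := by
  have hm : Measurable fun y : EuclideanSpace ℝ (Fin n) => c⁻¹ • y := by fun_prop
  have hm' : Measurable fun y : EuclideanSpace ℝ (Fin n) => c • y := by fun_prop
  have hvol : (volume : Measure (EuclideanSpace ℝ (Fin n))) =
      ENNReal.ofReal (c ^ n) • volume.map (fun y => c • y) := by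
    rw [Measure.map_addHaar_smul _ hc.ne', finrank_euclideanSpace, Fintype.card_fin, smul_smul,
      ← ENNReal.ofReal_mul (by positivity), abs_of_pos (by positivity),
      mul_inv_cancel₀ (by positivity), ENNReal.ofReal_one, one_smul]
  refine Measure.ext_of_lintegral _ fun f hf => ?_
  rw [lintegral_map hf hm, stdGaussian_eq_withDensity,
    lintegral_withDensity_eq_lintegral_mul _ (by fun_prop) (by fun_prop),
    lintegral_withDensity_eq_lintegral_mul _ (by fun_prop) hf]
  simp only [Pi.mul_apply]
  conv_lhs => rw [hvol]
  rw [lintegral_smul_measure, lintegral_map (by fun_prop) hm', smul_eq_mul,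
    ← lintegral_const_mul _ (by fun_prop)]
  refine lintegral_congr fun x => ?_
  rw [smul_smul, inv_mul_cancel₀ hc.ne', one_smul, ← mul_assoc,
    ← ENNReal.ofReal_mul (by positivity), norm_smul, Real.norm_of_nonneg hc.le]
  congr 2
  ring_nf

lemma lintegral_gauss_scaled {n r : ℕ} (w : Fin (r + 1) → ℝ) (hw : ∀ i, 0 < w i)
    {F : (Fin (r + 1) → EuclideanSpace ℝ (Fin n)) → ENNReal} (hF : Measurable F) :
    ∫⁻ y, F (fun i => (√(2 * w i))⁻¹ • y i)
      ∂Measure.pi (fun _ : Fin (r + 1) => stdGaussian (EuclideanSpace ℝ (Fin n))) =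
      ENNReal.ofReal (∏ i, ((√(2 * Real.pi))⁻¹ ^ n * √(2 * w i) ^ n)) *
      ∫⁻ x, F x * ∏ i, ENNReal.ofReal (Real.exp (-(w i) * ‖x i‖ ^ 2))
        ∂Measure.pi (fun _ => volume) := by
  have hs : ∀ i, 0 < √(2 * w i) := fun i => Real.sqrt_pos.2 (mul_pos two_pos (hw i))
  have hprob : ∀ i, IsProbabilityMeasure
      ((stdGaussian (EuclideanSpace ℝ (Fin n))).map (fun y => (√(2 * w i))⁻¹ • y)) :=
    fun i => Measure.isProbabilityMeasure_map (by fun_prop)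
  have hprob' : ∀ i, SigmaFinite ((volume : Measure (EuclideanSpace ℝ (Fin n))).withDensity fun x =>
        ENNReal.ofReal ((√(2 * Real.pi))⁻¹ ^ n * √(2 * w i) ^ n *
          Real.exp (-(√(2 * w i) ^ 2 / 2) * ‖x‖ ^ 2))) := by
    intro i
    have := hprob i
    rw [← map_smul_stdGaussian n (hs i)]
    infer_instance
  have h1 := Measure.pi_map_pi (μ := fun _ : Fin (r + 1) => stdGaussian (EuclideanSpace ℝ (Fin n)))
    (f := fun i y => (√(2 * w i))⁻¹ • y) (fun i => by fun_prop)
  simp only [map_smul_stdGaussian n (hs _)] at h1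
  rw [pi_withDensity (fun _ => volume) fun i => by fun_prop] at h1
  have h2 : ∫⁻ y, F (fun i => (√(2 * w i))⁻¹ • y i)
      ∂Measure.pi (fun _ : Fin (r + 1) => stdGaussian (EuclideanSpace ℝ (Fin n))) =
      ∫⁻ y, F y ∂((Measure.pi (fun _ : Fin (r + 1) => stdGaussian (EuclideanSpace ℝ (Fin n)))).map
        (fun x i => (√(2 * w i))⁻¹ • x i)) := by
    rw [lintegral_map hF (by fun_prop)]
  rw [h2, h1, lintegral_withDensity_eq_lintegral_mul _ (by fun_prop) hF,
    ← lintegral_const_mul _ (by fun_prop)]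
  refine lintegral_congr fun x => ?_
  simp only [Pi.mul_apply]
  rw [mul_comm (F x), ← mul_assoc, ← ENNReal.ofReal_prod_of_nonneg fun i _ => (Real.exp_pos _).le,
    ← ENNReal.ofReal_prod_of_nonneg fun i _ => by have := hs i; positivity,
    ← ENNReal.ofReal_mul (Finset.prod_nonneg fun i _ => by have := hs i; positivity),
    ← Finset.prod_mul_distrib]
  congr 3
  ext i
  rw [Real.sq_sqrt (by have := hw i; positivity)]
  ring_nf

/-- The Laplace transform of the radial moment in the squared radii. -/
lemma laplace_radialMoment {n r : ℕ} (hn : 1 ≤ n) (hrn : r ≤ n) : ∃ K : ℝ, 0 < K ∧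
    ∀ κ : ℝ, 0 < κ → κ < 1 / 2 → ∀ w : Fin (r + 1) → ℝ, (∀ i, 0 < w i) →
    ∫⁻ ρ, radialMoment (n := n) κ ρ * laplaceKernel w ρ
        ∂Measure.pi (fun _ => Measure.volumeIoiPow (n - 1)) =
      ENNReal.ofReal (K * (∏ j ∈ Finset.range r, Real.Gamma (((n : ℝ) - j) / 2 - κ)) *
        ((∏ i, (w i) ^ (-((n : ℝ) / 2 - κ))) * (∑ i, w i) ^ (-κ))) := by
  have hex : ∀ j, ∃ C : ℝ, 0 < C ∧ ∀ σ : ℝ, -(1 / 2) < σ → j < r →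
      gaussMoment (n - j) σ = ENNReal.ofReal (C * 2 ^ σ * Real.Gamma (((n : ℝ) - j) / 2 + σ)) := by
    intro j
    by_cases hj : j < r
    · obtain ⟨C, hC, h⟩ := gaussMoment_eq (n - j) (by omega)
      refine ⟨C, hC, fun σ hσ _ => ?_⟩
      rw [h σ hσ, Nat.cast_sub (by omega)]
    · exact ⟨1, one_pos, fun _ _ h => (hj h).elim⟩
  choose C hC hgm using hex
  set N : ℝ := ((√(2 * Real.pi))⁻¹ ^ n * √2 ^ n) ^ (r + 1) with hN
  have hNpos : 0 < N := by positivity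
  refine ⟨N⁻¹ * ∏ j ∈ Finset.range r, C j,
    mul_pos (inv_pos.2 hNpos) (Finset.prod_pos fun j _ => hC j), fun κ hκ hκ2 w hw => ?_⟩
  have hΓ : ∀ j ∈ Finset.range r, 0 < Real.Gamma (((n : ℝ) - j) / 2 - κ) := by
    intro j hj
    have : (j : ℝ) + 1 ≤ n := by
      have := Finset.mem_range.1 hj
      exact_mod_cast (by omega : j + 1 ≤ n)
    exact Real.Gamma_pos_of_pos (by linarith)
  have h1 := lintegral_gauss_scaled w hw
    (F := fun x => ENNReal.ofReal (simplexGram x) ^ (-κ))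
    ((measurable_simplexGram (n := n)).ennreal_ofReal.pow_const _)
  have hw2 : ∀ i, 0 < 2 * w i := fun i => mul_pos two_pos (hw i)
  rw [lintegral_simplexGram_stdGaussian hrn (by linarith) (fun i => 2 * w i) hw2,
    lintegral_simplexGram_radial hn κ
      (f := fun i t => ENNReal.ofReal (Real.exp (-(w i) * t ^ 2))) (fun i => by fun_prop)] at h1
  change _ = _ * ∫⁻ ρ, radialMoment (n := n) κ ρ * laplaceKernel w ρ
        ∂Measure.pi (fun _ => Measure.volumeIoiPow (n - 1)) at h1
  set I := ∫⁻ ρ, radialMoment (n := n) κ ρ * laplaceKernel w ρ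
        ∂Measure.pi (fun _ => Measure.volumeIoiPow (n - 1)) with hI
  have hsumpos : 0 < ∑ i, w i := Finset.sum_pos (fun i _ => hw i) Finset.univ_nonempty
  have hprodpos : 0 < ∏ i, w i := Finset.prod_pos fun i _ => hw i
  have e1 : ∏ j ∈ Finset.range r, gaussMoment (n - j) (-κ) =
      ENNReal.ofReal ((∏ j ∈ Finset.range r, C j) * (2 ^ (-κ)) ^ r *
        ∏ j ∈ Finset.range r, Real.Gamma (((n : ℝ) - j) / 2 - κ)) := by
    rw [Finset.prod_congr rfl fun j hj => hgm j (-κ) (by linarith) (Finset.mem_range.1 hj),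
      ← ENNReal.ofReal_prod_of_nonneg]
    · congr 1
      simp only [Finset.prod_mul_distrib, Finset.prod_const, Finset.card_range, ← sub_eq_add_neg]
    · intro j hj
      have h2 := hΓ j hj
      have h3 := hC j
      rw [← sub_eq_add_neg]
      positivity
  have hq : 0 < (∑ i, 2 * w i) / ∏ i, 2 * w i :=
    div_pos (Finset.sum_pos (fun i _ => hw2 i) Finset.univ_nonempty)
      (Finset.prod_pos fun i _ => hw2 i)
  have e2 : ((∑ i, 2 * w i) / ∏ i, 2 * w i) ^ (-κ) =
      (2 ^ κ) ^ r * ((∏ i, w i ^ κ) * (∑ i, w i) ^ (-κ)) := by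
    rw [← Finset.mul_sum, Finset.prod_mul_distrib, Finset.prod_const, Finset.card_univ,
      Fintype.card_fin, Real.finsetProd_rpow _ _ (fun i _ => (hw i).le)]
    have : 2 * ∑ i, w i = 2 * ∑ i, w i := rfl
    rw [show (2 * ∑ i, w i) / (2 ^ (r + 1) * ∏ i, w i) = (∑ i, w i) * (2 ^ r * ∏ i, w i)⁻¹ by
      rw [pow_succ]; field_simp, Real.mul_rpow hsumpos.le (by positivity),
      Real.inv_rpow (by positivity), ← Real.rpow_neg (by positivity), neg_neg,
      Real.mul_rpow (by positivity) hprodpos.le, ← Real.rpow_natCast, ← Real.rpow_mul two_pos.le,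
      ← Real.rpow_natCast, ← Real.rpow_mul two_pos.le, mul_comm (r : ℝ)]
    ring
  have e3 : ∏ i, ((√(2 * Real.pi))⁻¹ ^ n * √(2 * w i) ^ n) = N * ∏ i, (w i) ^ ((n : ℝ) / 2) := by
    rw [hN]
    have : ∏ _i : Fin (r + 1), ((√(2 * Real.pi))⁻¹ ^ n * √2 ^ n) =
        ((√(2 * Real.pi))⁻¹ ^ n * √2 ^ n) ^ (r + 1) := by simp
    rw [← this, ← Finset.prod_mul_distrib]
    refine Finset.prod_congr rfl fun i _ => ?_
    rw [Real.sqrt_mul two_pos.le (w i), mul_pow, ← mul_assoc]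
    congr 1
    rw [Real.sqrt_eq_rpow, ← Real.rpow_natCast, ← Real.rpow_mul (hw i).le]
    ring_nf
  have hc0 : 0 < N * ∏ i, (w i) ^ ((n : ℝ) / 2) :=
    mul_pos hNpos (Finset.prod_pos fun i _ => Real.rpow_pos_of_pos (hw i) _)
  rw [e1, e3, ENNReal.ofReal_rpow_of_pos hq, e2,
    ← ENNReal.ofReal_mul (mul_nonneg (by positivity) (mul_nonneg (Finset.prod_nonneg fun i _ =>
      Real.rpow_nonneg (hw i).le _) (Real.rpow_nonneg hsumpos.le _)))] at h1
  have h4 := congrArg (fun x => ENNReal.ofReal ((N * ∏ i, (w i) ^ ((n : ℝ) / 2))⁻¹) * x) h1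
  rw [← ENNReal.ofReal_mul (inv_nonneg.2 hc0.le), ← mul_assoc (ENNReal.ofReal (_)⁻¹),
    ← ENNReal.ofReal_mul (inv_nonneg.2 hc0.le), inv_mul_cancel₀ hc0.ne', ENNReal.ofReal_one,
    one_mul] at h4
  rw [← h4]
  congr 1
  have e4 : ∏ i, w i ^ (-((n : ℝ) / 2 - κ)) =
      (∏ i, (w i) ^ ((n : ℝ) / 2))⁻¹ * ∏ i, w i ^ κ := by
    rw [← Finset.prod_inv_distrib, ← Finset.prod_mul_distrib]
    refine Finset.prod_congr rfl fun i _ => ?_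
    rw [← Real.rpow_neg (hw i).le, ← Real.rpow_add (hw i)]
    ring_nf
  have e5 : ((2 : ℝ) ^ κ) ^ r * (2 ^ (-κ)) ^ r = 1 := by
    rw [← mul_pow, ← Real.rpow_add two_pos]; simp
  rw [e4, mul_inv]
  linear_combination (N⁻¹ * (∏ i, (w i) ^ ((n : ℝ) / 2))⁻¹ * (∏ i, w i ^ κ) * (∑ i, w i) ^ (-κ) *
    (∏ j ∈ Finset.range r, C j) * ∏ j ∈ Finset.range r, Real.Gamma (((n : ℝ) - j) / 2 - κ)) * e5

end RandomSimplex

/-! ### The radial density -/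

namespace RandomSimplex

/-- Substitution of the squared radius. -/
lemma lintegral_volumeIoiPow_sq {n : ℕ} (hn : 2 ≤ n) {g : ℝ → ENNReal} :
    ∫⁻ ρ, ENNReal.ofReal ((ρ.1 ^ (n - 2))⁻¹) * g (ρ.1 ^ 2) ∂Measure.volumeIoiPow (n - 1) =
      ENNReal.ofReal (1 / 2) * ∫⁻ q in Set.Ioi (0 : ℝ), g q := by
  rw [lintegral_volumeIoiPow (n - 1) (g := fun t => ENNReal.ofReal ((t ^ (n - 2))⁻¹) * g (t ^ 2))]
  have him : (fun x : ℝ => x ^ 2) '' Set.Ioi 0 = Set.Ioi 0 := by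
    ext q
    constructor
    · rintro ⟨x, hx, rfl⟩
      have : (0 : ℝ) < x := hx
      exact pow_pos this 2
    · intro hq
      exact ⟨√q, Real.sqrt_pos.2 hq, Real.sq_sqrt (le_of_lt hq)⟩
  have h := lintegral_image_eq_lintegral_abs_deriv_mul (s := Set.Ioi (0 : ℝ))
    (f := fun x : ℝ => x ^ 2) (f' := fun x => 2 * x) measurableSet_Ioi
    (fun x _ => by simpa using (hasDerivAt_pow 2 x).hasDerivWithinAt)
    (fun x hx y hy hxy => (sq_eq_sq₀ (le_of_lt hx) (le_of_lt hy)).1 hxy) g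
  rw [him] at h
  rw [h, ← lintegral_const_mul' _ _ ENNReal.ofReal_ne_top]
  refine setLIntegral_congr_fun measurableSet_Ioi fun x hx => ?_
  have hx0 : (0 : ℝ) < x := hx
  rw [← mul_assoc, ← mul_assoc, ← ENNReal.ofReal_mul (by positivity),
    ← ENNReal.ofReal_mul (by positivity), abs_of_pos (by positivity)]
  congr 2
  have : x ^ (n - 1) = x ^ (n - 2) * x := by rw [← pow_succ]; congr 1; omega
  rw [this]
  field_simp

/-- Up to a constant, the radial moment of the squared simplex volume of order `-κ`. -/
noncomputable def radialDensity (n : ℕ) {m : ℕ} (κ : ℝ) (ρ : Fin m → Set.Ioi (0 : ℝ)) : ENNReal :=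
  ∫⁻ t in Set.Ioi (0 : ℝ), ENNReal.ofReal (t ^ (κ - 1)) *
    ∏ i, (ENNReal.ofReal (((ρ i).1 ^ (n - 2))⁻¹) *
      ENNReal.ofReal ((ρ i).1 ^ 2 - t) ^ ((n : ℝ) / 2 - κ - 1))

lemma measurable_radialDensity (n : ℕ) {m : ℕ} (κ : ℝ) :
    Measurable (radialDensity n (m := m) κ) := by
  refine Measurable.lintegral_prod_right' (f := fun q : (Fin m → Set.Ioi (0 : ℝ)) × ℝ =>
    ENNReal.ofReal (q.2 ^ (κ - 1)) * ∏ i, (ENNReal.ofReal (((q.1 i).1 ^ (n - 2))⁻¹) *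
      ENNReal.ofReal ((q.1 i).1 ^ 2 - q.2) ^ ((n : ℝ) / 2 - κ - 1))) ?_
  fun_prop

/-- Integration of the radial density against a product weight in the squared radii: the factors
separate once the variable `t` is integrated last. -/
lemma lintegral_radialDensity_mul {n m : ℕ} (hn : 2 ≤ n) (κ : ℝ) {G : Fin m → ℝ → ENNReal}
    (hG : ∀ i, Measurable (G i)) :
    ∫⁻ ρ, radialDensity n κ ρ * ∏ i, G i ((ρ i).1 ^ 2)
        ∂Measure.pi (fun _ : Fin m => Measure.volumeIoiPow (n - 1)) =
      ENNReal.ofReal (1 / 2) ^ m * ∫⁻ t in Set.Ioi (0 : ℝ), ENNReal.ofReal (t ^ (κ - 1)) *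
        ∏ i, ∫⁻ q in Set.Ioi (0 : ℝ),
          ENNReal.ofReal (q - t) ^ ((n : ℝ) / 2 - κ - 1) * G i q := by
  have h1 : ∀ ρ : Fin m → Set.Ioi (0 : ℝ), radialDensity n κ ρ * ∏ i, G i ((ρ i).1 ^ 2) =
      ∫⁻ t in Set.Ioi (0 : ℝ), ENNReal.ofReal (t ^ (κ - 1)) *
        ∏ i, (ENNReal.ofReal (((ρ i).1 ^ (n - 2))⁻¹) *
          (ENNReal.ofReal ((ρ i).1 ^ 2 - t) ^ ((n : ℝ) / 2 - κ - 1) * G i ((ρ i).1 ^ 2))) := by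
    intro ρ
    rw [radialDensity, ← lintegral_mul_const _ (by fun_prop)]
    refine lintegral_congr fun t => ?_
    simp only [Finset.prod_mul_distrib]
    ring
  simp only [h1]
  rw [lintegral_lintegral_swap (by fun_prop), ← lintegral_const_mul' _ _ (by simp)]
  refine lintegral_congr fun t => ?_
  rw [lintegral_const_mul _ (by fun_prop),
    lintegral_pi_prod (fun _ : Fin m => Measure.volumeIoiPow (n - 1))
      (f := fun i ρ => ENNReal.ofReal ((ρ.1 ^ (n - 2))⁻¹) *
          (ENNReal.ofReal (ρ.1 ^ 2 - t) ^ ((n : ℝ) / 2 - κ - 1) * G i (ρ.1 ^ 2)))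
      (fun i => by fun_prop)]
  simp only [fun i => lintegral_volumeIoiPow_sq hn
    (g := fun q => ENNReal.ofReal (q - t) ^ ((n : ℝ) / 2 - κ - 1) * G i q)]
  rw [Finset.prod_mul_distrib, Finset.prod_const, Finset.card_univ, Fintype.card_fin]
  ring

lemma lintegral_Ioi_sub_rpow {t e : ℝ} (ht : 0 < t) (he : 0 < e) (G : ℝ → ENNReal) :
    ∫⁻ q in Set.Ioi (0 : ℝ), ENNReal.ofReal (q - t) ^ e * G q =
      ∫⁻ s in Set.Ioi (0 : ℝ), ENNReal.ofReal (s ^ e) * G (s + t) := by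
  rw [← lintegral_indicator measurableSet_Ioi, ← lintegral_indicator measurableSet_Ioi,
    ← lintegral_sub_right_eq_self ((Set.Ioi (0 : ℝ)).indicator
      fun s => ENNReal.ofReal (s ^ e) * G (s + t)) t]
  refine lintegral_congr fun q => ?_
  by_cases hq : t < q
  · rw [Set.indicator_of_mem (show q ∈ Set.Ioi (0 : ℝ) from ht.trans hq),
      Set.indicator_of_mem (show q - t ∈ Set.Ioi (0 : ℝ) from sub_pos.2 hq), sub_add_cancel,
      ENNReal.ofReal_rpow_of_pos (sub_pos.2 hq)]
  · rw [Set.indicator_of_notMem (show q - t ∉ Set.Ioi (0 : ℝ) from fun h => hq (sub_pos.1 h))]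
    by_cases hq0 : q ∈ Set.Ioi (0 : ℝ)
    · rw [Set.indicator_of_mem hq0, ENNReal.ofReal_of_nonpos (by linarith),
        ENNReal.zero_rpow_of_pos he, zero_mul]
    · rw [Set.indicator_of_notMem hq0]

lemma lintegral_rpow_mul_exp_neg {a w : ℝ} (ha : 0 < a) (hw : 0 < w) :
    ∫⁻ t in Set.Ioi (0 : ℝ), ENNReal.ofReal (t ^ (a - 1)) * ENNReal.ofReal (Real.exp (-w * t)) =
      ENNReal.ofReal (Real.Gamma a * w ^ (-a)) := by
  have h := Real.integral_rpow_mul_exp_neg_mul_Ioi ha hw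
  have hint : IntegrableOn (fun t : ℝ => t ^ (a - 1) * Real.exp (-(w * t))) (Set.Ioi 0) := by
    by_contra hc
    rw [integral_undef hc] at h
    have : 0 < (1 / w) ^ a * Real.Gamma a :=
      mul_pos (Real.rpow_pos_of_pos (by positivity) _) (Real.Gamma_pos_of_pos ha)
    linarith
  have h2 := ofReal_integral_eq_lintegral_ofReal hint
    ((ae_restrict_iff' measurableSet_Ioi).2 (ae_of_all _ fun t ht =>
      mul_nonneg (Real.rpow_nonneg (le_of_lt ht) _) (Real.exp_pos _).le))
  rw [h, one_div, Real.inv_rpow hw.le, ← Real.rpow_neg hw.le, mul_comm] at h2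
  rw [h2]
  refine setLIntegral_congr_fun measurableSet_Ioi fun t ht => ?_
  rw [← ENNReal.ofReal_mul (Real.rpow_nonneg (le_of_lt ht) _), neg_mul]

/-- The Laplace transform of the radial density in the squared radii. Each squared radius
contributes `Γ(n/2 - κ) w ^ (κ - n/2) exp (-t w)`, and the integral over `t` gives
`Γ(κ) (∑ w) ^ (-κ)`. -/
lemma laplace_radialDensity {n m : ℕ} (hm : 0 < m) (hn : 3 ≤ n) {κ : ℝ} (hκ : 0 < κ)
    (hκ2 : κ < 1 / 2) (w : Fin m → ℝ) (hw : ∀ i, 0 < w i) :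
    ∫⁻ ρ, radialDensity n κ ρ * laplaceKernel w ρ
        ∂Measure.pi (fun _ : Fin m => Measure.volumeIoiPow (n - 1)) =
      ENNReal.ofReal ((1 / 2) ^ m * (Real.Gamma ((n : ℝ) / 2 - κ) ^ m * Real.Gamma κ) *
        ((∏ i, (w i) ^ (-((n : ℝ) / 2 - κ))) * (∑ i, w i) ^ (-κ))) := by
  have hn3 : (3 : ℝ) ≤ n := by exact_mod_cast hn
  have hΓ : 0 < Real.Gamma ((n : ℝ) / 2 - κ) := Real.Gamma_pos_of_pos (by linarith)
  have hW : 0 ≤ ∏ i, (w i) ^ (-((n : ℝ) / 2 - κ)) :=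
    Finset.prod_nonneg fun i _ => Real.rpow_nonneg (hw i).le _
  have hsum : 0 < ∑ i, w i := by
    have : Nonempty (Fin m) := ⟨⟨0, hm⟩⟩
    exact Finset.sum_pos (fun i _ => hw i) Finset.univ_nonempty
  have h := lintegral_radialDensity_mul (m := m) (by omega : 2 ≤ n) κ
    (G := fun i q => ENNReal.ofReal (Real.exp (-(w i) * q))) (fun i => by fun_prop)
  change ∫⁻ ρ, radialDensity n κ ρ * laplaceKernel w ρ ∂_ = _ at h
  rw [h]
  have h1 : ∫⁻ t in Set.Ioi (0 : ℝ), ENNReal.ofReal (t ^ (κ - 1)) * ∏ i, ∫⁻ q in Set.Ioi (0 : ℝ),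
      ENNReal.ofReal (q - t) ^ ((n : ℝ) / 2 - κ - 1) * ENNReal.ofReal (Real.exp (-(w i) * q)) =
      ∫⁻ t in Set.Ioi (0 : ℝ), ENNReal.ofReal (Real.Gamma ((n : ℝ) / 2 - κ) ^ m *
        ∏ i, (w i) ^ (-((n : ℝ) / 2 - κ))) *
        (ENNReal.ofReal (t ^ (κ - 1)) * ENNReal.ofReal (Real.exp (-(∑ i, w i) * t))) := by
    refine setLIntegral_congr_fun measurableSet_Ioi fun t ht => ?_
    have h2 : ∀ i, ∫⁻ q in Set.Ioi (0 : ℝ), ENNReal.ofReal (q - t) ^ ((n : ℝ) / 2 - κ - 1) *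
        ENNReal.ofReal (Real.exp (-(w i) * q)) = ENNReal.ofReal (Real.exp (-(w i) * t) *
          (Real.Gamma ((n : ℝ) / 2 - κ) * (w i) ^ (-((n : ℝ) / 2 - κ)))) := by
      intro i
      rw [lintegral_Ioi_sub_rpow (t := t) ht (by linarith)
        (fun q => ENNReal.ofReal (Real.exp (-(w i) * q))), ENNReal.ofReal_mul (Real.exp_pos _).le,
        ← lintegral_rpow_mul_exp_neg (by linarith) (hw i),
        ← lintegral_const_mul' _ _ ENNReal.ofReal_ne_top]
      refine lintegral_congr fun s => ?_
      rw [mul_add, Real.exp_add, ENNReal.ofReal_mul (Real.exp_pos _).le]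
      ring
    simp only [h2]
    rw [← ENNReal.ofReal_prod_of_nonneg fun i _ => mul_nonneg (Real.exp_pos _).le
      (mul_nonneg hΓ.le (Real.rpow_nonneg (hw i).le _)), Finset.prod_mul_distrib,
      Finset.prod_mul_distrib, Finset.prod_const, Finset.card_univ, Fintype.card_fin,
      ← Real.exp_sum, ← Finset.sum_mul, Finset.sum_neg_distrib,
      ENNReal.ofReal_mul (Real.exp_pos _).le]
    ring
  rw [h1, lintegral_const_mul' _ _ ENNReal.ofReal_ne_top, lintegral_rpow_mul_exp_neg hκ hsum,
    ← ENNReal.ofReal_pow (by positivity), ← ENNReal.ofReal_mul (mul_nonneg (by positivity) hW),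
    ← ENNReal.ofReal_mul (by positivity)]
  congr 1
  ring

/-- The radial moment is a multiple of the radial density: both have the same Laplace
transform in the squared radii. -/
lemma radialMoment_ae_eq {n r : ℕ} (hn : 3 ≤ n) (hrn : r ≤ n) : ∃ K : ℝ, 0 < K ∧
    ∀ κ : ℝ, 0 < κ → κ < 1 / 2 →
    radialMoment (n := n) (r := r) κ =ᵐ[Measure.pi fun _ => Measure.volumeIoiPow (n - 1)] fun ρ =>
      ENNReal.ofReal (K * (∏ j ∈ Finset.range r, Real.Gamma (((n : ℝ) - j) / 2 - κ)) /
        (Real.Gamma ((n : ℝ) / 2 - κ) ^ (r + 1) * Real.Gamma κ)) * radialDensity n κ ρ := by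
  obtain ⟨K, hK, h⟩ := laplace_radialMoment (n := n) (r := r) (by omega) hrn
  have hn3 : (3 : ℝ) ≤ n := by exact_mod_cast hn
  refine ⟨K * 2 ^ (r + 1), by positivity, fun κ hκ hκ2 => ?_⟩
  have hΓ : 0 < Real.Gamma ((n : ℝ) / 2 - κ) := Real.Gamma_pos_of_pos (by linarith)
  have hΓκ : 0 < Real.Gamma κ := Real.Gamma_pos_of_pos hκ
  have hP : 0 < ∏ j ∈ Finset.range r, Real.Gamma (((n : ℝ) - j) / 2 - κ) := by
    refine Finset.prod_pos fun j hj => ?_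
    have : (j : ℝ) + 1 ≤ n := by
      have := Finset.mem_range.1 hj
      exact_mod_cast (by omega : j + 1 ≤ n)
    exact Real.Gamma_pos_of_pos (by linarith)
  refine ae_eq_of_laplace_eq (measurable_radialMoment κ)
    (measurable_const.mul (measurable_radialDensity n κ)) ?_ fun w => ?_
  · rw [h κ hκ hκ2 1 fun _ => one_pos]
    exact ENNReal.ofReal_ne_top
  · have hw : ∀ i, (0 : ℝ) < (w i : ℝ) + 1 := fun i => by positivity
    rw [h κ hκ hκ2 _ hw]
    simp only [mul_assoc (ENNReal.ofReal _)]
    rw [lintegral_const_mul' _ _ ENNReal.ofReal_ne_top,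
      laplace_radialDensity (m := r + 1) (Nat.succ_pos r) hn hκ hκ2 _ hw,
      ← ENNReal.ofReal_mul (by positivity)]
    congr 1
    rw [div_pow, one_pow]
    generalize Real.Gamma ((n : ℝ) / 2 - κ) = g at *
    generalize Real.Gamma κ = g' at *
    generalize ∏ j ∈ Finset.range r, Real.Gamma (((n : ℝ) - j) / 2 - κ) = p at *
    field_simp

lemma lintegral_Ioo_rpow_sub {c a b : ℝ} (hc : 0 < c) (ha : 0 < a) (hb : 0 < b) :
    ∫⁻ s in Set.Ioo (0 : ℝ) c, ENNReal.ofReal (s ^ (a - 1)) * ENNReal.ofReal ((c - s) ^ (b - 1)) =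
      ENNReal.ofReal (c ^ (a + b - 1) * beta a b) := by
  have him : (fun x : ℝ => c * x) '' Set.Ioo 0 1 = Set.Ioo 0 c := by
    rw [Set.image_mul_left_Ioo hc, mul_zero, mul_one]
  have h := lintegral_image_eq_lintegral_abs_deriv_mul (s := Set.Ioo (0 : ℝ) 1)
    (f := fun x : ℝ => c * x) (f' := fun _ => c) measurableSet_Ioo
    (fun x _ => by simpa using ((hasDerivAt_id x).const_mul c).hasDerivWithinAt)
    (fun x _ y _ hxy => mul_left_cancel₀ (ne_of_gt hc) hxy)
    (fun s => ENNReal.ofReal (s ^ (a - 1)) * ENNReal.ofReal ((c - s) ^ (b - 1)))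
  rw [him] at h
  have hbeta : ∫⁻ x in Set.Ioo (0 : ℝ) 1,
      ENNReal.ofReal (1 / beta a b * x ^ (a - 1) * (1 - x) ^ (b - 1)) = 1 := by
    rw [← lintegral_betaPDF, lintegral_betaPDF_eq_one ha hb]
  rw [h]
  have hB := beta_pos ha hb
  have hq : 0 < c ^ (a + b - 1) := Real.rpow_pos_of_pos hc (a + b - 1)
  rw [← mul_one (ENNReal.ofReal (c ^ (a + b - 1) * beta a b)), ← hbeta,
    ← lintegral_const_mul' _ _ ENNReal.ofReal_ne_top]
  refine setLIntegral_congr_fun measurableSet_Ioo fun x hx => ?_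
  have hx0 : 0 < x := hx.1
  have hx1 : 0 < 1 - x := sub_pos.2 hx.2
  rw [abs_of_pos hc, ← ENNReal.ofReal_mul (by positivity), ← ENNReal.ofReal_mul (by positivity),
    ← ENNReal.ofReal_mul (by positivity)]
  congr 1
  rw [show c - c * x = c * (1 - x) by ring, Real.mul_rpow hc.le hx0.le, Real.mul_rpow hc.le hx1.le,
    show a + b - 1 = 1 + (a - 1) + (b - 1) by ring, Real.rpow_add hc, Real.rpow_add hc,
    Real.rpow_one]
  field_simp

end RandomSimplex

/-! ### Moments in the Beta model -/

namespace RandomSimplex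

/-- Up to a factor that does not depend on `σ`, the moment of order `σ` of the squared simplex
volume in the Beta model (`ν > 0`) and in the spherical model (`ν = 0`). -/
noncomputable def betaMoment (n r : ℕ) (ν σ : ℝ) : ℝ :=
  (∏ j ∈ Finset.range r, Real.Gamma (((n : ℝ) - j) / 2 + σ)) /
    Real.Gamma (((n : ℝ) + ν) / 2 + σ) ^ (r + 1) *
    (Real.Gamma ((r + 1) * (((n : ℝ) + ν) / 2 - 1) + 1 + (r + 1) * σ) /
      Real.Gamma ((r + 1) * (((n : ℝ) + ν) / 2 - 1) + 1 + r * σ))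

/-- A Beta integral over `[t, 1]`, set to zero for `t ≥ 1`: the contribution of one vertex in the
Beta model. -/
lemma lintegral_Ioi_truncated {t b β c : ℝ} (ht : 0 < t) (hb : 1 < b) (hβ : 0 < β) (hc : 0 ≤ c) :
    ∫⁻ q in Set.Ioi (0 : ℝ), ENNReal.ofReal (q - t) ^ (b - 1) *
      (Set.Iio (1 : ℝ)).indicator (fun q => ENNReal.ofReal (c * (1 - q) ^ (β - 1))) q =
    (Set.Iio (1 : ℝ)).indicator
      (fun t => ENNReal.ofReal (c * ((1 - t) ^ (b + β - 1) * beta b β))) t := by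
  rw [lintegral_Ioi_sub_rpow ht (by linarith)]
  by_cases ht1 : t < 1
  · rw [Set.indicator_of_mem (show t ∈ Set.Iio 1 from ht1), ENNReal.ofReal_mul hc,
      ← lintegral_Ioo_rpow_sub (sub_pos.2 ht1) (by linarith) hβ,
      ← lintegral_const_mul' _ _ ENNReal.ofReal_ne_top, ← lintegral_indicator measurableSet_Ioi,
      ← lintegral_indicator measurableSet_Ioo]
    refine lintegral_congr fun s => ?_
    by_cases hs : 0 < s
    · rw [Set.indicator_of_mem (show s ∈ Set.Ioi 0 from hs)]
      by_cases hs1 : s + t < 1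
      · rw [Set.indicator_of_mem (show s + t ∈ Set.Iio 1 from hs1),
          Set.indicator_of_mem (show s ∈ Set.Ioo 0 (1 - t) from ⟨hs, by linarith⟩),
          ENNReal.ofReal_mul hc, show 1 - (s + t) = 1 - t - s by ring]
        ring
      · rw [Set.indicator_of_notMem (show s + t ∉ Set.Iio 1 from hs1), mul_zero,
          Set.indicator_of_notMem fun h => hs1 (by linarith [h.2])]
    · rw [Set.indicator_of_notMem (show s ∉ Set.Ioi 0 from hs),
        Set.indicator_of_notMem fun h => hs h.1]
  · rw [Set.indicator_of_notMem (show t ∉ Set.Iio 1 from ht1)]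
    refine (lintegral_congr_ae ((ae_restrict_iff' measurableSet_Ioi).2
      (ae_of_all _ fun s hs => ?_))).trans lintegral_zero
    have hs0 : (0 : ℝ) < s := hs
    rw [Set.indicator_of_notMem (show s + t ∉ Set.Iio 1 from fun h => ht1 (by
      have : s + t < 1 := h
      linarith)), mul_zero]

lemma lintegral_Ioi_rpow_truncated {κ e : ℝ} (hκ : 0 < κ) (he : 0 ≤ e) {c : ℝ} (hc : 0 ≤ c)
    (m : ℕ) :
    ∫⁻ t in Set.Ioi (0 : ℝ), ENNReal.ofReal (t ^ (κ - 1)) * ∏ _i : Fin (m + 1),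
      (Set.Iio (1 : ℝ)).indicator (fun t => ENNReal.ofReal (c * (1 - t) ^ e)) t =
    ENNReal.ofReal (c ^ (m + 1) * beta κ ((m + 1) * e + 1)) := by
  have h := lintegral_Ioo_rpow_sub one_pos hκ (by positivity : 0 < ((m : ℝ) + 1) * e + 1)
  rw [Real.one_rpow, one_mul] at h
  simp only [Finset.prod_const, Finset.card_univ, Fintype.card_fin]
  rw [ENNReal.ofReal_mul (by positivity), ← h, ← lintegral_const_mul' _ _ ENNReal.ofReal_ne_top,
    ← lintegral_indicator measurableSet_Ioi, ← lintegral_indicator measurableSet_Ioo]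
  refine lintegral_congr fun t => ?_
  by_cases ht : 0 < t
  · rw [Set.indicator_of_mem (show t ∈ Set.Ioi 0 from ht)]
    by_cases ht1 : t < 1
    · have h1 : 0 ≤ 1 - t := by linarith
      rw [Set.indicator_of_mem (show t ∈ Set.Iio 1 from ht1),
        Set.indicator_of_mem (show t ∈ Set.Ioo 0 1 from ⟨ht, ht1⟩),
        ← ENNReal.ofReal_pow (by positivity), mul_pow, ENNReal.ofReal_mul (by positivity),
        ← Real.rpow_mul_natCast h1]
      rw [show e * ((m + 1 : ℕ) : ℝ) = ((m : ℝ) + 1) * e + 1 - 1 by push_cast; ring]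
      ring
    · rw [Set.indicator_of_notMem (show t ∉ Set.Iio 1 from ht1), zero_pow (by omega), mul_zero,
        Set.indicator_of_notMem fun h => ht1 h.2]
  · rw [Set.indicator_of_notMem (show t ∉ Set.Ioi 0 from ht),
      Set.indicator_of_notMem fun h => ht h.1]

lemma betaModel_eq_withDensity (n : ℕ) (ν : ℝ) :
    betaModel n ν = volume.withDensity fun x => (Set.Iio (1 : ℝ)).indicator (fun q =>
      ENNReal.ofReal (1 / Real.pi ^ ((n : ℝ) / 2) * (Real.Gamma ((n + ν) / 2) / Real.Gamma (ν / 2)) *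
        (1 - q) ^ (ν / 2 - 1))) (‖x‖ ^ 2) := by
  rw [betaModel, ← withDensity_indicator measurableSet_ball]
  congr 1
  ext x
  by_cases hx : ‖x‖ < 1
  · rw [Set.indicator_of_mem (by simpa using hx), Set.indicator_of_mem (by simpa using hx),
      show (ν - 2) / 2 = ν / 2 - 1 by ring]
  · rw [Set.indicator_of_notMem (by simpa using hx), Set.indicator_of_notMem (by simpa using hx)]

/-- The negative moments of the squared simplex volume in the Beta model. -/
lemma lintegral_simplexGram_betaModel {n r : ℕ} (hn : 3 ≤ n) (hrn : r ≤ n) {ν : ℝ} (hν : 0 < ν)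
    [IsProbabilityMeasure (betaModel n ν)] : ∃ C : ℝ, 0 < C ∧ ∀ κ : ℝ, 0 < κ → κ < 1 / 2 →
    ∫⁻ x : Fin (r + 1) → EuclideanSpace ℝ (Fin n), ENNReal.ofReal (simplexGram x) ^ (-κ)
      ∂Measure.pi (fun _ => betaModel n ν) = ENNReal.ofReal (C * betaMoment n r ν (-κ)) := by
  obtain ⟨K, hK, h⟩ := radialMoment_ae_eq hn hrn
  have hn3 : (3 : ℝ) ≤ n := by exact_mod_cast hn
  have hΓν : 0 < Real.Gamma (ν / 2) := Real.Gamma_pos_of_pos (by linarith)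
  set c : ℝ := 1 / Real.pi ^ ((n : ℝ) / 2) * (Real.Gamma ((n + ν) / 2) / Real.Gamma (ν / 2)) with hc
  have hcpos : 0 < c := by
    have := Real.Gamma_pos_of_pos (by linarith : 0 < ((n : ℝ) + ν) / 2)
    positivity
  refine ⟨K * (1 / 2) ^ (r + 1) * (c * Real.Gamma (ν / 2)) ^ (r + 1), by positivity,
    fun κ hκ hκ2 => ?_⟩
  have hΓ : 0 < Real.Gamma ((n : ℝ) / 2 - κ) := Real.Gamma_pos_of_pos (by linarith)
  have hΓκ : 0 < Real.Gamma κ := Real.Gamma_pos_of_pos hκ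
  have hP : 0 < ∏ j ∈ Finset.range r, Real.Gamma (((n : ℝ) - j) / 2 - κ) := by
    refine Finset.prod_pos fun j hj => ?_
    have : (j : ℝ) + 1 ≤ n := by
      have := Finset.mem_range.1 hj
      exact_mod_cast (by omega : j + 1 ≤ n)
    exact Real.Gamma_pos_of_pos (by linarith)
  set G : ℝ → ENNReal := (Set.Iio (1 : ℝ)).indicator
    (fun q => ENNReal.ofReal (c * (1 - q) ^ (ν / 2 - 1))) with hG
  have hGm : Measurable G := Measurable.indicator (by fun_prop) measurableSet_Iio
  have hmod : betaModel n ν = volume.withDensity fun x => G (‖x‖ ^ 2) :=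
    betaModel_eq_withDensity n ν
  have hsf : SigmaFinite ((volume : Measure (EuclideanSpace ℝ (Fin n))).withDensity
      fun x => G (‖x‖ ^ 2)) := by
    rw [← hmod]; infer_instance
  have hden : Measurable fun x : Fin (r + 1) → EuclideanSpace ℝ (Fin n) => ∏ i, G (‖x i‖ ^ 2) :=
    Finset.measurable_prod _ fun i _ => hGm.comp (by fun_prop)
  rw [hmod, pi_withDensity (r := r + 1) (fun _ => volume) (f := fun _ x => G (‖x‖ ^ 2))
      (fun i => hGm.comp (by fun_prop)),
    lintegral_withDensity_eq_lintegral_mul _ hden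
      ((measurable_simplexGram (n := n)).ennreal_ofReal.pow_const _)]
  simp only [Pi.mul_apply, mul_comm (∏ i, G (‖_‖ ^ 2))]
  rw [lintegral_simplexGram_radial (by omega) κ (f := fun _ t => G (t ^ 2))
    (fun i => hGm.comp (by fun_prop))]
  have h2 : ∀ᵐ ρ ∂Measure.pi (fun _ : Fin (r + 1) => Measure.volumeIoiPow (n - 1)),
      radialMoment (n := n) κ ρ * ∏ i, G ((ρ i).1 ^ 2) =
      ENNReal.ofReal (K * (∏ j ∈ Finset.range r, Real.Gamma (((n : ℝ) - j) / 2 - κ)) /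
        (Real.Gamma ((n : ℝ) / 2 - κ) ^ (r + 1) * Real.Gamma κ)) *
        (radialDensity n κ ρ * ∏ i, G ((ρ i).1 ^ 2)) := by
    filter_upwards [h κ hκ hκ2] with ρ hρ
    rw [hρ, mul_assoc]
  rw [lintegral_congr_ae h2, lintegral_const_mul' _ _ ENNReal.ofReal_ne_top,
    lintegral_radialDensity_mul (by omega) κ (G := fun _ => G) (fun _ => hGm)]
  have hbpos : 0 < beta ((n : ℝ) / 2 - κ) (ν / 2) := beta_pos (by linarith) (by linarith)
  have h3 : ∫⁻ t in Set.Ioi (0 : ℝ), ENNReal.ofReal (t ^ (κ - 1)) * ∏ _i : Fin (r + 1),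
      ∫⁻ q in Set.Ioi (0 : ℝ), ENNReal.ofReal (q - t) ^ ((n : ℝ) / 2 - κ - 1) * G q =
      ENNReal.ofReal ((c * beta ((n : ℝ) / 2 - κ) (ν / 2)) ^ (r + 1) *
        beta κ ((r + 1) * ((n : ℝ) / 2 - κ + ν / 2 - 1) + 1)) := by
    rw [← lintegral_Ioi_rpow_truncated hκ (by linarith) (by positivity)]
    refine setLIntegral_congr_fun measurableSet_Ioi fun t ht => ?_
    simp only [hG]
    rw [lintegral_Ioi_truncated ht (by linarith) (by linarith) hcpos.le]
    congr 1
    refine Finset.prod_congr rfl fun _ _ => ?_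
    congr 1
    ext t
    congr 1
    ring
  have hA : 0 < ((r : ℝ) + 1) * ((n : ℝ) / 2 - κ + ν / 2 - 1) + 1 := by
    have : 0 ≤ (n : ℝ) / 2 - κ + ν / 2 - 1 := by linarith
    positivity
  have hβ2 := beta_pos hκ hA
  rw [h3, ← ENNReal.ofReal_pow (by positivity), ← ENNReal.ofReal_mul (by positivity),
    ← ENNReal.ofReal_mul (by positivity)]
  congr 1
  have e1 : ((r : ℝ) + 1) * (((n : ℝ) + ν) / 2 - 1) + 1 + (r + 1) * -κ =
      ((r : ℝ) + 1) * ((n : ℝ) / 2 - κ + ν / 2 - 1) + 1 := by ring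
  have e2 : ((r : ℝ) + 1) * (((n : ℝ) + ν) / 2 - 1) + 1 + r * -κ =
      κ + (((r : ℝ) + 1) * ((n : ℝ) / 2 - κ + ν / 2 - 1) + 1) := by ring
  have e3 : ((n : ℝ) + ν) / 2 + -κ = (n : ℝ) / 2 - κ + ν / 2 := by ring
  rw [betaMoment, e1, e2, e3]
  simp only [← sub_eq_add_neg, beta]
  have g1 : 0 < Real.Gamma ((n : ℝ) / 2 - κ + ν / 2) := Real.Gamma_pos_of_pos (by linarith)
  have g2 : 0 < Real.Gamma (κ + (((r : ℝ) + 1) * ((n : ℝ) / 2 - κ + ν / 2 - 1) + 1)) :=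
    Real.Gamma_pos_of_pos (by linarith)
  generalize Real.Gamma ((n : ℝ) / 2 - κ) = x1 at *
  generalize Real.Gamma κ = x2 at *
  generalize ∏ j ∈ Finset.range r, Real.Gamma (((n : ℝ) - j) / 2 - κ) = x3 at *
  generalize Real.Gamma ((n : ℝ) / 2 - κ + ν / 2) = x4 at *
  generalize Real.Gamma (κ + (((r : ℝ) + 1) * ((n : ℝ) / 2 - κ + ν / 2 - 1) + 1)) = x5 at *
  simp only [mul_pow, div_pow]
  field_simp

end RandomSimplex

/-! ### Moments in the spherical model -/

namespace RandomSimplex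

lemma le_min_add_rpow (x : ENNReal) {M c : ℝ} (hM : 0 < M) (hc : 1 < c) :
    x ≤ min x (ENNReal.ofReal M) + ENNReal.ofReal M ^ (1 - c) * x ^ c := by
  have hM0 : ENNReal.ofReal M ≠ 0 := (ENNReal.ofReal_pos.2 hM).ne'
  rcases le_total x (ENNReal.ofReal M) with h | h
  · rw [min_eq_left h]
    exact le_self_add
  · refine le_trans ?_ le_add_self
    by_cases hx : x = ⊤
    · rw [hx, ENNReal.top_rpow_of_pos (by linarith), ENNReal.mul_top]
      exact (ENNReal.rpow_pos (ENNReal.ofReal_pos.2 hM) ENNReal.ofReal_ne_top).ne'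
    · have hx0 : x ≠ 0 := fun h0 => hM0 (le_antisymm (h0 ▸ h) zero_le)
      have h1 : x = x ^ (1 - c) * x ^ c := by
        rw [← ENNReal.rpow_add _ _ hx0 hx, sub_add_cancel, ENNReal.rpow_one]
      have h2 : x ^ (1 - c) ≤ ENNReal.ofReal M ^ (1 - c) := by
        rw [← neg_sub c 1, ENNReal.rpow_neg, ENNReal.rpow_neg]
        exact ENNReal.inv_le_inv.2 (ENNReal.rpow_le_rpow h (by linarith))
      calc x = x ^ (1 - c) * x ^ c := h1
        _ ≤ _ := mul_le_mul_left h2 _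

/-- Convergence of integrals from pointwise convergence and a bound on a higher moment, which
excludes a loss of mass in the limit. -/
lemma lintegral_eq_of_tendsto_of_rpow_bound {α : Type*} [MeasurableSpace α] {μ : Measure α}
    [IsFiniteMeasure μ] {φ : ℕ → α → ENNReal} {ψ : α → ENNReal} (hφ : ∀ k, Measurable (φ k))
    (hlim : ∀ x, Tendsto (fun k => φ k x) atTop (𝓝 (ψ x))) {c : ℝ} (hc : 1 < c) {B ℓ : ENNReal}
    (hB : B ≠ ⊤) (hbound : ∀ᶠ k in atTop, ∫⁻ x, φ k x ^ c ∂μ ≤ B)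
    (hℓ : Tendsto (fun k => ∫⁻ x, φ k x ∂μ) atTop (𝓝 ℓ)) : ∫⁻ x, ψ x ∂μ = ℓ := by
  apply le_antisymm
  · calc ∫⁻ x, ψ x ∂μ = ∫⁻ x, liminf (fun k => φ k x) atTop ∂μ :=
        lintegral_congr fun x => (hlim x).liminf_eq.symm
      _ ≤ liminf (fun k => ∫⁻ x, φ k x ∂μ) atTop := lintegral_liminf_le hφ
      _ = ℓ := hℓ.liminf_eq
  · have key : ∀ M : ℝ, 0 < M → ℓ ≤ ∫⁻ x, ψ x ∂μ + ENNReal.ofReal M ^ (1 - c) * B := by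
      intro M hM
      have h1 : Tendsto (fun k => ∫⁻ x, min (φ k x) (ENNReal.ofReal M) ∂μ) atTop
          (𝓝 (∫⁻ x, min (ψ x) (ENNReal.ofReal M) ∂μ)) := by
        refine tendsto_lintegral_of_dominated_convergence (fun _ => ENNReal.ofReal M)
          (fun k => (hφ k).min measurable_const) (fun k => ae_of_all _ fun x => min_le_right _ _) ?_
          (ae_of_all _ fun x => (hlim x).min tendsto_const_nhds)
        rw [lintegral_const]
        exact ENNReal.mul_ne_top ENNReal.ofReal_ne_top (measure_ne_top _ _)
      have h2 : ℓ ≤ ∫⁻ x, min (ψ x) (ENNReal.ofReal M) ∂μ + ENNReal.ofReal M ^ (1 - c) * B := by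
        refine le_of_tendsto_of_tendsto hℓ (h1.add_const _) ?_
        filter_upwards [hbound] with k hk
        calc ∫⁻ x, φ k x ∂μ
            ≤ ∫⁻ x, (min (φ k x) (ENNReal.ofReal M) + ENNReal.ofReal M ^ (1 - c) * φ k x ^ c) ∂μ :=
              lintegral_mono fun x => le_min_add_rpow _ hM hc
          _ = ∫⁻ x, min (φ k x) (ENNReal.ofReal M) ∂μ +
                ENNReal.ofReal M ^ (1 - c) * ∫⁻ x, φ k x ^ c ∂μ := by
              rw [lintegral_add_left ((hφ k).min measurable_const),
                lintegral_const_mul _ ((hφ k).pow_const _)]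
          _ ≤ _ := by gcongr
      exact h2.trans (by gcongr; exact min_le_left _ _)
    have hlim2 : Tendsto (fun M : ℝ => ∫⁻ x, ψ x ∂μ + ENNReal.ofReal M ^ (1 - c) * B) atTop
        (𝓝 (∫⁻ x, ψ x ∂μ + 0 * B)) := by
      refine Tendsto.const_add _ (ENNReal.Tendsto.mul_const ?_ (Or.inr hB))
      have h3 : Tendsto (fun M : ℝ => ENNReal.ofReal (M ^ (-(c - 1)))) atTop
          (𝓝 (ENNReal.ofReal 0)) :=
        ENNReal.tendsto_ofReal (tendsto_rpow_neg_atTop (by linarith))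
      rw [ENNReal.ofReal_zero] at h3
      refine h3.congr' ?_
      filter_upwards [eventually_gt_atTop 0] with M hM
      rw [ENNReal.ofReal_rpow_of_pos hM, neg_sub]
    rw [zero_mul, add_zero] at hlim2
    exact ge_of_tendsto hlim2 ((eventually_gt_atTop 0).mono key)

instance isOpenPosMeasure_volumeIoiPow (k : ℕ) : (Measure.volumeIoiPow k).IsOpenPosMeasure := by
  have h0 : (Measure.comap (Subtype.val : Set.Ioi (0 : ℝ) → ℝ) volume).IsOpenPosMeasure :=
    Measure.IsOpenPosMeasure.comap _ (isOpen_Ioi.isOpenEmbedding_subtypeVal)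
  have h1 : Measure.comap (Subtype.val : Set.Ioi (0 : ℝ) → ℝ) volume ≪ Measure.volumeIoiPow k := by
    refine withDensity_absolutelyContinuous' (by fun_prop) (ae_of_all _ fun x => ?_)
    have hx : 0 < x.1 := x.2
    exact (ENNReal.ofReal_pos.2 (by positivity)).ne'
  exact h1.isOpenPosMeasure

/-- The vector of unit radii. -/
def unitRadii (m : ℕ) : Fin m → Set.Ioi (0 : ℝ) := fun _ => ⟨1, Set.mem_Ioi.2 one_pos⟩

lemma tendsto_radialDensity {n m : ℕ} (hn : 3 ≤ n) {κ : ℝ} (hκ : 0 < κ) (hκ2 : κ < 1 / 2)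
    {ρ : ℕ → Fin (m + 1) → Set.Ioi (0 : ℝ)} (hρ : Tendsto ρ atTop (𝓝 (unitRadii (m + 1)))) :
    Tendsto (fun k => radialDensity n κ (ρ k)) atTop
      (𝓝 (radialDensity n κ (unitRadii (m + 1)))) := by
  have hn3 : (3 : ℝ) ≤ n := by exact_mod_cast hn
  have he : 0 < (n : ℝ) / 2 - κ - 1 := by linarith
  have hcoord : ∀ i, Tendsto (fun k => (ρ k i).1) atTop (𝓝 1) := fun i =>
    (continuous_subtype_val.tendsto _).comp ((continuous_apply i).tendsto _ |>.comp hρ)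
  have hev : ∀ᶠ k in atTop, ∀ i, 1 / 2 ≤ (ρ k i).1 ∧ (ρ k i).1 ≤ 2 := by
    rw [eventually_all]
    intro i
    exact ((hcoord i).eventually_const_le (by norm_num)).and
      ((hcoord i).eventually_le_const (by norm_num))
  obtain ⟨k0, hk0⟩ := eventually_atTop.1 hev
  rw [← tendsto_add_atTop_iff_nat k0]
  have hB : ∀ k, ∀ i, 1 / 2 ≤ (ρ (k + k0) i).1 ∧ (ρ (k + k0) i).1 ≤ 2 := fun k => hk0 _ (by omega)
  refine tendsto_lintegral_of_dominated_convergence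
    ((Set.Iio (4 : ℝ)).indicator fun t => ENNReal.ofReal (t ^ (κ - 1)) *
      (ENNReal.ofReal (2 ^ (n - 2)) * ENNReal.ofReal 4 ^ ((n : ℝ) / 2 - κ - 1)) ^ (m + 1)) ?_ ?_ ?_ ?_
  · intro k
    fun_prop
  · intro k
    refine (ae_restrict_iff' measurableSet_Ioi).2 (ae_of_all _ fun t ht => ?_)
    have ht0 : (0 : ℝ) < t := ht
    by_cases ht4 : t < 4
    · rw [Set.indicator_of_mem (show t ∈ Set.Iio 4 from ht4)]
      refine mul_le_mul_right ?_ _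
      refine (Finset.prod_le_pow_card _ _ (ENNReal.ofReal (2 ^ (n - 2)) *
        ENNReal.ofReal 4 ^ ((n : ℝ) / 2 - κ - 1)) fun i _ => ?_).trans
        (by rw [Finset.card_univ, Fintype.card_fin])
      obtain ⟨h1, h2⟩ := hB k i
      refine mul_le_mul' (ENNReal.ofReal_le_ofReal ?_)
        (ENNReal.rpow_le_rpow (ENNReal.ofReal_le_ofReal ?_) he.le)
      · rw [← inv_pow]
        refine pow_le_pow_left₀ (inv_nonneg.2 (by linarith)) ?_ _
        rw [inv_le_comm₀ (by linarith) two_pos]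
        linarith
      · nlinarith
    · rw [Set.indicator_of_notMem (show t ∉ Set.Iio 4 from ht4)]
      obtain ⟨h1, h2⟩ := hB k 0
      beta_reduce
      rw [Finset.prod_eq_zero (Finset.mem_univ (0 : Fin (m + 1))), mul_zero]
      rw [ENNReal.ofReal_of_nonpos (p := (ρ (k + k0) 0).1 ^ 2 - t) (by nlinarith),
        ENNReal.zero_rpow_of_pos he, mul_zero]
  · have h := lintegral_Ioo_rpow_sub (c := 4) (by norm_num) hκ one_pos
    simp only [sub_self, Real.rpow_zero, ENNReal.ofReal_one, mul_one] at h
    rw [lintegral_indicator measurableSet_Iio, Measure.restrict_restrict measurableSet_Iio,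
      Set.Iio_inter_Ioi, lintegral_mul_const _ (by fun_prop), h]
    refine ENNReal.mul_ne_top ENNReal.ofReal_ne_top (ENNReal.pow_ne_top
      (ENNReal.mul_ne_top ENNReal.ofReal_ne_top (ENNReal.rpow_ne_top_of_nonneg he.le
      ENNReal.ofReal_ne_top)))
  · refine ae_of_all _ fun t => ?_
    have hc : ∀ i, Tendsto (fun k => (ρ (k + k0) i).1) atTop (𝓝 1) := fun i =>
      (tendsto_add_atTop_iff_nat k0).2 (hcoord i)
    refine ENNReal.Tendsto.const_mul ?_ (Or.inr ENNReal.ofReal_ne_top)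
    refine ENNReal.tendsto_finsetProd_of_ne_top _ (fun i _ => ?_) fun i _ => ?_
    · refine ENNReal.Tendsto.mul (ENNReal.tendsto_ofReal (Tendsto.inv₀ ((hc i).pow _) ?_))
        (Or.inr ?_) ((ENNReal.continuous_rpow_const.tendsto _).comp
          (ENNReal.tendsto_ofReal (((hc i).pow 2).sub_const t))) (Or.inr ENNReal.ofReal_ne_top)
      · exact pow_ne_zero _ one_ne_zero
      · exact ENNReal.rpow_ne_top_of_nonneg he.le ENNReal.ofReal_ne_top
    · exact ENNReal.mul_ne_top ENNReal.ofReal_ne_top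
        (ENNReal.rpow_ne_top_of_nonneg he.le ENNReal.ofReal_ne_top)

lemma radialDensity_unitRadii {n m : ℕ} (hn : 3 ≤ n) {κ : ℝ} (hκ : 0 < κ) (hκ2 : κ < 1 / 2) :
    radialDensity n κ (unitRadii (m + 1)) =
      ENNReal.ofReal (beta κ ((m + 1) * ((n : ℝ) / 2 - κ - 1) + 1)) := by
  have hn3 : (3 : ℝ) ≤ n := by exact_mod_cast hn
  have he : 0 < (n : ℝ) / 2 - κ - 1 := by linarith
  have h := lintegral_Ioi_rpow_truncated hκ he.le zero_le_one m
  rw [one_pow, one_mul] at h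
  rw [← h, radialDensity]
  refine lintegral_congr fun t => ?_
  congr 1
  refine Finset.prod_congr rfl fun i _ => ?_
  simp only [unitRadii, one_pow, inv_one, ENNReal.ofReal_one, one_mul]
  by_cases ht : t < 1
  · rw [Set.indicator_of_mem (show t ∈ Set.Iio 1 from ht), ENNReal.ofReal_rpow_of_pos (by linarith)]
  · rw [Set.indicator_of_notMem (show t ∉ Set.Iio 1 from ht), ENNReal.ofReal_of_nonpos (by linarith),
      ENNReal.zero_rpow_of_pos he]

/-- The radial moment at unit radii. The identity of `radialMoment_ae_eq`, which holds almost
everywhere, extends to this point by approximation. -/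
lemma radialMoment_unitRadii {n r : ℕ} (hn : 3 ≤ n) (hrn : r ≤ n) : ∃ K : ℝ, 0 < K ∧
    ∀ κ : ℝ, 0 < κ → κ < 1 / 2 →
    radialMoment (n := n) (r := r) κ (unitRadii (r + 1)) =
      ENNReal.ofReal (K * (∏ j ∈ Finset.range r, Real.Gamma (((n : ℝ) - j) / 2 - κ)) /
        (Real.Gamma ((n : ℝ) / 2 - κ) ^ (r + 1) * Real.Gamma κ)) *
        radialDensity n κ (unitRadii (r + 1)) := by
  obtain ⟨K, hK, h⟩ := radialMoment_ae_eq hn hrn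
  refine ⟨K, hK, ?_⟩
  obtain ⟨D, hD⟩ : ∃ D : ℝ → ℝ, ∀ κ, K * (∏ j ∈ Finset.range r, Real.Gamma (((n : ℝ) - j) / 2 - κ)) /
      (Real.Gamma ((n : ℝ) / 2 - κ) ^ (r + 1) * Real.Gamma κ) = D κ := ⟨_, fun _ => rfl⟩
  simp only [hD] at h ⊢
  clear hD
  intro κ hκ hκ2
  -- The moment of the larger order `κ'` along the approximating radii is bounded, which gives
  -- uniform integrability of the integrand of order `κ`.
  obtain ⟨κ', hκκ', hκ'2⟩ := exists_between hκ2
  have hκ'0 : 0 < κ' := hκ.trans hκκ'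
  have hdense := Measure.dense_of_ae ((h κ hκ hκ2).and (h κ' hκ'0 hκ'2))
  obtain ⟨ρ, hρmem, hρ⟩ := mem_closure_iff_seq_limit.1 (hdense (unitRadii (r + 1)))
  have hne : ∀ κ, 0 < κ → κ < 1 / 2 →
      ENNReal.ofReal (D κ) * radialDensity n κ (unitRadii (r + 1)) ≠ ⊤ := by
    intro κ h1 h2
    rw [radialDensity_unitRadii hn h1 h2]
    exact ENNReal.mul_ne_top ENNReal.ofReal_ne_top ENNReal.ofReal_ne_top
  have hlim : ∀ κ (hκ : 0 < κ) (hκ2 : κ < 1 / 2), Tendsto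
      (fun k => ENNReal.ofReal (D κ) * radialDensity n κ (ρ k)) atTop
      (𝓝 (ENNReal.ofReal (D κ) * radialDensity n κ (unitRadii (r + 1)))) := fun κ hκ hκ2 =>
    ENNReal.Tendsto.const_mul (tendsto_radialDensity hn hκ hκ2 hρ) (Or.inr ENNReal.ofReal_ne_top)
  rw [radialMoment]
  refine lintegral_eq_of_tendsto_of_rpow_bound
    (μ := Measure.pi fun _ : Fin (r + 1) =>
      (volume : Measure (EuclideanSpace ℝ (Fin n))).toSphere)
    (ψ := fun u => ENNReal.ofReal
      (simplexGram fun i => polarVec (u i, unitRadii (r + 1) i)) ^ (-κ))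
    (ℓ := ENNReal.ofReal (D κ) * radialDensity n κ (unitRadii (r + 1)))
    (φ := fun k u => ENNReal.ofReal (simplexGram fun i => polarVec (u i, ρ k i)) ^ (-κ))
    (c := κ' / κ)
    (B := ENNReal.ofReal (D κ') * radialDensity n κ' (unitRadii (r + 1)) + 1)
    (fun k => measurable_polar_simplexGram_right κ (ρ k)) ?_ ((one_lt_div hκ).2 hκκ')
    (ENNReal.add_ne_top.2 ⟨hne κ' hκ'0 hκ'2, ENNReal.one_ne_top⟩) ?_ ?_
  · intro u
    refine (ENNReal.continuous_rpow_const.tendsto _).comp (ENNReal.tendsto_ofReal ?_)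
    refine (continuous_simplexGram.tendsto _).comp (tendsto_pi_nhds.2 fun i => ?_)
    exact (continuous_polarVec.tendsto _).comp
      (tendsto_const_nhds.prodMk_nhds ((continuous_apply i).tendsto _ |>.comp hρ))
  · filter_upwards [(hlim κ' hκ'0 hκ'2).eventually_le_const
      (ENNReal.lt_add_right (hne κ' hκ'0 hκ'2) one_ne_zero)] with k hk
    refine le_trans (le_of_eq ?_) hk
    have h2 : radialMoment κ' (ρ k) = ENNReal.ofReal (D κ') * radialDensity n κ' (ρ k) :=
      (hρmem k).2
    rw [← h2, radialMoment]
    refine lintegral_congr fun u => ?_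
    rw [← ENNReal.rpow_mul, neg_mul, mul_div_cancel₀ _ hκ.ne']
  · refine (hlim κ hκ hκ2).congr fun k => ?_
    have h1 : radialMoment κ (ρ k) = ENNReal.ofReal (D κ) * radialDensity n κ (ρ k) :=
      (hρmem k).1
    rw [← h1, radialMoment]

/-- The uniform distribution as a normalised surface measure, in a product. -/
lemma lintegral_pi_sphericalModel {n r : ℕ} (hn : 1 ≤ n) :
    ∃ c : ℝ, 0 < c ∧ ∀ F : (Fin r → EuclideanSpace ℝ (Fin n)) → ENNReal, Measurable F →
      ∫⁻ x, F x ∂Measure.pi (fun _ => sphericalModel n) = ENNReal.ofReal c *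
        ∫⁻ u, F (fun i => (u i).1)
          ∂Measure.pi fun _ => (volume : Measure (EuclideanSpace ℝ (Fin n))).toSphere := by
  have : Nonempty (Fin n) := ⟨⟨0, hn⟩⟩
  obtain ⟨c, hc, hcS⟩ : ∃ c : ℝ, 0 < c ∧
      ((volume : Measure (EuclideanSpace ℝ (Fin n))).toSphere Set.univ)⁻¹ = ENNReal.ofReal c := by
    have h0 : ((volume : Measure (EuclideanSpace ℝ (Fin n))).toSphere Set.univ)⁻¹ ≠ 0 :=
      ENNReal.inv_ne_zero.2 (measure_ne_top _ _)
    have ht : ((volume : Measure (EuclideanSpace ℝ (Fin n))).toSphere Set.univ)⁻¹ ≠ ⊤ :=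
      ENNReal.inv_ne_top.2 (Measure.measure_univ_ne_zero.2 (Measure.toSphere_ne_zero _))
    exact ⟨_, ENNReal.toReal_pos h0 ht, (ENNReal.ofReal_toReal ht).symm⟩
  have hmod : sphericalModel n = ((volume : Measure (EuclideanSpace ℝ (Fin n))).toSphere.map
      Subtype.val).withDensity fun _ => ENNReal.ofReal c := by
    rw [withDensity_const, ← hcS, sphericalModel]
  have hfin : IsFiniteMeasure (((volume : Measure (EuclideanSpace ℝ (Fin n))).toSphere.map
      Subtype.val).withDensity fun _ => ENNReal.ofReal c) := by
    rw [withDensity_const]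
    exact Measure.smul_finite _ ENNReal.ofReal_ne_top
  refine ⟨c ^ r, by positivity, fun F hF => ?_⟩
  rw [hmod, pi_withDensity (fun _ => _) (fun i => measurable_const), Finset.prod_const,
    Finset.card_univ, Fintype.card_fin, withDensity_const, lintegral_smul_measure,
    ← Measure.pi_map_pi (fun i => measurable_subtype_coe.aemeasurable),
    lintegral_map hF (by fun_prop), ← ENNReal.ofReal_pow hc.le, smul_eq_mul]

/-- The negative moments of the squared simplex volume in the spherical model. -/
lemma lintegral_simplexGram_sphericalModel {n r : ℕ} (hn : 3 ≤ n) (hrn : r ≤ n) :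
    ∃ C : ℝ, 0 < C ∧ ∀ κ : ℝ, 0 < κ → κ < 1 / 2 →
    ∫⁻ x : Fin (r + 1) → EuclideanSpace ℝ (Fin n), ENNReal.ofReal (simplexGram x) ^ (-κ)
      ∂Measure.pi (fun _ => sphericalModel n) = ENNReal.ofReal (C * betaMoment n r 0 (-κ)) := by
  obtain ⟨K, hK, h⟩ := radialMoment_unitRadii hn hrn
  obtain ⟨c, hc, hcF⟩ := lintegral_pi_sphericalModel (n := n) (r := r + 1) (by omega)
  have hn3 : (3 : ℝ) ≤ n := by exact_mod_cast hn
  refine ⟨c * K, by positivity, fun κ hκ hκ2 => ?_⟩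
  have hΓ : 0 < Real.Gamma ((n : ℝ) / 2 - κ) := Real.Gamma_pos_of_pos (by linarith)
  have hΓκ : 0 < Real.Gamma κ := Real.Gamma_pos_of_pos hκ
  have hP : 0 < ∏ j ∈ Finset.range r, Real.Gamma (((n : ℝ) - j) / 2 - κ) := by
    refine Finset.prod_pos fun j hj => ?_
    have : (j : ℝ) + 1 ≤ n := by
      have := Finset.mem_range.1 hj
      exact_mod_cast (by omega : j + 1 ≤ n)
    exact Real.Gamma_pos_of_pos (by linarith)
  have hA : 0 < ((r : ℝ) + 1) * ((n : ℝ) / 2 - κ - 1) + 1 := by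
    have : 0 ≤ (n : ℝ) / 2 - κ - 1 := by linarith
    positivity
  rw [hcF _ ((measurable_simplexGram (n := n)).ennreal_ofReal.pow_const _)]
  have h1 : ∫⁻ u, ENNReal.ofReal (simplexGram fun i => (u i).1) ^ (-κ)
      ∂(Measure.pi fun _ : Fin (r + 1) =>
        (volume : Measure (EuclideanSpace ℝ (Fin n))).toSphere) =
      radialMoment (n := n) κ (unitRadii (r + 1)) := by
    rw [radialMoment]
    simp only [polarVec, unitRadii, one_smul]
  rw [h1, h κ hκ hκ2, radialDensity_unitRadii hn hκ hκ2, ← ENNReal.ofReal_mul (by positivity),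
    ← ENNReal.ofReal_mul hc.le]
  congr 1
  have e1 : ((r : ℝ) + 1) * (((n : ℝ) + 0) / 2 - 1) + 1 + (r + 1) * -κ =
      ((r : ℝ) + 1) * ((n : ℝ) / 2 - κ - 1) + 1 := by ring
  have e2 : ((r : ℝ) + 1) * (((n : ℝ) + 0) / 2 - 1) + 1 + r * -κ =
      κ + (((r : ℝ) + 1) * ((n : ℝ) / 2 - κ - 1) + 1) := by ring
  rw [betaMoment, e1, e2, add_zero, beta]
  simp only [← sub_eq_add_neg]
  have g2 : 0 < Real.Gamma (κ + (((r : ℝ) + 1) * ((n : ℝ) / 2 - κ - 1) + 1)) :=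
    Real.Gamma_pos_of_pos (by linarith)
  generalize Real.Gamma ((n : ℝ) / 2 - κ) = x1 at *
  generalize Real.Gamma κ = x2 at *
  generalize ∏ j ∈ Finset.range r, Real.Gamma (((n : ℝ) - j) / 2 - κ) = x3 at *
  generalize Real.Gamma (κ + (((r : ℝ) + 1) * ((n : ℝ) / 2 - κ - 1) + 1)) = x5 at *
  field_simp

end RandomSimplex

/-! ### Cumulants from moments -/

namespace RandomSimplex

lemma iteratedDeriv_comp_ofReal_mul {h : ℂ → ℂ} (hh : AnalyticAt ℂ h 0) (c : ℂ) (m : ℕ) :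
    ∀ᶠ t : ℝ in 𝓝 0, iteratedDeriv m (fun t : ℝ => h (c * t)) t =
      c ^ m * iteratedDeriv m h (c * t) := by
  have hc : Tendsto (fun t : ℝ => c * (t : ℂ)) (𝓝 0) (𝓝 0) := by
    have : Continuous fun t : ℝ => c * (t : ℂ) := by fun_prop
    simpa using this.tendsto 0
  induction m with
  | zero => simp
  | succ m ih =>
    have han := hc.eventually hh.eventually_analyticAt
    filter_upwards [ih.eventually_nhds, han] with t ht hat
    rw [iteratedDeriv_succ, Filter.EventuallyEq.deriv_eq ht]
    have h1 : AnalyticAt ℂ (iteratedDeriv m h) (c * t) := by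
      rw [iteratedDeriv_eq_iterate]
      exact hat.iterated_deriv m
    have h2 : HasDerivAt (fun t : ℝ => c * (t : ℂ)) c t := by
      simpa using (Complex.ofRealCLM.hasDerivAt (x := t)).const_mul c
    have h3 := (h1.differentiableAt.hasDerivAt.comp_of_eq t h2 rfl).const_mul (c ^ m)
    rw [iteratedDeriv_succ, pow_succ]
    refine Eq.trans h3.deriv ?_
    ring

lemma iteratedDeriv_ofReal {f : ℝ → ℝ} (hf : AnalyticAt ℝ f 0) (m : ℕ) :
    ∀ᶠ t in 𝓝 (0 : ℝ), iteratedDeriv m (fun t => (f t : ℂ)) t =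
        ((iteratedDeriv m f t : ℝ) : ℂ) := by
  induction m with
  | zero => simp
  | succ m ih =>
    filter_upwards [ih.eventually_nhds, hf.eventually_analyticAt] with t ht hat
    have h1 : AnalyticAt ℝ (iteratedDeriv m f) t := by
      rw [iteratedDeriv_eq_iterate]
      exact hat.iterated_deriv m
    rw [iteratedDeriv_succ, Filter.EventuallyEq.deriv_eq ht, iteratedDeriv_succ]
    exact h1.differentiableAt.hasDerivAt.ofReal_comp.deriv

variable {Ω : Type*} [MeasurableSpace Ω]

/-- The random variable `Y` has exponential moments near `0`, and `Φ` is its cumulant generating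
function near `0`, up to an additive constant. -/
structure HasCumulantFunction (Y : Ω → ℝ) (P : Measure Ω) (Φ : ℝ → ℝ) : Prop where
  zero_mem_interior : 0 ∈ interior (integrableExpSet Y P)
  exists_cgf_eq : ∃ c, ∀ᶠ s in 𝓝 0, cgf Y P s = c + Φ s

namespace HasCumulantFunction

variable {P : Measure Ω} {Y : Ω → ℝ} {Φ : ℝ → ℝ}

lemma memLp (h : HasCumulantFunction Y P Φ) (p : ℕ) : MemLp Y p P := by
  have := memLp_of_mem_interior_integrableExpSet h.zero_mem_interior p
  simpa using this

lemma iteratedDeriv_cgf (h : HasCumulantFunction Y P Φ) {m : ℕ} (hm : 0 < m) :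
    iteratedDeriv m (cgf Y P) 0 = iteratedDeriv m Φ 0 := by
  obtain ⟨c, hc⟩ := h.exists_cgf_eq
  rw [Filter.EventuallyEq.iteratedDeriv_eq m hc, iteratedDeriv_const_add hm]

lemma integral_eq [IsProbabilityMeasure P] (h : HasCumulantFunction Y P Φ) :
    ∫ ω, Y ω ∂P = deriv Φ 0 := by
  have h1 := deriv_cgf_zero h.zero_mem_interior
  rw [probReal_univ, div_one] at h1
  rw [← h1, ← iteratedDeriv_one, ← iteratedDeriv_one, h.iteratedDeriv_cgf one_pos]

lemma variance_eq [IsProbabilityMeasure P] (h : HasCumulantFunction Y P Φ) :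
    Var[Y; P] = iteratedDeriv 2 Φ 0 := by
  have h1 := deriv_cgf_zero h.zero_mem_interior
  rw [probReal_univ, div_one] at h1
  rw [← h.iteratedDeriv_cgf two_pos, iteratedDeriv_two_cgf_eq_integral h.zero_mem_interior,
    variance_eq_integral (h.memLp 1).aestronglyMeasurable.aemeasurable, h1]
  simp

lemma cumulant_eq [IsProbabilityMeasure P] (h : HasCumulantFunction Y P Φ) {m : ℕ} (hm : 0 < m) :
    cumulant m Y P = ((iteratedDeriv m Φ 0 : ℝ) : ℂ) := by
  have hF : AnalyticAt ℂ (complexMGF Y P) 0 :=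
    analyticAt_complexMGF (by simpa using h.zero_mem_interior)
  have hF0 : complexMGF Y P 0 = 1 := by simp [complexMGF]
  have hlog : AnalyticAt ℂ (fun z => Complex.log (complexMGF Y P z)) 0 :=
    hF.clog (by rw [hF0]; exact Complex.one_mem_slitPlane)
  have hcgf := analyticAt_cgf h.zero_mem_interior
  have h1 := (iteratedDeriv_comp_ofReal_mul hlog Complex.I m).self_of_nhds
  have h2 := (iteratedDeriv_comp_ofReal_mul hlog 1 m).self_of_nhds
  have h3 := (iteratedDeriv_ofReal hcgf m).self_of_nhds
  have h4 : (fun t : ℝ => Complex.log (complexMGF Y P (1 * t))) =ᶠ[𝓝 0]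
      fun t => ((cgf Y P t : ℝ) : ℂ) := by
    filter_upwards [mem_interior_iff_mem_nhds.1 h.zero_mem_interior] with t ht
    rw [one_mul, complexMGF_ofReal, cgf, Complex.ofReal_log (mgf_pos ht).le]
  rw [Filter.EventuallyEq.iteratedDeriv_eq m h4, h3, one_pow, one_mul] at h2
  rw [cumulant]
  simp only [complexMGF] at h1 h2
  rw [h1, ← mul_assoc, ← mul_pow, neg_mul, Complex.I_mul_I, neg_neg, one_pow, one_mul,
    ← h.iteratedDeriv_cgf hm, h2]
  simp

lemma congr_ae (h : HasCumulantFunction Y P Φ) {Z : Ω → ℝ} (hZ : Y =ᵐ[P] Z) :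
    HasCumulantFunction Z P Φ := by
  have hset : integrableExpSet Z P = integrableExpSet Y P := by
    ext t
    refine integrable_congr ?_
    filter_upwards [hZ] with ω hω
    rw [hω]
  have hcgf : ∀ t, cgf Z P t = cgf Y P t := by
    intro t
    rw [cgf, cgf, mgf, mgf, integral_congr_ae]
    filter_upwards [hZ] with ω hω
    rw [hω]
  refine ⟨hset ▸ h.zero_mem_interior, ?_⟩
  simpa only [hcgf] using h.exists_cgf_eq

end HasCumulantFunction

/-- Moments of small negative order determine the cumulant generating function of the logarithm
near `0`, since it is analytic there. -/
lemma hasCumulantFunction_of_lintegral {P : Measure Ω} [IsProbabilityMeasure P] {g : Ω → ℝ}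
    (hg : AEMeasurable g P) (hpos : ∀ᵐ ω ∂P, 0 < g ω) {δ C : ℝ} (hδ : 0 < δ) (hC : 0 < C)
    {Φ : ℝ → ℝ} (hΦ : AnalyticAt ℝ Φ 0)
    (h : ∀ s, -δ < s → s < 0 → ∫⁻ ω, ENNReal.ofReal (g ω) ^ (s / 2) ∂P =
      ENNReal.ofReal (C * Real.exp (Φ s)))
    {η : ℝ} (hη : 0 < η) (hfin : ∫⁻ ω, ENNReal.ofReal (g ω) ^ (η / 2) ∂P ≠ ⊤) :
    HasCumulantFunction (fun ω => 1 / 2 * Real.log (g ω)) P Φ := by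
  have hexp : ∀ s : ℝ, ∀ᵐ ω ∂P, ENNReal.ofReal (Real.exp (s * (1 / 2 * Real.log (g ω)))) =
      ENNReal.ofReal (g ω) ^ (s / 2) := by
    intro s
    filter_upwards [hpos] with ω hω
    rw [ENNReal.ofReal_rpow_of_pos hω, Real.rpow_def_of_pos hω]
    ring_nf
  have hmeas : ∀ s : ℝ, AEStronglyMeasurable
      (fun ω => Real.exp (s * (1 / 2 * Real.log (g ω)))) P := fun s =>
    (Real.measurable_exp.comp_aemeasurable ((Real.measurable_log.comp_aemeasurable hg).const_mul
      (1 / 2) |>.const_mul s)).aestronglyMeasurable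
  have hint : ∀ s : ℝ, ∫⁻ ω, ENNReal.ofReal (g ω) ^ (s / 2) ∂P ≠ ⊤ →
      s ∈ integrableExpSet (fun ω => 1 / 2 * Real.log (g ω)) P := by
    intro s hs
    rw [← lintegral_congr_ae (hexp s)] at hs
    exact (lintegral_ofReal_ne_top_iff_integrable (hmeas s)
      (ae_of_all _ fun ω => (Real.exp_pos _).le)).1 hs
  have hneg : ∀ s, -δ < s → s < 0 → s ∈ integrableExpSet (fun ω => 1 / 2 * Real.log (g ω)) P :=
    fun s h1 h2 => hint s (by rw [h s h1 h2]; exact ENNReal.ofReal_ne_top)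
  have hzero : 0 ∈ interior (integrableExpSet (fun ω => 1 / 2 * Real.log (g ω)) P) := by
    rw [mem_interior_iff_mem_nhds]
    have hsub : Set.Icc (-(δ / 2)) η ⊆ integrableExpSet (fun ω => 1 / 2 * Real.log (g ω)) P :=
      convex_integrableExpSet.ordConnected.out (hneg _ (by linarith) (by linarith)) (hint η hfin)
    exact mem_of_superset (Icc_mem_nhds (by linarith) hη) hsub
  refine ⟨hzero, Real.log C, ?_⟩
  refine ((analyticAt_cgf hzero).frequently_eq_iff_eventually_eq (analyticAt_const.add hΦ)).1 ?_
  have hev : ∀ᶠ s in 𝓝[<] (0 : ℝ), cgf (fun ω => 1 / 2 * Real.log (g ω)) P s =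
      (fun _ => Real.log C) s + Φ s := by
    filter_upwards [Ioo_mem_nhdsLT (by linarith : -δ < 0)] with s hs
    have h1 : mgf (fun ω => 1 / 2 * Real.log (g ω)) P s = C * Real.exp (Φ s) := by
      rw [mgf, integral_eq_lintegral_of_nonneg_ae (ae_of_all _ fun ω => (Real.exp_pos _).le)
        (hmeas s), lintegral_congr_ae (hexp s), h s hs.1 hs.2, ENNReal.toReal_ofReal (by positivity)]
    rw [cgf, h1, Real.log_mul hC.ne' (Real.exp_pos _).ne', Real.log_exp]
  exact hev.frequently.filter_mono (nhdsWithin_mono _ fun s hs => ne_of_lt hs)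

/-- Reduction of the distribution of the volume to the moments of the Gram determinant under the
product measure. -/
lemma IsIIDSample.hasCumulantFunction_logVolume {n r : ℕ} {P : Measure Ω} [IsProbabilityMeasure P]
    {μ : Measure (EuclideanSpace ℝ (Fin n))} {X : Fin (r + 1) → Ω → EuclideanSpace ℝ (Fin n)}
    (hX : IsIIDSample P μ X) {δ C : ℝ} (hδ : 0 < δ) (hC : 0 < C)
    {Φ : ℝ → ℝ} (hΦ : AnalyticAt ℝ Φ 0)
    (h : ∀ s, -δ < s → s < 0 → ∫⁻ x, ENNReal.ofReal (simplexGram x) ^ (s / 2)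
      ∂Measure.pi (fun _ : Fin (r + 1) => μ) = ENNReal.ofReal (C * Real.exp (Φ s)))
    {η : ℝ} (hη : 0 < η) (hfin : ∫⁻ x, ENNReal.ofReal (simplexGram x) ^ (η / 2)
      ∂Measure.pi (fun _ : Fin (r + 1) => μ) ≠ ⊤) :
    (∀ᵐ ω ∂P, 0 < simplexVolume fun i => X i ω) ∧ HasCumulantFunction (logVolume X) P Φ := by
  have hm : AEMeasurable (fun ω i => X i ω) P :=
    aemeasurable_pi_lambda _ fun i => (hX.law i).aemeasurable
  have hlaw : P.map (fun ω i => X i ω) = Measure.pi fun _ => μ := by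
    rw [(iIndepFun_iff_map_fun_eq_pi_map fun i => (hX.law i).aemeasurable).1 hX.indep]
    simp only [fun i => (hX.law i).map_eq]
  have hlint : ∀ s : ℝ, ∫⁻ x, ENNReal.ofReal (simplexGram x) ^ s
      ∂Measure.pi (fun _ : Fin (r + 1) => μ) =
      ∫⁻ ω, ENNReal.ofReal (simplexGram fun i => X i ω) ^ s ∂P := by
    intro s
    rw [← hlaw,
      lintegral_map' ((measurable_simplexGram.ennreal_ofReal.pow_const _).aemeasurable) hm]
  have hpos : ∀ᵐ ω ∂P, 0 < simplexGram fun i => X i ω := by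
    have h1 : ∀ᵐ x ∂(P.map fun ω i => X i ω), 0 < simplexGram x := by
      rw [hlaw]
      refine ae_pos_of_lintegral_rpow_lt_top measurable_simplexGram
        (σ := -(δ / 2) / 2) (by linarith) ?_
      rw [h _ (by linarith) (by linarith)]
      exact ENNReal.ofReal_ne_top
    exact ae_of_ae_map hm h1
  have hfac : (0 : ℝ) < r.factorial := by exact_mod_cast r.factorial_pos
  constructor
  · filter_upwards [hpos] with ω hω
    rw [simplexVolume_eq _ hω]
    exact div_pos (Real.sqrt_pos.2 hω) hfac
  · refine (hasCumulantFunction_of_lintegral (measurable_simplexGram.comp_aemeasurable hm) hpos hδ hC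
      hΦ (fun s h1 h2 => ?_) hη ?_).congr_ae ?_
    · exact (hlint _).symm.trans (h s h1 h2)
    · exact (hlint _).symm.trans_ne hfin
    · filter_upwards [hpos] with ω hω
      rw [logVolume, simplexVolume_eq _ hω, mul_div_cancel₀ _ hfac.ne', Real.log_sqrt hω.le]
      simp only [Function.comp_apply]
      ring

end RandomSimplex

/-! ### Cumulant functions of the models -/

namespace RandomSimplex

lemma analyticAt_log_Gamma_affine {b : ℝ} (hb : 0 < b) (c : ℝ) :
    AnalyticAt ℝ (fun s => Real.log (Real.Gamma (b + c * s))) 0 := by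
  have h : AnalyticAt ℝ (fun x => Real.log (Real.Gamma x)) (b + c * 0) :=
    analyticAt_log_Gamma (by simpa using hb)
  have h2 : AnalyticAt ℝ (fun s : ℝ => b + c * s) 0 := by fun_prop
  exact AnalyticAt.fun_comp (g := fun x => Real.log (Real.Gamma x)) h h2

/-- The cumulant generating function of the logarithmic volume in the Gaussian model, up to an
additive constant. -/
noncomputable def gaussCumulantFun (n r : ℕ) (s : ℝ) : ℝ :=
  1 / 2 * Real.log (2 ^ r * (r + 1)) * s +
    ∑ j ∈ Finset.range r, Real.log (Real.Gamma (((n : ℝ) - j) / 2 + 1 / 2 * s))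

/-- The cumulant generating function of the logarithmic volume in the Beta model (`ν > 0`) and in
the spherical model (`ν = 0`), up to an additive constant. -/
noncomputable def betaCumulantFun (n r : ℕ) (ν s : ℝ) : ℝ :=
  ∑ j ∈ Finset.range r, Real.log (Real.Gamma (((n : ℝ) - j) / 2 + 1 / 2 * s)) -
    (r + 1) * Real.log (Real.Gamma (((n : ℝ) + ν) / 2 + 1 / 2 * s)) +
    (Real.log (Real.Gamma ((r + 1) * (((n : ℝ) + ν) / 2 - 1) + 1 + (r + 1) / 2 * s)) -
      Real.log (Real.Gamma ((r + 1) * (((n : ℝ) + ν) / 2 - 1) + 1 + r / 2 * s)))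

lemma half_pos_of_mem_range {n r : ℕ} (hrn : r ≤ n) {j : ℕ} (hj : j ∈ Finset.range r) :
    1 / 2 ≤ ((n : ℝ) - j) / 2 := by
  have : (j : ℝ) + 1 ≤ n := by
    have := Finset.mem_range.1 hj
    exact_mod_cast (by omega : j + 1 ≤ n)
  linarith

lemma analyticAt_sum_log_Gamma {n r : ℕ} (hrn : r ≤ n) :
    AnalyticAt ℝ (fun s : ℝ => ∑ j ∈ Finset.range r,
      Real.log (Real.Gamma (((n : ℝ) - j) / 2 + 1 / 2 * s))) 0 :=
  Finset.analyticAt_fun_sum _ fun j hj => analyticAt_log_Gamma_affine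
    (by linarith [half_pos_of_mem_range hrn hj]) _

lemma analyticAt_gaussCumulantFun {n r : ℕ} (hrn : r ≤ n) :
    AnalyticAt ℝ (gaussCumulantFun n r) 0 := by
  have h : AnalyticAt ℝ (fun s : ℝ => 1 / 2 * Real.log (2 ^ r * (r + 1)) * s) 0 := by fun_prop
  exact h.fun_add (analyticAt_sum_log_Gamma hrn)

section

variable {n r : ℕ} {ν : ℝ}

lemma beta_arg_pos (hn : 2 ≤ n) (hν : 0 ≤ ν) :
    1 ≤ ((r : ℝ) + 1) * (((n : ℝ) + ν) / 2 - 1) + 1 := by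
  have hn2 : (2 : ℝ) ≤ n := by exact_mod_cast hn
  have : 0 ≤ ((n : ℝ) + ν) / 2 - 1 := by linarith
  have : 0 ≤ ((r : ℝ) + 1) * (((n : ℝ) + ν) / 2 - 1) := by positivity
  linarith

lemma analyticAt_betaCumulantFun (hn : 2 ≤ n) (hrn : r ≤ n) (hν : 0 ≤ ν) :
    AnalyticAt ℝ (betaCumulantFun n r ν) 0 := by
  have hn2 : (2 : ℝ) ≤ n := by exact_mod_cast hn
  have hA : 1 ≤ ((r : ℝ) + 1) * (((n : ℝ) + ν) / 2 - 1) + 1 := beta_arg_pos hn hν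
  have ha : 0 < ((n : ℝ) + ν) / 2 := by linarith
  exact ((analyticAt_sum_log_Gamma hrn).fun_sub
    (analyticAt_const.fun_mul (analyticAt_log_Gamma_affine ha _))).fun_add
    ((analyticAt_log_Gamma_affine (by linarith) _).fun_sub
      (analyticAt_log_Gamma_affine (by linarith) _))

end

lemma iteratedDeriv_sum_log_Gamma {n r : ℕ} (hrn : r ≤ n) (m : ℕ) :
    iteratedDeriv (m + 2) (fun s : ℝ => ∑ j ∈ Finset.range r,
      Real.log (Real.Gamma (((n : ℝ) - j) / 2 + 1 / 2 * s))) 0 =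
      (-1) ^ m * (m + 1).factorial * ((1 / 2) ^ (m + 2) *
        ∑ j ∈ Finset.range r, polySum (m + 2) (((n : ℝ) - j) / 2)) := by
  rw [iteratedDeriv_fun_sum fun j hj => (analyticAt_log_Gamma_affine
    (by linarith [half_pos_of_mem_range hrn hj]) _).contDiffAt, Finset.mul_sum, Finset.mul_sum]
  refine Finset.sum_congr rfl fun j hj => ?_
  rw [iteratedDeriv_log_Gamma_affine _ _ _ (by linarith [half_pos_of_mem_range hrn hj]), mul_zero,
    add_zero]
  ring

lemma iteratedDeriv_gaussCumulantFun {n r : ℕ} (hrn : r ≤ n) (m : ℕ) :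
    iteratedDeriv (m + 2) (gaussCumulantFun n r) 0 =
      (-1) ^ m * (m + 1).factorial * ((1 / 2) ^ (m + 2) *
        ∑ j ∈ Finset.range r, polySum (m + 2) (((n : ℝ) - j) / 2)) := by
  have h : AnalyticAt ℝ (fun s : ℝ => 1 / 2 * Real.log (2 ^ r * (r + 1)) * s) 0 := by fun_prop
  have h0 : iteratedDeriv (m + 2) (fun s : ℝ => 1 / 2 * Real.log (2 ^ r * (r + 1)) * s) 0 = 0 := by
    have h1 : deriv (fun s : ℝ => 1 / 2 * Real.log (2 ^ r * (r + 1)) * s) =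
        fun _ => 1 / 2 * Real.log (2 ^ r * (r + 1)) := by
      ext s
      simp
    rw [iteratedDeriv_succ', h1, iteratedDeriv_const]
    simp
  rw [show gaussCumulantFun n r = fun s => 1 / 2 * Real.log (2 ^ r * (r + 1)) * s +
      ∑ j ∈ Finset.range r, Real.log (Real.Gamma (((n : ℝ) - j) / 2 + 1 / 2 * s)) from rfl,
    iteratedDeriv_fun_add h.contDiffAt (analyticAt_sum_log_Gamma hrn).contDiffAt, h0, zero_add,
    iteratedDeriv_sum_log_Gamma hrn]

lemma deriv_gaussCumulantFun {n r : ℕ} (hrn : r ≤ n) :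
    deriv (gaussCumulantFun n r) 0 = 1 / 2 * Real.log (2 ^ r * (r + 1)) +
      1 / 2 * ∑ j ∈ Finset.range r, digammaReal (((n : ℝ) - j) / 2) := by
  have h1 : HasDerivAt (fun s : ℝ => 1 / 2 * Real.log (2 ^ r * (r + 1)) * s)
      (1 / 2 * Real.log (2 ^ r * (r + 1))) 0 := by
    simpa using (hasDerivAt_id (0 : ℝ)).const_mul (1 / 2 * Real.log (2 ^ r * (r + 1)))
  have h2 : HasDerivAt (fun s : ℝ => ∑ j ∈ Finset.range r,
      Real.log (Real.Gamma (((n : ℝ) - j) / 2 + 1 / 2 * s)))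
      (∑ j ∈ Finset.range r, 1 / 2 * digammaReal (((n : ℝ) - j) / 2)) 0 := by
    refine HasDerivAt.fun_sum fun j hj => ?_
    have hp := half_pos_of_mem_range hrn hj
    have h3 := (analyticAt_log_Gamma_affine (by linarith : 0 < ((n : ℝ) - j) / 2)
      (1 / 2)).differentiableAt.hasDerivAt
    rw [deriv_log_Gamma_affine _ _ (by linarith), mul_zero, add_zero] at h3
    exact h3
  rw [Finset.mul_sum]
  exact (h1.fun_add h2).deriv

lemma iteratedDeriv_betaCumulantFun {n r : ℕ} (hn : 2 ≤ n) (hrn : r ≤ n) {ν : ℝ} (hν : 0 ≤ ν)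
    (m : ℕ) :
    iteratedDeriv (m + 2) (betaCumulantFun n r ν) 0 =
      (-1) ^ m * (m + 1).factorial * ((1 / 2) ^ (m + 2) *
        (∑ j ∈ Finset.range r, polySum (m + 2) (((n : ℝ) - j) / 2) -
          (r + 1) * polySum (m + 2) (((n : ℝ) + ν) / 2) +
          (((r : ℝ) + 1) ^ (m + 2) - (r : ℝ) ^ (m + 2)) *
            polySum (m + 2) ((r + 1) * (((n : ℝ) + ν) / 2 - 1) + 1))) := by
  have hn2 : (2 : ℝ) ≤ n := by exact_mod_cast hn
  have hA : 1 ≤ ((r : ℝ) + 1) * (((n : ℝ) + ν) / 2 - 1) + 1 := beta_arg_pos hn hν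
  have ha : 0 < ((n : ℝ) + ν) / 2 := by linarith
  have f1 := analyticAt_sum_log_Gamma hrn
  have f2 := analyticAt_log_Gamma_affine ha (1 / 2)
  have f3 := analyticAt_log_Gamma_affine (by linarith : 0 < ((r : ℝ) + 1) * (((n : ℝ) + ν) / 2 - 1) + 1)
    (((r : ℝ) + 1) / 2)
  have f4 := analyticAt_log_Gamma_affine (by linarith : 0 < ((r : ℝ) + 1) * (((n : ℝ) + ν) / 2 - 1) + 1)
    ((r : ℝ) / 2)
  have f2' : AnalyticAt ℝ (fun s => ((r : ℝ) + 1) *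
      Real.log (Real.Gamma (((n : ℝ) + ν) / 2 + 1 / 2 * s))) 0 := analyticAt_const.fun_mul f2
  rw [show betaCumulantFun n r ν = fun s =>
    ∑ j ∈ Finset.range r, Real.log (Real.Gamma (((n : ℝ) - j) / 2 + 1 / 2 * s)) -
    (r + 1) * Real.log (Real.Gamma (((n : ℝ) + ν) / 2 + 1 / 2 * s)) +
    (Real.log (Real.Gamma ((r + 1) * (((n : ℝ) + ν) / 2 - 1) + 1 + (r + 1) / 2 * s)) -
      Real.log (Real.Gamma ((r + 1) * (((n : ℝ) + ν) / 2 - 1) + 1 + r / 2 * s))) from rfl,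
    iteratedDeriv_fun_add (f1.fun_sub f2').contDiffAt (f3.fun_sub f4).contDiffAt,
    iteratedDeriv_fun_sub f1.contDiffAt f2'.contDiffAt,
    iteratedDeriv_fun_sub f3.contDiffAt f4.contDiffAt, iteratedDeriv_const_mul_field,
    iteratedDeriv_sum_log_Gamma hrn, iteratedDeriv_log_Gamma_affine _ _ _ (by linarith),
    iteratedDeriv_log_Gamma_affine _ _ _ (by linarith),
    iteratedDeriv_log_Gamma_affine _ _ _ (by linarith)]
  simp only [mul_zero, add_zero, div_pow]
  ring

variable {Ω : Type*} [MeasurableSpace Ω]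

/-- The logarithmic volume in the Gaussian model. -/
lemma IsIIDSample.gaussian {n r : ℕ} (hrn : r ≤ n) {P : Measure Ω} [IsProbabilityMeasure P]
    {X : Fin (r + 1) → Ω → EuclideanSpace ℝ (Fin n)}
    (hX : IsIIDSample P (stdGaussian (EuclideanSpace ℝ (Fin n))) X) :
    (∀ᵐ ω ∂P, 0 < simplexVolume fun i => X i ω) ∧
      HasCumulantFunction (logVolume X) P (gaussCumulantFun n r) := by
  have hex : ∀ j, ∃ C : ℝ, 0 < C ∧ ∀ σ : ℝ, -(1 / 2) < σ → j < r →
      gaussMoment (n - j) σ = ENNReal.ofReal (C * 2 ^ σ * Real.Gamma (((n : ℝ) - j) / 2 + σ)) := by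
    intro j
    by_cases hj : j < r
    · obtain ⟨C, hC, h⟩ := gaussMoment_eq (n - j) (by omega)
      refine ⟨C, hC, fun σ hσ _ => ?_⟩
      rw [h σ hσ, Nat.cast_sub (by omega)]
    · exact ⟨1, one_pos, fun _ _ h => (hj h).elim⟩
  choose C hC hgm using hex
  have key : ∀ s, -1 < s → ∫⁻ x, ENNReal.ofReal (simplexGram x) ^ (s / 2)
      ∂Measure.pi (fun _ : Fin (r + 1) => stdGaussian (EuclideanSpace ℝ (Fin n))) =
      ENNReal.ofReal ((∏ j ∈ Finset.range r, C j) * Real.exp (gaussCumulantFun n r s)) := by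
    intro s hs
    have h := lintegral_simplexGram_stdGaussian (n := n) hrn (by linarith : -(1 / 2) < s / 2)
      (fun _ => 1) (fun _ => one_pos)
    simp only [Real.sqrt_one, inv_one, one_smul, Finset.prod_const_one, Finset.sum_const,
      Finset.card_univ, Fintype.card_fin, nsmul_eq_mul, mul_one, div_one] at h
    have hΓ : ∀ j ∈ Finset.range r, 0 < Real.Gamma (((n : ℝ) - j) / 2 + s / 2) := fun j hj =>
      Real.Gamma_pos_of_pos (by linarith [half_pos_of_mem_range hrn hj])
    rw [h, Finset.prod_congr rfl fun j hj => hgm j (s / 2) (by linarith) (Finset.mem_range.1 hj),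
      ← ENNReal.ofReal_prod_of_nonneg fun j hj =>
        (mul_pos (mul_pos (hC j) (by positivity)) (hΓ j hj)).le,
      ENNReal.ofReal_rpow_of_pos (by positivity), ← ENNReal.ofReal_mul (by positivity)]
    congr 1
    rw [Finset.prod_mul_distrib, Finset.prod_mul_distrib, Finset.prod_const, Finset.card_range,
      gaussCumulantFun, Real.exp_add, Real.exp_sum]
    have h1 : ∏ j ∈ Finset.range r, Real.exp (Real.log (Real.Gamma (((n : ℝ) - j) / 2 + 1 / 2 * s))) =
        ∏ j ∈ Finset.range r, Real.Gamma (((n : ℝ) - j) / 2 + s / 2) := by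
      refine Finset.prod_congr rfl fun j hj => ?_
      rw [show 1 / 2 * s = s / 2 by ring, Real.exp_log (hΓ j hj)]
    have h2 : Real.exp (1 / 2 * Real.log (2 ^ r * (r + 1)) * s) =
        ((r + 1 : ℕ) : ℝ) ^ (s / 2) * (2 ^ (s / 2)) ^ r := by
      rw [← Real.rpow_mul_natCast two_pos.le, mul_comm (s / 2), Real.rpow_natCast_mul two_pos.le,
        ← Real.mul_rpow (by positivity) (by positivity), Real.rpow_def_of_pos (by positivity)]
      push_cast
      ring_nf
    rw [h1, h2]
    ring
  refine hX.hasCumulantFunction_logVolume one_pos (Finset.prod_pos fun j _ => hC j)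
    (analyticAt_gaussCumulantFun hrn) (fun s hs _ => key s hs) one_pos ?_
  rw [key 1 (by norm_num)]
  exact ENNReal.ofReal_ne_top

lemma ae_norm_le_betaSphericalModel (n : ℕ) (ν : ℝ) : ∀ᵐ x ∂betaSphericalModel n ν, ‖x‖ ≤ 1 := by
  rw [betaSphericalModel]
  split_ifs with h
  · rw [sphericalModel]
    refine Measure.ae_smul_measure ?_ _
    rw [ae_map_iff measurable_subtype_coe.aemeasurable
      (measurableSet_le (by fun_prop) (by fun_prop))]
    exact ae_of_all _ fun u => by simp
  · rw [betaModel]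
    refine (withDensity_absolutelyContinuous _ _).ae_le ?_
    filter_upwards [ae_restrict_mem measurableSet_ball] with x hx
    exact (mem_ball_zero_iff.1 hx).le

lemma betaMoment_eq_exp {n r : ℕ} (hn : 3 ≤ n) (hrn : r ≤ n) {ν : ℝ} (hν : 0 ≤ ν) {s : ℝ}
    (hs : -1 < s) (hs0 : s ≤ 0) :
    betaMoment n r ν (s / 2) = Real.exp (betaCumulantFun n r ν s) := by
  have hn3 : (3 : ℝ) ≤ n := by exact_mod_cast hn
  have hΓ : ∀ j ∈ Finset.range r, 0 < Real.Gamma (((n : ℝ) - j) / 2 + 1 / 2 * s) := fun j hj =>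
    Real.Gamma_pos_of_pos (by linarith [half_pos_of_mem_range hrn hj])
  have ha : 0 < Real.Gamma (((n : ℝ) + ν) / 2 + 1 / 2 * s) := Real.Gamma_pos_of_pos (by linarith)
  have h0 : 0 ≤ ((r : ℝ) + 1) * (((n : ℝ) + ν) / 2 - 1 + s / 2) :=
    mul_nonneg (by positivity) (by linarith)
  have h1 : 0 < Real.Gamma ((r + 1) * (((n : ℝ) + ν) / 2 - 1) + 1 + (r + 1) / 2 * s) :=
    Real.Gamma_pos_of_pos (by linarith)
  have h2 : 0 < Real.Gamma ((r + 1) * (((n : ℝ) + ν) / 2 - 1) + 1 + r / 2 * s) :=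
    Real.Gamma_pos_of_pos (by linarith)
  rw [betaMoment, betaCumulantFun, Real.exp_add, Real.exp_sub, Real.exp_sub, Real.exp_sum,
    Finset.prod_congr rfl fun j hj => Real.exp_log (hΓ j hj), Real.exp_log h1, Real.exp_log h2,
    ← Nat.cast_succ, Real.exp_nat_mul, Real.exp_log ha]
  simp only [Nat.cast_succ, show s / 2 = 1 / 2 * s by ring,
    show ((r : ℝ) + 1) * (1 / 2 * s) = (r + 1) / 2 * s by ring,
    show (r : ℝ) * (1 / 2 * s) = r / 2 * s by ring]

/-- The logarithmic volume in the Beta model and in the spherical model. -/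
lemma IsIIDSample.betaSpherical {n r : ℕ} (hn : 3 ≤ n) (hrn : r ≤ n) {P : Measure Ω}
    [IsProbabilityMeasure P] {ν : ℝ} (hν : 0 ≤ ν)
    {X : Fin (r + 1) → Ω → EuclideanSpace ℝ (Fin n)}
    (hX : IsIIDSample P (betaSphericalModel n ν) X) :
    (∀ᵐ ω ∂P, 0 < simplexVolume fun i => X i ω) ∧
      HasCumulantFunction (logVolume X) P (betaCumulantFun n r ν) := by
  have hprob : IsProbabilityMeasure (betaSphericalModel n ν) := by
    rw [← (hX.law 0).map_eq]
    exact Measure.isProbabilityMeasure_map (hX.law 0).aemeasurable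
  obtain ⟨C, hC, h⟩ : ∃ C : ℝ, 0 < C ∧ ∀ κ : ℝ, 0 < κ → κ < 1 / 2 →
      ∫⁻ x : Fin (r + 1) → EuclideanSpace ℝ (Fin n), ENNReal.ofReal (simplexGram x) ^ (-κ)
        ∂Measure.pi (fun _ => betaSphericalModel n ν) =
            ENNReal.ofReal (C * betaMoment n r ν (-κ)) := by
    rcases hν.eq_or_lt with h0 | h0
    · have : betaSphericalModel n ν = sphericalModel n := by rw [betaSphericalModel, if_pos h0.symm]
      rw [this, ← h0]
      exact lintegral_simplexGram_sphericalModel hn hrn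
    · have : betaSphericalModel n ν = betaModel n ν := by rw [betaSphericalModel, if_neg h0.ne']
      rw [this] at hprob ⊢
      exact lintegral_simplexGram_betaModel hn hrn h0
  refine hX.hasCumulantFunction_logVolume one_pos hC
    (analyticAt_betaCumulantFun (by omega) hrn hν) (fun s h1 h2 => ?_) one_pos ?_
  · have h3 := h (-(s / 2)) (by linarith) (by linarith)
    rw [neg_neg, betaMoment_eq_exp hn hrn hν h1 h2.le] at h3
    exact h3
  · obtain ⟨B, hB⟩ := (isCompact_univ_pi fun _ : Fin (r + 1) =>
      isCompact_closedBall (0 : EuclideanSpace ℝ (Fin n)) 1).bddAbove_image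
      continuous_simplexGram.continuousOn
    have hae : ∀ᵐ x ∂Measure.pi (fun _ : Fin (r + 1) => betaSphericalModel n ν),
        ENNReal.ofReal (simplexGram x) ^ ((1 : ℝ) / 2) ≤ ENNReal.ofReal B ^ ((1 : ℝ) / 2) := by
      have hall : ∀ᵐ x ∂Measure.pi (fun _ : Fin (r + 1) => betaSphericalModel n ν),
          ∀ i, ‖x i‖ ≤ 1 := by
        rw [ae_all_iff]
        intro i
        exact (Measure.quasiMeasurePreserving_eval
          (fun _ : Fin (r + 1) => betaSphericalModel n ν) i).ae (ae_norm_le_betaSphericalModel n ν)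
      filter_upwards [hall] with x hx
      refine ENNReal.rpow_le_rpow (ENNReal.ofReal_le_ofReal (hB ⟨x, ?_, rfl⟩)) (by norm_num)
      exact fun i _ => mem_closedBall_zero_iff.2 (hx i)
    refine ne_top_of_le_ne_top ?_ (lintegral_mono_ae hae)
    rw [lintegral_const, measure_univ, mul_one]
    exact ENNReal.rpow_ne_top_of_nonneg (by norm_num) ENNReal.ofReal_ne_top

end RandomSimplex

/-! ### Estimates of means and variances -/

namespace RandomSimplex

lemma log_succ_div_bounds {l : ℝ} (hl : 0 < l) :
    Real.log ((l + 1) / l) ≤ 1 / l ∧ 1 / l - (1 / l - 1 / (l + 1)) ≤ Real.log ((l + 1) / l) := by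
  constructor
  · have := Real.log_le_sub_one_of_pos (by positivity : 0 < (l + 1) / l)
    rwa [show (l + 1) / l - 1 = 1 / l by field_simp; ring] at this
  · have := Real.one_sub_inv_le_log_of_pos (by positivity : 0 < (l + 1) / l)
    rwa [show 1 - ((l + 1) / l)⁻¹ = 1 / l - (1 / l - 1 / (l + 1)) by field_simp; ring] at this

/-- Harmonic sums exceed logarithms by at most the telescoping sum of `1 / l - 1 / (l + 1)`. -/
lemma sum_inv_bounds {n r : ℕ} (hrn : r ≤ n) :
    Real.log (((n : ℝ) + 1) / (n - r + 1)) ≤ ∑ j ∈ Finset.range r, 1 / ((n : ℝ) - j) ∧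
    ∑ j ∈ Finset.range r, 1 / ((n : ℝ) - j) ≤ Real.log (((n : ℝ) + 1) / (n - r + 1)) +
      (1 / ((n : ℝ) - r + 1) - 1 / (n + 1)) := by
  induction r with
  | zero =>
    have : ((n : ℝ) + 1) / (n + 1) = 1 := div_self (by positivity)
    simp [this]
  | succ r ih =>
    obtain ⟨h1, h2⟩ := ih (by omega)
    have hl : 0 < (n : ℝ) - r := by
      have : (r : ℝ) + 1 ≤ n := by exact_mod_cast hrn
      linarith
    obtain ⟨h3, h4⟩ := log_succ_div_bounds hl
    have hlog : Real.log (((n : ℝ) + 1) / (n - (r + 1 : ℕ) + 1)) =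
        Real.log (((n : ℝ) + 1) / (n - r + 1)) + Real.log (((n : ℝ) - r + 1) / (n - r)) := by
      rw [← Real.log_mul (by positivity) (by positivity)]
      congr 1
      push_cast
      rw [show (n : ℝ) - (r + 1) + 1 = n - r by ring]
      field_simp
    rw [Finset.sum_range_succ, hlog]
    push_cast
    rw [show (n : ℝ) - (r + 1) + 1 = n - r by ring]
    constructor <;> linarith

lemma sum_inv_sq_le {n r : ℕ} (hrn : r ≤ n) :
    ∑ j ∈ Finset.range r, 1 / ((n : ℝ) - j) ^ 2 ≤
      2 * (1 / ((n : ℝ) - r + 1) - 1 / (n + 1)) := by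
  induction r with
  | zero => simp
  | succ r ih =>
    have h1 := ih (by omega)
    have hl : 1 ≤ (n : ℝ) - r := by
      have : (r : ℝ) + 1 ≤ n := by exact_mod_cast hrn
      linarith
    have h2 : 1 / ((n : ℝ) - r) ^ 2 ≤ 2 * (1 / ((n : ℝ) - r) - 1 / (n - r + 1)) := by
      generalize (n : ℝ) - r = l at *
      rw [show 2 * (1 / l - 1 / (l + 1)) = 2 / (l * (l + 1)) by field_simp; ring,
        div_le_div_iff₀ (by positivity) (by positivity)]
      nlinarith
    rw [Finset.sum_range_succ]
    push_cast
    rw [show (n : ℝ) - (r + 1) + 1 = n - r by ring]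
    linarith

lemma sum_polySum_two_bounds {n r : ℕ} (hrn : r ≤ n) :
    1 / 2 * Real.log (((n : ℝ) + 1) / (n - r + 1)) ≤
      1 / 4 * ∑ j ∈ Finset.range r, polySum 2 (((n : ℝ) - j) / 2) ∧
    1 / 4 * ∑ j ∈ Finset.range r, polySum 2 (((n : ℝ) - j) / 2) ≤
      1 / 2 * Real.log (((n : ℝ) + 1) / (n - r + 1)) +
        5 / 2 * (1 / ((n : ℝ) - r + 1) - 1 / (n + 1)) := by
  obtain ⟨h1, h2⟩ := sum_inv_bounds hrn
  have h3 := sum_inv_sq_le hrn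
  have hlow : ∑ j ∈ Finset.range r, 2 * (1 / ((n : ℝ) - j)) ≤
      ∑ j ∈ Finset.range r, polySum 2 (((n : ℝ) - j) / 2) := by
    refine Finset.sum_le_sum fun j hj => ?_
    have hp := half_pos_of_mem_range hrn hj
    have := le_polySum_two (by linarith : 0 < ((n : ℝ) - j) / 2)
    rwa [one_div_div, ← mul_one_div] at this
  have hup : ∑ j ∈ Finset.range r, polySum 2 (((n : ℝ) - j) / 2) ≤
      ∑ j ∈ Finset.range r, (4 * (1 / ((n : ℝ) - j) ^ 2) + 2 * (1 / ((n : ℝ) - j))) := by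
    refine Finset.sum_le_sum fun j hj => ?_
    have hp := half_pos_of_mem_range hrn hj
    have h4 := polySum_le le_rfl (by linarith : 0 < ((n : ℝ) - j) / 2)
    refine h4.trans (le_of_eq ?_)
    have : (n : ℝ) - j ≠ 0 := by linarith
    push_cast
    field_simp
    ring
  rw [← Finset.mul_sum] at hlow
  rw [Finset.sum_add_distrib, ← Finset.mul_sum, ← Finset.mul_sum] at hup
  constructor <;> linarith

lemma variance_gauss_eq {n r : ℕ} (hrn : r ≤ n) : iteratedDeriv 2 (gaussCumulantFun n r) 0 =
    1 / 4 * ∑ j ∈ Finset.range r, polySum 2 (((n : ℝ) - j) / 2) := by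
  have := iteratedDeriv_gaussCumulantFun hrn 0
  norm_num at this ⊢
  exact this

lemma gap_le {n r : ℕ} (hn : 1 ≤ n) (hrn : r ≤ n) :
    1 / ((n : ℝ) - r + 1) - 1 / (n + 1) ≤ r / (n * ((n : ℝ) - r + 1)) := by
  have hr : (r : ℝ) ≤ n := by exact_mod_cast hrn
  have hn1 : (1 : ℝ) ≤ n := by exact_mod_cast hn
  have h1 : 0 < (n : ℝ) - r + 1 := by linarith
  rw [div_sub_div _ _ h1.ne' (by positivity), div_le_div_iff₀ (by positivity) (by positivity)]
  have : (r : ℝ) * n ≤ r * (n + 1) := by gcongr; linarith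
  nlinarith [mul_le_mul_of_nonneg_right this h1.le]

lemma ratio_le_one {n r : ℕ} (hn : 1 ≤ n) (hrn : r ≤ n) :
    (r : ℝ) / (n * ((n : ℝ) - r + 1)) ≤ 1 := by
  have hr : (r : ℝ) ≤ n := by exact_mod_cast hrn
  have hn1 : (1 : ℝ) ≤ n := by exact_mod_cast hn
  rw [div_le_one (mul_pos (by linarith) (by linarith))]
  nlinarith

lemma abs_variance_gauss_sub_le {n r : ℕ} (hn : 1 ≤ n) (hrn : r ≤ n) :
    |iteratedDeriv 2 (gaussCumulantFun n r) 0 - 1 / 2 * Real.log (((n : ℝ) + 1) / (n - r + 1))| ≤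
      5 / 2 * (r / (n * ((n : ℝ) - r + 1))) := by
  rw [variance_gauss_eq hrn]
  obtain ⟨h1, h2⟩ := sum_polySum_two_bounds hrn
  have := gap_le hn hrn
  rw [abs_of_nonneg (by linarith)]
  linarith

/-- The trigamma function at `N` is `1 / N` up to `O(1 / N²)`, and shifting the argument by `D`
costs another `O(D / N²)`. -/
lemma abs_polySum_two_sub_le {x N D : ℝ} (hx : 0 < x) (hN : 0 < N) (hD : |x - N| ≤ D)
    (hxN : N / 2 ≤ x) : |polySum 2 x - 1 / N| ≤ (2 * D + 4) / N ^ 2 := by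
  have h1 := le_polySum_two hx
  have h2 := polySum_le le_rfl hx
  norm_num at h2
  have h3 : |1 / x - 1 / N| ≤ 2 * D / N ^ 2 := by
    rw [div_sub_div _ _ hx.ne' hN.ne', abs_div, abs_of_pos (by positivity : 0 < x * N),
      div_le_div_iff₀ (by positivity) (by positivity), one_mul, mul_one, abs_sub_comm]
    have hD0 : 0 ≤ D := (abs_nonneg _).trans hD
    calc |x - N| * N ^ 2 ≤ D * N ^ 2 := by gcongr
      _ ≤ 2 * D * (x * N) := by nlinarith [mul_nonneg hD0 hN.le]
  have h4 : (x ^ 2)⁻¹ ≤ 4 / N ^ 2 := by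
    rw [inv_eq_one_div, div_le_div_iff₀ (by positivity) (by positivity)]
    nlinarith
  rw [add_div]
  rw [abs_le] at h3 ⊢
  have h5 : 0 ≤ 4 / N ^ 2 := by positivity
  simp only [one_div] at h1 h3 ⊢
  constructor <;> linarith [h3.1, h3.2]

lemma variance_beta_eq {n r : ℕ} (hn : 2 ≤ n) (hrn : r ≤ n) {ν : ℝ} (hν : 0 ≤ ν) :
    iteratedDeriv 2 (betaCumulantFun n r ν) 0 =
    1 / 4 * ∑ j ∈ Finset.range r, polySum 2 (((n : ℝ) - j) / 2) -
      (r + 1) / 4 * polySum 2 (((n : ℝ) + ν) / 2) +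
      (2 * r + 1) / 4 * polySum 2 ((r + 1) * (((n : ℝ) + ν) / 2 - 1) + 1) := by
  have := iteratedDeriv_betaCumulantFun hn hrn hν 0
  rw [zero_add] at this
  rw [this]
  simp only [pow_zero, zero_add, Nat.factorial_one, Nat.cast_one, one_mul]
  ring

/-- The variance in the Beta and spherical models. Replacing the two trigamma values of large
argument by reciprocals, the terms `-(r + 1) / (2 n)` and `(2 r + 1) / (2 n (r + 1))` combine to
`-r² / (2 n (r + 1))`, and the errors are of no larger order than the one in the harmonic sum. -/
lemma abs_variance_beta_sub_le {n r : ℕ} (hn : 4 ≤ n) (hr : 1 ≤ r) (hrn : r ≤ n) {ν : ℝ}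
    (hν : 0 ≤ ν) :
    |iteratedDeriv 2 (betaCumulantFun n r ν) 0 - (1 / 2 * Real.log (((n : ℝ) + 1) / (n - r + 1)) -
      (r : ℝ) ^ 2 / (2 * n * (r + 1)))| ≤ (4 * ν + 19) * (r / (n * ((n : ℝ) - r + 1))) := by
  have hn4 : (4 : ℝ) ≤ n := by exact_mod_cast hn
  have hr1 : (1 : ℝ) ≤ r := by exact_mod_cast hr
  have hrn' : (r : ℝ) ≤ n := by exact_mod_cast hrn
  rw [variance_beta_eq (by omega) hrn hν]
  obtain ⟨h1, h2⟩ := sum_polySum_two_bounds hrn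
  have hgap := gap_le (by omega : 1 ≤ n) hrn
  have ha := abs_polySum_two_sub_le (x := ((n : ℝ) + ν) / 2) (N := n / 2) (D := ν / 2)
    (by linarith) (by linarith) (by rw [abs_le]; constructor <;> linarith) (by linarith)
  have hA := abs_polySum_two_sub_le (x := ((r : ℝ) + 1) * (((n : ℝ) + ν) / 2 - 1) + 1)
    (N := (r + 1) * n / 2) (D := (r + 1) * (ν / 2 + 1)) (by nlinarith) (by positivity)
    (by rw [abs_le]; constructor <;> nlinarith) (by nlinarith)
  set pa := polySum 2 (((n : ℝ) + ν) / 2)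
  set pA := polySum 2 (((r : ℝ) + 1) * (((n : ℝ) + ν) / 2 - 1) + 1)
  set S := 1 / 4 * ∑ j ∈ Finset.range r, polySum 2 (((n : ℝ) - j) / 2)
  set Lg := Real.log (((n : ℝ) + 1) / (n - r + 1))
  have hid : (r : ℝ) ^ 2 / (2 * n * (r + 1)) =
      (r + 1) / 4 * (1 / (n / 2)) - (2 * r + 1) / 4 * (1 / ((r + 1) * n / 2)) := by
    field_simp
    ring
  have e1 : (r + 1) / 4 * |pa - 1 / ((n : ℝ) / 2)| ≤ (2 * ν + 8) * (r / n ^ 2) := by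
    calc ((r : ℝ) + 1) / 4 * |pa - 1 / ((n : ℝ) / 2)|
        ≤ (r + r) / 4 * ((2 * (ν / 2) + 4) / ((n : ℝ) / 2) ^ 2) := by gcongr
      _ = (2 * ν + 8) * (r / n ^ 2) := by field_simp; ring
  have e2 : (2 * r + 1) / 4 * |pA - 1 / (((r : ℝ) + 1) * n / 2)| ≤ (2 * ν + 8) * (r / n ^ 2) := by
    calc (2 * (r : ℝ) + 1) / 4 * |pA - 1 / (((r : ℝ) + 1) * n / 2)|
        ≤ (2 * r + 2) / 4 * ((2 * ((r + 1) * (ν / 2 + 1)) + 2 * (r + 1)) /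
          (((r : ℝ) + 1) * n / 2) ^ 2) := by
          refine mul_le_mul (by linarith) (hA.trans ?_) (abs_nonneg _) (by positivity)
          gcongr
          linarith
      _ = (2 * ν + 8) * (1 / n ^ 2) := by field_simp; ring
      _ ≤ (2 * ν + 8) * (r / n ^ 2) := by gcongr
  have e3 : (r : ℝ) / n ^ 2 ≤ r / (n * ((n : ℝ) - r + 1)) := by
    rw [sq]
    gcongr
    nlinarith
  have e4 : 0 ≤ (r : ℝ) / (n * ((n : ℝ) - r + 1)) := le_trans (by positivity) e3
  have e5 : S - (r + 1) / 4 * pa + (2 * r + 1) / 4 * pA -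
        (1 / 2 * Lg - (r : ℝ) ^ 2 / (2 * n * (r + 1))) =
      (S - 1 / 2 * Lg) - (r + 1) / 4 * (pa - 1 / ((n : ℝ) / 2)) +
        (2 * r + 1) / 4 * (pA - 1 / (((r : ℝ) + 1) * n / 2)) := by
    rw [hid]; ring
  have e6 : |S - 1 / 2 * Lg| ≤ 5 / 2 * (r / (n * ((n : ℝ) - r + 1))) := by
    rw [abs_of_nonneg (by linarith)]
    linarith
  rw [← abs_of_nonneg (by positivity : 0 ≤ ((r : ℝ) + 1) / 4), ← abs_mul] at e1
  rw [← abs_of_nonneg (by positivity : 0 ≤ (2 * (r : ℝ) + 1) / 4), ← abs_mul] at e2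
  rw [e5]
  refine (abs_add_le _ _).trans ((add_le_add_left (abs_sub _ _) _).trans ?_)
  have e7 : (2 * ν + 8) * ((r : ℝ) / n ^ 2) ≤ (2 * ν + 8) * (r / (n * ((n : ℝ) - r + 1))) := by
    gcongr
  linarith

end RandomSimplex

/-! ### Asymptotics of means and variances -/

namespace RandomSimplex

lemma isEquivalent_of_abs_sub_le {u v ε : ℕ → ℝ} (hε : Tendsto ε atTop (𝓝 0))
    (h : ∀ᶠ n in atTop, |u n - v n| ≤ ε n * |v n|) : u ~[atTop] v := by
  refine isLittleO_iff.2 fun c hc => ?_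
  filter_upwards [h, hε.eventually_le_const hc] with n h1 h2
  exact h1.trans (mul_le_mul_of_nonneg_right h2 (abs_nonneg _))

lemma isEquivalent_of_abs_sub_le_const {u v : ℕ → ℝ} (hv : Tendsto v atTop atTop) {B : ℝ}
    (h : ∀ᶠ n in atTop, |u n - v n| ≤ B) : u ~[atTop] v := by
  refine isEquivalent_of_abs_sub_le (hv.const_div_atTop B) ?_
  filter_upwards [h, hv.eventually_gt_atTop 0] with n h1 h2
  rwa [abs_of_pos h2, div_mul_cancel₀ _ h2.ne']

variable {r : ℕ → ℕ}

lemma tendsto_div_of_isLittleO (h : (fun n => (r n : ℝ)) =o[atTop] (fun n => (n : ℝ))) :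
    Tendsto (fun n => (r n : ℝ) / n) atTop (𝓝 0) := h.tendsto_div_nhds_zero

lemma tendsto_div_of_isEquivalent {α : ℝ}
    (h : (fun n => (r n : ℝ)) ~[atTop] (fun n => α * (n : ℝ))) :
    Tendsto (fun n => (r n : ℝ) / n) atTop (𝓝 α) := by
  have h1 : (fun n => (r n : ℝ) / n) ~[atTop] (fun n => α * (n : ℝ) / n) :=
    h.div IsEquivalent.refl
  refine h1.symm.tendsto_nhds ?_
  refine tendsto_const_nhds.congr' ?_
  filter_upwards [eventually_gt_atTop 0] with n hn
  have : (n : ℝ) ≠ 0 := by exact_mod_cast hn.ne'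
  field_simp

/-- If the dimension of the simplex is of smaller order than that of the space, or proportional to
it with a factor less than one, then `n - r + 1` is at least proportional to `n`. -/
lemma exists_le_sub (hr : ∀ n, 1 ≤ n → 1 ≤ r n ∧ r n ≤ n)
    (h : (fun n => (r n : ℝ)) =o[atTop] (fun n => (n : ℝ)) ∨
      (∃ α : ℝ, 0 < α ∧ α < 1 ∧ (fun n => (r n : ℝ)) ~[atTop] (fun n => α * (n : ℝ)))) :
    ∃ c : ℝ, 0 < c ∧ c ≤ 1 ∧ ∀ n : ℕ, 1 ≤ n → c * n ≤ (n : ℝ) - r n + 1 := by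
  obtain ⟨β, hβ0, hβ, hlim⟩ : ∃ β : ℝ, 0 ≤ β ∧ β < 1 ∧
      Tendsto (fun n => (r n : ℝ) / n) atTop (𝓝 β) := by
    rcases h with h | ⟨α, h0, h1, h⟩
    · exact ⟨0, le_rfl, one_pos, tendsto_div_of_isLittleO h⟩
    · exact ⟨α, h0.le, h1, tendsto_div_of_isEquivalent h⟩
  obtain ⟨N, hN⟩ := eventually_atTop.1
    (hlim.eventually_le_const (by linarith : β < (1 + β) / 2))
  refine ⟨min ((1 - β) / 2) (1 / (N + 1)), lt_min (by linarith) (by positivity),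
    (min_le_left _ _).trans (by linarith), fun n hn => ?_⟩
  have hn0 : (0 : ℝ) < n := by exact_mod_cast hn
  rcases le_total N n with h1 | h1
  · have h2 := (div_le_iff₀ hn0).1 (hN n h1)
    calc min ((1 - β) / 2) (1 / ((N : ℝ) + 1)) * n ≤ (1 - β) / 2 * n := by
          gcongr; exact min_le_left _ _
      _ ≤ _ := by linarith
  · have h2 : (r n : ℝ) ≤ n := by exact_mod_cast (hr n hn).2
    have h3 : (n : ℝ) ≤ N := by exact_mod_cast h1
    calc min ((1 - β) / 2) (1 / ((N : ℝ) + 1)) * n ≤ 1 / ((N : ℝ) + 1) * n := by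
          gcongr; exact min_le_right _ _
      _ ≤ 1 := by rw [one_div_mul_eq_div, div_le_one (by positivity)]; linarith
      _ ≤ _ := by linarith

lemma variance_equiv_of_isLittleO (hr : ∀ n, 1 ≤ n → 1 ≤ r n ∧ r n ≤ n) {V : ℕ → ℝ} {K : ℝ}
    (hK : 0 ≤ K)
    (hV : ∀ᶠ n in atTop, |V n - 1 / 2 * Real.log (((n : ℝ) + 1) / (n - r n + 1))| ≤
      K * (r n / (n * ((n : ℝ) - r n + 1))))
    (h : (fun n => (r n : ℝ)) =o[atTop] (fun n => (n : ℝ))) :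
    V ~[atTop] (fun n => (r n : ℝ) / (2 * n)) := by
  have hlim := tendsto_div_of_isLittleO h
  refine isEquivalent_of_abs_sub_le (ε := fun n => (2 + 4 * K) * ((r n : ℝ) / n)) ?_ ?_
  · simpa using hlim.const_mul (2 + 4 * K)
  · filter_upwards [hV, hlim.eventually_le_const (by norm_num : (0 : ℝ) < 1 / 2),
      eventually_ge_atTop 1] with n h1 h2 hn
    obtain ⟨hr1, hrn⟩ := hr n hn
    have hr1' : (1 : ℝ) ≤ r n := by exact_mod_cast hr1
    have hrn' : (r n : ℝ) ≤ n := by exact_mod_cast hrn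
    have hn1 : (1 : ℝ) ≤ n := by exact_mod_cast hn
    rw [div_le_iff₀ (by linarith)] at h2
    generalize (r n : ℝ) = x at *
    generalize (n : ℝ) = y at *
    have hd : 0 < y - x + 1 := by linarith
    have hlow := Real.one_sub_inv_le_log_of_pos (by positivity : 0 < (y + 1) / (y - x + 1))
    have hup := Real.log_le_sub_one_of_pos (by positivity : 0 < (y + 1) / (y - x + 1))
    have e1 : |Real.log ((y + 1) / (y - x + 1)) - x / y| ≤ x / y * (2 * x / y) := by
      rw [abs_le]
      constructor
      · have h3 : x / y - (1 - ((y + 1) / (y - x + 1))⁻¹) = x / (y * (y + 1)) := by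
          rw [inv_div]; field_simp; ring
        have h4 : x / (y * (y + 1)) ≤ x / y * (2 * x / y) := by
          rw [div_mul_div_comm, div_le_div_iff₀ (by positivity) (by positivity)]
          have : y * y ≤ 2 * x * (y * (y + 1)) := by
            nlinarith [mul_pos (by linarith : 0 < y) (by linarith : 0 < y)]
          nlinarith
        linarith
      · have h3 : (y + 1) / (y - x + 1) - 1 = x / (y - x + 1) := by field_simp; ring
        have h4 : x / (y - x + 1) ≤ x / y + x / y * (2 * x / y) := by
          rw [show x / y + x / y * (2 * x / y) = x * (y + 2 * x) / (y * y) by field_simp,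
            div_le_div_iff₀ hd (by positivity)]
          have : y * y ≤ (y + 2 * x) * (y - x + 1) := by nlinarith
          nlinarith
        linarith
    have e2 : K * (x / (y * (y - x + 1))) ≤ K * (x / y * (2 * x / y)) := by
      gcongr
      rw [div_mul_div_comm, div_le_div_iff₀ (by positivity) (by positivity)]
      have : y * y ≤ 2 * x * (y * (y - x + 1)) := by nlinarith [mul_pos (by linarith : 0 < y) hd]
      nlinarith
    rw [abs_of_nonneg (by positivity : 0 ≤ x / (2 * y))]
    have e3 : (2 + 4 * K) * (x / y) * (x / (2 * y)) =
        1 / 2 * (x / y * (2 * x / y)) + K * (x / y * (2 * x / y)) := by field_simp; ring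
    rw [e3, show V n - x / (2 * y) = (V n - 1 / 2 * Real.log ((y + 1) / (y - x + 1))) +
      1 / 2 * (Real.log ((y + 1) / (y - x + 1)) - x / y) by field_simp; ring]
    refine (abs_add_le _ _).trans ?_
    rw [abs_mul, abs_of_pos (by norm_num : (0 : ℝ) < 1 / 2)]
    linarith

lemma tendsto_inv_natCast : Tendsto (fun n : ℕ => 1 / (n : ℝ)) atTop (𝓝 0) :=
  tendsto_const_div_atTop_nhds_zero_nat 1

lemma variance_equiv_of_proportional {V : ℕ → ℝ} {K : ℝ}
    (hV : ∀ᶠ n in atTop, |V n - 1 / 2 * Real.log (((n : ℝ) + 1) / (n - r n + 1))| ≤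
      K * (r n / (n * ((n : ℝ) - r n + 1)))) {α : ℝ} (hα0 : 0 < α) (hα : α < 1)
    (h : (fun n => (r n : ℝ)) ~[atTop] (fun n => α * (n : ℝ))) :
    V ~[atTop] (fun _ => 1 / 2 * Real.log (1 / (1 - α))) := by
  have hlim := tendsto_div_of_isEquivalent h
  have hα1 : 0 < 1 - α := by linarith
  have hne : 1 / 2 * Real.log (1 / (1 - α)) ≠ 0 := by
    have : 0 < Real.log (1 / (1 - α)) := Real.log_pos (by rw [lt_div_iff₀ hα1]; linarith)
    positivity
  refine (isEquivalent_const_iff_tendsto hne).2 ?_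
  have hden : Tendsto (fun n : ℕ => 1 - (r n : ℝ) / n + 1 / n) atTop (𝓝 (1 - α)) := by
    simpa using (tendsto_const_nhds.sub hlim).add tendsto_inv_natCast
  have hLg : Tendsto (fun n : ℕ => 1 / 2 * Real.log (((n : ℝ) + 1) / (n - r n + 1))) atTop
      (𝓝 (1 / 2 * Real.log (1 / (1 - α)))) := by
    have h1 : Tendsto (fun n : ℕ => 1 / 2 * Real.log ((1 + 1 / (n : ℝ)) / (1 - (r n : ℝ) / n + 1 / n)))
        atTop (𝓝 (1 / 2 * Real.log ((1 + 0) / (1 - α)))) :=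
      (((tendsto_inv_natCast.const_add 1).div hden hα1.ne').log (by positivity)).const_mul _
    rw [add_zero] at h1
    refine h1.congr' ?_
    filter_upwards [eventually_gt_atTop 0] with n hn
    have : (n : ℝ) ≠ 0 := by exact_mod_cast hn.ne'
    rw [show 1 + 1 / (n : ℝ) = ((n : ℝ) + 1) / n by field_simp,
      show 1 - (r n : ℝ) / n + 1 / n = ((n : ℝ) - r n + 1) / n by field_simp,
      div_div_div_cancel_right₀ this]
  have herr : Tendsto (fun n : ℕ => K * ((r n : ℝ) / (n * ((n : ℝ) - r n + 1)))) atTop (𝓝 0) := by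
    have h1 : Tendsto (fun n : ℕ => K * ((r n : ℝ) / n * (1 / n) / (1 - (r n : ℝ) / n + 1 / n))) atTop
        (𝓝 (K * (α * 0 / (1 - α)))) :=
      ((hlim.mul tendsto_inv_natCast).div hden hα1.ne').const_mul _
    rw [mul_zero, zero_div, mul_zero] at h1
    refine h1.congr' ?_
    filter_upwards [eventually_gt_atTop 0] with n hn
    have : (n : ℝ) ≠ 0 := by exact_mod_cast hn.ne'
    rw [show 1 - (r n : ℝ) / n + 1 / n = ((n : ℝ) - r n + 1) / n by field_simp,
      div_mul_div_comm, mul_one, div_div_div_eq, mul_assoc, mul_comm (r n : ℝ),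
      mul_div_mul_left _ _ this]
  have hdiff : Tendsto (fun n : ℕ => V n - 1 / 2 * Real.log (((n : ℝ) + 1) / (n - r n + 1))) atTop
      (𝓝 0) := squeeze_zero_norm' hV herr
  simpa using hdiff.add hLg

lemma variance_equiv_of_sub_isLittleO (hr : ∀ n, 1 ≤ n → 1 ≤ r n ∧ r n ≤ n) {V : ℕ → ℝ} {B : ℝ}
    (hV : ∀ᶠ n in atTop, |V n - 1 / 2 * Real.log (((n : ℝ) + 1) / (n - r n + 1))| ≤ B)
    (h : (fun n : ℕ => (n : ℝ) - r n) =o[atTop] (fun n => (n : ℝ))) :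
    V ~[atTop] (fun n => 1 / 2 * Real.log ((n : ℝ) / ((n : ℝ) - r n + 1))) := by
  have hquot : Tendsto (fun n : ℕ => (n : ℝ) / ((n : ℝ) - r n + 1)) atTop atTop := by
    have h1 : Tendsto (fun n : ℕ => ((n : ℝ) - r n) / n + 1 / n) atTop (𝓝 0) := by
      simpa using h.tendsto_div_nhds_zero.add tendsto_inv_natCast
    have h2 : Tendsto (fun n : ℕ => ((n : ℝ) - r n) / n + 1 / n) atTop (𝓝[>] 0) := by
      refine tendsto_nhdsWithin_iff.2 ⟨h1, ?_⟩
      filter_upwards [eventually_ge_atTop 1] with n hn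
      have h3 : (r n : ℝ) ≤ n := by exact_mod_cast (hr n hn).2
      have h4 : (0 : ℝ) < n := by exact_mod_cast hn
      have h5 : 0 ≤ ((n : ℝ) - r n) / n := div_nonneg (by linarith) h4.le
      have h6 : 0 < 1 / (n : ℝ) := by positivity
      exact add_pos_of_nonneg_of_pos h5 h6
    refine h2.inv_tendsto_nhdsGT_zero.congr fun n => ?_
    simp only [Pi.inv_apply]
    rw [← add_div, inv_div]
  have hT : Tendsto (fun n : ℕ => 1 / 2 * Real.log ((n : ℝ) / ((n : ℝ) - r n + 1))) atTop atTop :=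
    (Real.tendsto_log_atTop.comp hquot).const_mul_atTop (by norm_num)
  refine isEquivalent_of_abs_sub_le_const (B := B + 1 / 2) hT ?_
  filter_upwards [hV, eventually_ge_atTop 1] with n h1 hn
  have h3 : (r n : ℝ) ≤ n := by exact_mod_cast (hr n hn).2
  have h4 : (1 : ℝ) ≤ n := by exact_mod_cast hn
  have h5 : 0 < (n : ℝ) - r n + 1 := by linarith
  have hlog : Real.log (((n : ℝ) + 1) / (n - r n + 1)) =
      Real.log ((n : ℝ) / ((n : ℝ) - r n + 1)) + Real.log (((n : ℝ) + 1) / n) := by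
    rw [← Real.log_mul (by positivity) (by positivity)]
    congr 1
    field_simp
  obtain ⟨h6, -⟩ := log_succ_div_bounds (by linarith : (0 : ℝ) < n)
  have h7 : 0 ≤ Real.log (((n : ℝ) + 1) / n) := Real.log_nonneg (by
    rw [le_div_iff₀ (by linarith)]; linarith)
  have h8 : 1 / (n : ℝ) ≤ 1 := by rw [div_le_one (by linarith)]; exact h4
  rw [hlog, abs_le] at h1
  rw [abs_le]
  constructor <;> linarith [h1.1, h1.2]

/-- The numbers `log (n / (n - j))` are at most one on average: the right-hand side is the integral
of `x ↦ log (n / (n - x))` over `[0, r]`. -/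
lemma sum_log_div_le {n r : ℕ} (hrn : r ≤ n) :
    ∑ j ∈ Finset.range r, Real.log ((n : ℝ) / (n - j)) ≤
      r - (n - r) * Real.log ((n : ℝ) / (n - r)) := by
  induction r with
  | zero =>
    rcases Nat.eq_zero_or_pos n with h | h
    · simp [h]
    · have : (n : ℝ) / n = 1 := div_self (by positivity)
      simp [this]
  | succ r ih =>
    have h1 := ih (by omega)
    have hn : (0 : ℝ) < n := by exact_mod_cast (by omega : 0 < n)
    have hl : 1 ≤ (n : ℝ) - r := by
      have : (r : ℝ) + 1 ≤ n := by exact_mod_cast hrn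
      linarith
    rw [Finset.sum_range_succ]
    push_cast
    rw [show (n : ℝ) - (r + 1) = n - r - 1 by ring]
    generalize (n : ℝ) - r = k at *
    rcases hl.eq_or_lt with hk | hk
    · rw [← hk, sub_self, zero_mul, sub_zero]
      rw [← hk] at h1
      linarith
    · have h2 : Real.log ((n : ℝ) / (k - 1)) = Real.log (n / k) + Real.log (k / (k - 1)) := by
        rw [← Real.log_mul (by positivity) (div_ne_zero (by linarith) (by linarith))]
        congr 1
        have : k - 1 ≠ 0 := by linarith
        field_simp
      have h3 := Real.log_le_sub_one_of_pos (div_pos (by linarith) (by linarith) : 0 < k / (k - 1))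
      have h4 : (k - 1) * Real.log (k / (k - 1)) ≤ 1 := by
        have : (k - 1) * (k / (k - 1) - 1) = 1 := by
          have : k - 1 ≠ 0 := by linarith
          field_simp
          ring
        calc _ ≤ (k - 1) * (k / (k - 1) - 1) := mul_le_mul_of_nonneg_left h3 (by linarith)
          _ = 1 := this
      rw [h2]
      linarith

lemma abs_deriv_gaussCumulantFun_sub_le {n r : ℕ} (hrn : r ≤ n) :
    |deriv (gaussCumulantFun n r) 0 - r / 2 * Real.log n| ≤ 2 * r := by
  rcases Nat.eq_zero_or_pos r with h0 | h0
  · subst h0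
    rw [deriv_gaussCumulantFun hrn]
    simp
  have hn : (0 : ℝ) < n := by exact_mod_cast (by omega : 0 < n)
  have hrr : (0 : ℝ) < r := by exact_mod_cast h0
  have hrn' : (r : ℝ) ≤ n := by exact_mod_cast hrn
  have hdig : ∀ j ∈ Finset.range r, Real.log n - Real.log ((n : ℝ) / (n - j)) - Real.log 2 - 2 ≤
      digammaReal (((n : ℝ) - j) / 2) ∧
      digammaReal (((n : ℝ) - j) / 2) ≤ Real.log n - Real.log ((n : ℝ) / (n - j)) - Real.log 2 := by
    intro j hj
    have hp := half_pos_of_mem_range hrn hj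
    obtain ⟨h1, h2⟩ := digammaReal_bounds (by linarith : 0 < ((n : ℝ) - j) / 2)
    have hnj : 0 < (n : ℝ) - j := by linarith
    rw [Real.log_div hnj.ne' two_ne_zero] at h1 h2
    rw [Real.log_div hn.ne' hnj.ne']
    have h3 : 1 / (((n : ℝ) - j) / 2) ≤ 2 := by
      rw [div_le_iff₀ (by linarith)]; linarith
    constructor <;> linarith
  have hlow := Finset.sum_le_sum fun j hj => (hdig j hj).1
  have hup := Finset.sum_le_sum fun j hj => (hdig j hj).2
  simp only [Finset.sum_sub_distrib, Finset.sum_const, Finset.card_range, nsmul_eq_mul] at hlow hup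
  have hsum := sum_log_div_le hrn
  have hsum0 : 0 ≤ ∑ j ∈ Finset.range r, Real.log ((n : ℝ) / (n - j)) := by
    refine Finset.sum_nonneg fun j hj => Real.log_nonneg ?_
    have hp := half_pos_of_mem_range hrn hj
    rw [le_div_iff₀ (by linarith)]
    have : (0 : ℝ) ≤ j := by positivity
    linarith
  have hrest : 0 ≤ ((n : ℝ) - r) * Real.log ((n : ℝ) / (n - r)) := by
    rcases hrn'.eq_or_lt with h | h
    · rw [h]; simp
    · exact mul_nonneg (by linarith) (Real.log_nonneg (by
        rw [le_div_iff₀ (by linarith)]; linarith))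
  have hlr : 0 ≤ Real.log ((r : ℝ) + 1) ∧ Real.log ((r : ℝ) + 1) ≤ r :=
    ⟨Real.log_nonneg (by linarith), by
      have := Real.log_le_sub_one_of_pos (by linarith : 0 < (r : ℝ) + 1)
      linarith⟩
  rw [deriv_gaussCumulantFun hrn, Real.log_mul (by positivity) (by positivity), Real.log_pow]
  rw [abs_le]
  constructor <;> linarith [hlr.1, hlr.2]

lemma mean_equiv (hr : ∀ n, 1 ≤ n → 1 ≤ r n ∧ r n ≤ n) {E : ℕ → ℝ}
    (hE : ∀ᶠ n in atTop, E n = deriv (gaussCumulantFun n (r n)) 0) :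
    E ~[atTop] (fun n => (r n : ℝ) / 2 * Real.log n) := by
  have hlog : Tendsto (fun n : ℕ => Real.log n) atTop atTop :=
    Real.tendsto_log_atTop.comp tendsto_natCast_atTop_atTop
  refine isEquivalent_of_abs_sub_le (hlog.const_div_atTop 4) ?_
  filter_upwards [hE, eventually_ge_atTop 1, hlog.eventually_gt_atTop 0] with n h1 hn h2
  rw [h1, abs_of_nonneg (a := (r n : ℝ) / 2 * Real.log n) (by positivity)]
  refine (abs_deriv_gaussCumulantFun_sub_le (hr n hn).2).trans (le_of_eq ?_)
  field_simp
  ring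

end RandomSimplex

/-! ### The variance in the Beta and spherical models -/

namespace RandomSimplex

/-- The leading term of the variance in the Beta and spherical models for simplices of dimension
`x` in dimension `y`. -/
noncomputable def betaVarianceTerm (y x : ℝ) : ℝ :=
  1 / 2 * Real.log (y / (y - x)) - x ^ 2 / (2 * y * (x + 1))

section

variable {x y : ℝ}

lemma log_div_sub_lower (hx : 0 ≤ x) (hxy : x < y) :
    x / y + (x / y) ^ 2 / 2 ≤ Real.log (y / (y - x)) := by
  have hy : 0 < y := by linarith
  have hq0 : 0 ≤ x / y := by positivity
  have hq1 : x / y < 1 := (div_lt_one hy).2 hxy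
  have h : Real.log (y / (y - x)) = -Real.log (1 - x / y) := by
    rw [← Real.log_inv]
    congr 1
    have : y - x ≠ 0 := by linarith
    field_simp
  have hs := Real.hasSum_pow_div_log_of_abs_lt_one (x := x / y) (by rwa [abs_of_nonneg hq0])
  rw [h]
  have := hs.summable.sum_le_tsum (Finset.range 2) fun i _ => by positivity
  rw [hs.tsum_eq] at this
  simpa [Finset.sum_range_succ, one_add_one_eq_two] using this

/-- A lower bound without cancellation: the part of `x / (2 y)` that survives the subtraction, and
the quadratic term of the logarithm. -/
lemma betaVarianceTerm_lower (hx : 0 ≤ x) (hxy : x < y) :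
    x ^ 2 / (4 * y ^ 2) + x / (2 * y * (x + 1)) ≤ betaVarianceTerm y x := by
  have h := log_div_sub_lower hx hxy
  have hy : 0 < y := by linarith
  have e : x ^ 2 / (4 * y ^ 2) + x / (2 * y * (x + 1)) =
      1 / 2 * (x / y + (x / y) ^ 2 / 2) - x ^ 2 / (2 * y * (x + 1)) := by
    field_simp
    ring
  rw [betaVarianceTerm, e]
  linarith

/-- The error in the variance is of smaller order than the leading term, uniformly in the dimension
of the simplex. -/
lemma div_le_betaVarianceTerm (hx : 1 ≤ x) (hxy : x + 1 ≤ y) (hy : 1 < Real.log √y) :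
    x / (y * (y - x)) ≤ (16 / √y + 2 / (Real.log √y - 1)) * betaVarianceTerm y x := by
  have hy0 : 0 < y := by linarith
  have hlow := betaVarianceTerm_lower (by linarith : 0 ≤ x) (by linarith : x < y)
  set M := betaVarianceTerm y x with hM
  have hM0 : 0 ≤ M := le_trans (by positivity) hlow
  have hs : 1 ≤ √y := Real.one_le_sqrt.2 (by linarith)
  have hsq : √y ^ 2 = y := Real.sq_sqrt hy0.le
  have hlog0 : 0 < Real.log √y - 1 := by linarith
  rw [add_mul]
  have t1 : 0 ≤ 16 / √y * M := by positivity
  have t2 : 0 ≤ 2 / (Real.log √y - 1) * M := by positivity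
  have hd : 0 < y - x := by linarith
  -- For `x ≤ y / 2` the two terms of the lower bound balance at `x ~ √y`, which yields the factor
  -- `√y`. For larger `x` the quadratic term is bounded below, so that `y - x ≥ √y` suffices; if `x`
  -- is even closer to `y`, the logarithm itself is large.
  rcases le_total x (y / 2) with hc | hc
  · have h1 : x / y ^ 2 * (√y / 4) ≤ M := by
      refine le_trans ?_ hlow
      have h2 : √y / 4 ≤ x / 4 + y / (2 * (x + 1)) := by
        rw [← sub_nonneg]
        have : x / 4 + y / (2 * (x + 1)) - √y / 4 =
            (x * (x + 1) + 2 * y - √y * (x + 1)) / (4 * (x + 1)) := by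
          field_simp
          ring
        rw [this]
        refine div_nonneg ?_ (by positivity)
        nlinarith [sq_nonneg (√y - (x + 1) / 2), sq_nonneg (x - 1)]
      calc x / y ^ 2 * (√y / 4) ≤ x / y ^ 2 * (x / 4 + y / (2 * (x + 1))) := by gcongr
        _ = _ := by field_simp
    have h3 : x / (y * (y - x)) ≤ 8 / √y * (x / y ^ 2 * (√y / 4)) := by
      have : 8 / √y * (x / y ^ 2 * (√y / 4)) = x / (y * (y / 2)) := by field_simp; ring
      rw [this]
      gcongr
      linarith
    have h4 : 8 / √y * (x / y ^ 2 * (√y / 4)) ≤ 16 / √y * M := by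
      have : 8 / √y ≤ 16 / √y := by gcongr; norm_num
      exact mul_le_mul this h1 (by positivity) (by positivity)
    linarith
  · have h1 : x / (y * (y - x)) ≤ 1 / (y - x) := by
      rw [div_le_div_iff₀ (by positivity) hd]
      nlinarith
    rcases le_total (√y) (y - x) with hc2 | hc2
    · have h2 : 1 / 16 ≤ M := by
        refine le_trans ?_ hlow
        have : 1 / 16 ≤ x ^ 2 / (4 * y ^ 2) := by
          rw [div_le_div_iff₀ (by norm_num) (by positivity)]
          nlinarith
        have : 0 ≤ x / (2 * y * (x + 1)) := by positivity
        linarith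
      have h3 : 1 / (y - x) ≤ 1 / √y := by gcongr
      have h4 : 1 / √y ≤ 16 / √y * M := by
        calc 1 / √y = 16 / √y * (1 / 16) := by field_simp
          _ ≤ _ := by gcongr
      linarith
    · have h2 : (Real.log √y - 1) / 2 ≤ M := by
        have h3 : Real.log √y ≤ Real.log (y / (y - x)) := by
          refine Real.log_le_log (by positivity) ?_
          rw [le_div_iff₀ hd]
          calc √y * (y - x) ≤ √y * √y := by gcongr
            _ = y := Real.mul_self_sqrt hy0.le
        have h4 : x ^ 2 / (2 * y * (x + 1)) ≤ 1 / 2 := by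
          rw [div_le_div_iff₀ (by positivity) two_pos]
          nlinarith
        rw [hM, betaVarianceTerm]
        linarith
      have h5 : 1 / (y - x) ≤ 1 := by rw [div_le_one hd]; linarith
      have h6 : 1 ≤ 2 / (Real.log √y - 1) * M := by
        calc 1 = 2 / (Real.log √y - 1) * ((Real.log √y - 1) / 2) := by field_simp
          _ ≤ _ := by gcongr
      linarith

lemma abs_betaVarianceTerm_sub_le (hx : 1 ≤ x) (hxy : x ≤ y / 2) :
    |betaVarianceTerm y x - x / (2 * (x + 1) * y)| ≤ 4 * (x ^ 2 / y) * (x / (2 * (x + 1) * y)) := by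
  have hy0 : 0 < y := by linarith
  have hlow := betaVarianceTerm_lower (by linarith : 0 ≤ x) (by linarith : x < y)
  have h1 : x / (2 * y * (x + 1)) = x / (2 * (x + 1) * y) := by ring_nf
  have hup := Real.log_le_sub_one_of_pos (div_pos hy0 (by linarith) : 0 < y / (y - x))
  have hd : 0 < y - x := by linarith
  have h0 : 0 ≤ x ^ 2 / (4 * y ^ 2) := by positivity
  rw [abs_of_nonneg (by rw [← h1]; linarith), betaVarianceTerm]
  have h2 : 1 / 2 * (y / (y - x) - 1) - x ^ 2 / (2 * y * (x + 1)) - x / (2 * (x + 1) * y) =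
      1 / 2 * (x ^ 2 / (y * (y - x))) := by field_simp; ring
  have h3 : x ^ 2 / (y * (y - x)) ≤ x ^ 2 / (y * (y / 2)) := by gcongr; linarith
  have h4 : 1 / 2 * (x ^ 2 / (y * (y / 2))) ≤ 4 * (x ^ 2 / y) * (x / (2 * (x + 1) * y)) := by
    rw [show 1 / 2 * (x ^ 2 / (y * (y / 2))) = x ^ 2 / y ^ 2 by field_simp,
      show 4 * (x ^ 2 / y) * (x / (2 * (x + 1) * y)) = x ^ 2 / y ^ 2 * (2 * x / (x + 1)) by
        field_simp; ring]
    refine le_mul_of_one_le_right (by positivity) ?_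
    rw [le_div_iff₀ (by linarith)]
    linarith
  linarith

lemma abs_betaVarianceTerm_sub_log_le (hx : 1 ≤ x) (hxy : x + 1 ≤ y) :
    |betaVarianceTerm y x - (1 / 2 * Real.log ((y + 1) / (y - x + 1)) -
      x ^ 2 / (2 * y * (x + 1)))| ≤ x / (y * (y - x)) := by
  have hy0 : 0 < y := by linarith
  have hd : 0 < y - x := by linarith
  have h1 := log_succ_div_bounds hd
  have h2 := log_succ_div_bounds hy0
  have hlog : Real.log (y / (y - x)) = Real.log ((y + 1) / (y - x + 1)) +
      (Real.log ((y - x + 1) / (y - x)) - Real.log ((y + 1) / y)) := by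
    rw [Real.log_div hy0.ne' hd.ne', Real.log_div (by positivity) (by positivity),
      Real.log_div (by positivity) hd.ne', Real.log_div (by positivity) hy0.ne']
    ring
  have h3 : 1 / (y - x) - 1 / y = x / (y * (y - x)) := by field_simp; ring
  have h4 : 1 / y - 1 / (y + 1) ≤ x / (y * (y - x)) := by
    rw [div_sub_div _ _ hy0.ne' (by positivity), div_le_div_iff₀ (by positivity) (by positivity)]
    have h5 : y * (y - x) ≤ x * (y * (y + 1)) := by
      calc y * (y - x) ≤ y * (y + 1) := by gcongr; linarith
        _ ≤ x * (y * (y + 1)) := le_mul_of_one_le_left (by positivity) hx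
    linarith
  have h5 : 1 / (y - x + 1) ≥ 1 / (y + 1) := by
    apply one_div_le_one_div_of_le <;> linarith
  rw [betaVarianceTerm, hlog, abs_le]
  have h6 : 0 ≤ x / (y * (y - x)) := by positivity
  constructor <;> linarith [h1.1, h1.2, h2.1, h2.2]

end

variable {r : ℕ → ℕ} {V : ℕ → ℝ} {K : ℝ}

lemma variance_beta_equiv (hr : ∀ n, 1 ≤ n → 1 ≤ r n ∧ r n ≤ n) (hK : 0 ≤ K)
    (hV : ∀ᶠ n in atTop, |V n - (1 / 2 * Real.log (((n : ℝ) + 1) / (n - r n + 1)) -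
      (r n : ℝ) ^ 2 / (2 * n * (r n + 1)))| ≤ K * (r n / (n * ((n : ℝ) - r n + 1))))
    (hlt : ∀ᶠ n in atTop, r n < n) :
    V ~[atTop] (fun n => betaVarianceTerm n (r n)) := by
  have hsqrt : Tendsto (fun n : ℕ => √(n : ℝ)) atTop atTop :=
    Real.tendsto_sqrt_atTop.comp tendsto_natCast_atTop_atTop
  have hlog := Real.tendsto_log_atTop.comp hsqrt
  refine isEquivalent_of_abs_sub_le
    (ε := fun n => (K + 1) * (16 / √(n : ℝ) + 2 / (Real.log √(n : ℝ) - 1))) ?_ ?_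
  · have h1 : Tendsto (fun n : ℕ => Real.log √(n : ℝ) - 1) atTop atTop :=
      tendsto_atTop_add_const_right _ (-1) hlog
    simpa using ((hsqrt.const_div_atTop 16).add (h1.const_div_atTop 2)).const_mul (K + 1)
  · filter_upwards [hV, hlt, eventually_ge_atTop 1, hlog.eventually_gt_atTop 1] with n h1 h2 hn h3
    have hx : (1 : ℝ) ≤ r n := by exact_mod_cast (hr n hn).1
    have hxy : (r n : ℝ) + 1 ≤ n := by exact_mod_cast h2
    have hy0 : (0 : ℝ) < n := by linarith
    have hd : 0 < (n : ℝ) - r n := by linarith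
    have h4 := div_le_betaVarianceTerm hx hxy h3
    have h5 := abs_betaVarianceTerm_sub_log_le hx hxy
    have hM0 : 0 ≤ betaVarianceTerm n (r n) :=
      le_trans (by positivity) (betaVarianceTerm_lower (by linarith) (by linarith : (r n : ℝ) < n))
    have h6 : (r n : ℝ) / (n * ((n : ℝ) - r n + 1)) ≤ r n / (n * ((n : ℝ) - r n)) := by
      gcongr
      linarith
    rw [abs_of_nonneg hM0, mul_assoc]
    rw [abs_sub_comm] at h5
    have h7 := (abs_sub_le (V n) _ (betaVarianceTerm n (r n))).trans (add_le_add h1 h5)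
    refine h7.trans ?_
    calc K * (r n / (n * ((n : ℝ) - r n + 1))) + r n / (n * ((n : ℝ) - r n))
        ≤ K * (r n / (n * ((n : ℝ) - r n))) + r n / (n * ((n : ℝ) - r n)) := by gcongr
      _ = (K + 1) * (r n / (n * ((n : ℝ) - r n))) := by ring
      _ ≤ _ := by gcongr

lemma eventually_lt_of_tendsto_div {β : ℝ} (hβ : β < 1)
    (h : Tendsto (fun n => (r n : ℝ) / n) atTop (𝓝 β)) : ∀ᶠ n in atTop, r n < n := by
  filter_upwards [h.eventually_lt_const hβ, eventually_gt_atTop 0] with n h1 hn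
  have hn' : (0 : ℝ) < n := by exact_mod_cast hn
  rw [div_lt_one hn'] at h1
  exact_mod_cast h1

lemma betaVarianceTerm_equiv_of_isLittleO_sqrt (hr : ∀ n, 1 ≤ n → 1 ≤ r n ∧ r n ≤ n)
    (h : (fun n => (r n : ℝ)) =o[atTop] (fun n => √(n : ℝ))) :
    (fun n : ℕ => betaVarianceTerm n (r n)) ~[atTop]
      (fun n => (r n : ℝ) / (2 * (r n + 1) * n)) := by
  have h1 : Tendsto (fun n : ℕ => (r n : ℝ) ^ 2 / n) atTop (𝓝 0) := by
    have h2 := (h.tendsto_div_nhds_zero).pow 2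
    rw [zero_pow two_ne_zero] at h2
    refine h2.congr fun n => ?_
    rw [div_pow, Real.sq_sqrt (Nat.cast_nonneg n)]
  refine isEquivalent_of_abs_sub_le (by simpa using h1.const_mul 4) ?_
  filter_upwards [h1.eventually_le_const (by norm_num : (0 : ℝ) < 1 / 2), eventually_ge_atTop 1]
    with n h2 hn
  have hx : (1 : ℝ) ≤ r n := by exact_mod_cast (hr n hn).1
  have hn' : (0 : ℝ) < n := by exact_mod_cast hn
  rw [div_le_iff₀ hn'] at h2
  rw [abs_of_nonneg (a := (r n : ℝ) / (2 * (r n + 1) * n)) (by positivity)]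
  exact abs_betaVarianceTerm_sub_le hx (by nlinarith)

lemma isLittleO_of_isLittleO_sqrt (h : (fun n => (r n : ℝ)) =o[atTop] (fun n => √(n : ℝ))) :
    (fun n => (r n : ℝ)) =o[atTop] (fun n => (n : ℝ)) := by
  refine h.trans_isBigO (IsBigO.of_bound 1 ?_)
  filter_upwards [eventually_ge_atTop 1] with n hn
  have hn' : (1 : ℝ) ≤ n := by exact_mod_cast hn
  rw [one_mul, Real.norm_of_nonneg (Real.sqrt_nonneg _), Real.norm_of_nonneg (by linarith)]
  exact Real.sqrt_le_iff.2 ⟨by linarith, by nlinarith⟩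

lemma betaVarianceTerm_equiv_of_proportional {α : ℝ} (hα0 : 0 < α) (hα : α < 1)
    (h : (fun n => (r n : ℝ)) ~[atTop] (fun n => α * (n : ℝ))) :
    (fun n : ℕ => betaVarianceTerm n (r n)) ~[atTop]
      (fun _ => 1 / 2 * Real.log (1 / (1 - α)) - α / 2) := by
  have hlim := tendsto_div_of_isEquivalent h
  have hα1 : 0 < 1 - α := by linarith
  have hne : 1 / 2 * Real.log (1 / (1 - α)) - α / 2 ≠ 0 := by
    have := log_div_sub_lower hα0.le hα
    rw [div_one] at this
    have : 0 < α ^ 2 := by positivity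
    linarith
  refine (isEquivalent_const_iff_tendsto hne).2 ?_
  have hn0 : ∀ᶠ n : ℕ in atTop, (n : ℝ) ≠ 0 := by
    filter_upwards [eventually_gt_atTop 0] with n hn
    exact_mod_cast hn.ne'
  have hrinf : Tendsto (fun n => (r n : ℝ)) atTop atTop :=
    h.symm.tendsto_atTop (tendsto_natCast_atTop_atTop.const_mul_atTop hα0)
  have h1 : Tendsto (fun n : ℕ => Real.log (1 / (1 - (r n : ℝ) / n))) atTop
      (𝓝 (Real.log (1 / (1 - α)))) :=
    (tendsto_const_nhds.div (tendsto_const_nhds.sub hlim) hα1.ne').log (by positivity)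
  have h2 : Tendsto (fun n : ℕ => (r n : ℝ) / n * (1 - 1 / (r n + 1)) / 2) atTop
      (𝓝 (α * (1 - 0) / 2)) :=
    (hlim.mul (tendsto_const_nhds.sub
      ((tendsto_atTop_add_const_right _ 1 hrinf).const_div_atTop 1))).div_const 2
  have h3 := (h1.const_mul (1 / 2)).sub h2
  rw [sub_zero, mul_one] at h3
  refine h3.congr' ?_
  filter_upwards [hn0, eventually_lt_of_tendsto_div hα hlim] with n hn hlt
  have hlt' : (r n : ℝ) < n := by exact_mod_cast hlt
  have hd : (n : ℝ) - r n ≠ 0 := by linarith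
  rw [betaVarianceTerm]
  have e1 : 1 / (1 - (r n : ℝ) / n) = n / (n - r n) := by field_simp
  have e2 : (r n : ℝ) / n * (1 - 1 / (r n + 1)) / 2 = (r n : ℝ) ^ 2 / (2 * n * (r n + 1)) := by
    field_simp
    ring
  rw [e1, e2]

end RandomSimplex

/-! ### Bounds for higher cumulants -/

namespace RandomSimplex

lemma half_pow_mul_polySum_le (k : ℕ) {x : ℝ} (hx : 0 < x) :
    (1 / 2) ^ (k + 3) * polySum (k + 3) (x / 2) ≤
      1 / x ^ (k + 3) + 1 / 4 * (1 / x ^ (k + 2)) := by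
  have h := polySum_le (by omega : 1 ≤ k + 2) (by linarith : 0 < x / 2)
  calc (1 / 2) ^ (k + 3) * polySum (k + 3) (x / 2)
      ≤ (1 / 2) ^ (k + 3) * (1 / (x / 2) ^ (k + 3) +
        1 / (k + 2 : ℕ) * (1 / (x / 2) ^ (k + 2))) := by gcongr
    _ = 1 / x ^ (k + 3) + 1 / (2 * ((k : ℝ) + 2)) * (1 / x ^ (k + 2)) := by
        rw [div_pow, div_pow, div_pow, one_pow, pow_succ 2 (k + 2)]
        push_cast
        field_simp
    _ ≤ _ := by
        gcongr
        have : (0 : ℝ) ≤ k := by positivity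
        linarith

lemma half_pow_mul_polySum_le' (k : ℕ) {x y : ℝ} (hy : 4 ≤ y) (hyx : y ≤ x) :
    (1 / 2) ^ (k + 3) * polySum (k + 3) (x / 2) ≤ 1 / 2 * (1 / y ^ (k + 2)) := by
  have hx : 0 < x := by linarith
  refine (half_pow_mul_polySum_le k hx).trans ?_
  have h1 : 1 / x ^ (k + 3) ≤ 1 / 4 * (1 / x ^ (k + 2)) := by
    rw [pow_succ x (k + 2), one_div_mul_one_div, mul_comm]
    gcongr
    linarith
  have h2 : 1 / x ^ (k + 2) ≤ 1 / y ^ (k + 2) := by gcongr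
  linarith

/-- The sum over all dimensions that bounds the cumulants in the Gaussian model. The constant comes
from `∑ (1 / l ^ 3 + 1 / (4 * l ^ 2)) ≤ 2`, which follows by telescoping. -/
lemma sum_polySum_le_two {n r : ℕ} (hn : 1 ≤ n) (hrn : r ≤ n) (k : ℕ) :
    (1 / 2) ^ (k + 3) * ∑ j ∈ Finset.range r, polySum (k + 3) (((n : ℝ) - j) / 2) ≤ 2 := by
  have hN : ∀ N : ℕ, ∑ l ∈ Finset.range (N + 1),
      (1 / ((l : ℝ) + 1) ^ 3 + 1 / 4 * (1 / ((l : ℝ) + 1) ^ 2)) ≤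
          2 - 3 / 4 * (1 / ((N : ℝ) + 1)) := by
    intro N
    induction N with
    | zero => norm_num
    | succ N ih =>
      rw [Finset.sum_range_succ]
      have h : 1 / (((N + 1 : ℕ) : ℝ) + 1) ^ 3 + 1 / 4 * (1 / (((N + 1 : ℕ) : ℝ) + 1) ^ 2) ≤
          3 / 4 * (1 / ((N : ℝ) + 1)) - 3 / 4 * (1 / (((N + 1 : ℕ) : ℝ) + 1)) := by
        push_cast
        rw [← sub_nonneg]
        have : 3 / 4 * (1 / ((N : ℝ) + 1)) - 3 / 4 * (1 / ((N : ℝ) + 1 + 1)) -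
            (1 / ((N : ℝ) + 1 + 1) ^ 3 + 1 / 4 * (1 / ((N : ℝ) + 1 + 1) ^ 2)) =
            (2 * (N : ℝ) ^ 2 + 5 * N + 6) / (4 * (N + 1) * (N + 1 + 1) ^ 3) := by
          field_simp
          ring
        rw [this]
        positivity
      linarith
  have hterm : ∀ j ∈ Finset.range r, (1 / 2) ^ (k + 3) * polySum (k + 3) (((n : ℝ) - j) / 2) ≤
      1 / ((n : ℝ) - j) ^ 3 + 1 / 4 * (1 / ((n : ℝ) - j) ^ 2) := by
    intro j hj
    have hp := half_pos_of_mem_range hrn hj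
    have h1 : 1 ≤ (n : ℝ) - j := by linarith
    refine (half_pow_mul_polySum_le k (by linarith)).trans ?_
    gcongr 1 / ?_ + 1 / 4 * (1 / ?_)
    · exact pow_le_pow_right₀ h1 (by omega)
    · exact pow_le_pow_right₀ h1 (by omega)
  rw [Finset.mul_sum]
  refine (Finset.sum_le_sum hterm).trans ?_
  have h2 : ∑ j ∈ Finset.range r, (1 / ((n : ℝ) - j) ^ 3 + 1 / 4 * (1 / ((n : ℝ) - j) ^ 2)) ≤
      ∑ j ∈ Finset.range n, (1 / ((n : ℝ) - j) ^ 3 + 1 / 4 * (1 / ((n : ℝ) - j) ^ 2)) := by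
    refine Finset.sum_le_sum_of_subset_of_nonneg (Finset.range_subset_range.2 hrn) fun j hj _ => ?_
    have hp := half_pos_of_mem_range le_rfl hj
    have h1 : 0 < (n : ℝ) - j := by linarith
    positivity
  refine h2.trans ?_
  obtain ⟨N, rfl⟩ : ∃ N, n = N + 1 := ⟨n - 1, by omega⟩
  rw [← Finset.sum_range_reflect]
  have h3 : ∀ j ∈ Finset.range (N + 1), (((N + 1 : ℕ) : ℝ) - ((N + 1 - 1 - j : ℕ) : ℝ)) =
      j + 1 := by
    intro j hj
    have : j ≤ N := by have := Finset.mem_range.1 hj; omega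
    rw [Nat.add_sub_cancel, Nat.cast_sub this]
    push_cast
    ring
  rw [Finset.sum_congr rfl fun j hj => by rw [h3 j hj]]
  refine (hN N).trans ?_
  have : 0 ≤ 3 / 4 * (1 / ((N : ℝ) + 1)) := by positivity
  linarith

lemma sum_polySum_le_of_le_sub {n r : ℕ} (hn : 1 ≤ n) (k : ℕ) {c : ℝ} (hc : 0 < c)
    (hc1 : c ≤ 1) (hcn : c * n ≤ (n : ℝ) - r + 1) :
    (1 / 2) ^ (k + 3) * ∑ j ∈ Finset.range r, polySum (k + 3) (((n : ℝ) - j) / 2) ≤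
      2 * (1 / c) ^ (k + 3) * (r * ((n : ℝ) ^ (k + 2))⁻¹) := by
  have hn1 : (1 : ℝ) ≤ n := by exact_mod_cast hn
  have hterm : ∀ j ∈ Finset.range r, (1 / 2) ^ (k + 3) * polySum (k + 3) (((n : ℝ) - j) / 2) ≤
      2 * (1 / c) ^ (k + 3) * ((n : ℝ) ^ (k + 2))⁻¹ := by
    intro j hj
    have hjr : (j : ℝ) + 1 ≤ r := by
      have := Finset.mem_range.1 hj
      exact_mod_cast (by omega : j + 1 ≤ r)
    have hcn0 : 0 < c * n := by positivity
    have h1 : c * n ≤ (n : ℝ) - j := by linarith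
    have h3 : 1 / ((n : ℝ) - j) ^ (k + 3) ≤ (1 / c) ^ (k + 3) * ((n : ℝ) ^ (k + 2))⁻¹ := by
      calc 1 / ((n : ℝ) - j) ^ (k + 3) ≤ 1 / (c * n) ^ (k + 3) := by gcongr
        _ = (1 / c) ^ (k + 3) * ((n : ℝ) ^ (k + 3))⁻¹ := by
          rw [mul_pow, div_pow, one_pow]; field_simp
        _ ≤ _ := by
          refine mul_le_mul_of_nonneg_left (inv_anti₀ (by positivity) ?_) (by positivity)
          exact pow_le_pow_right₀ hn1 (by omega)
    have h4 : 1 / ((n : ℝ) - j) ^ (k + 2) ≤ (1 / c) ^ (k + 3) * ((n : ℝ) ^ (k + 2))⁻¹ := by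
      calc 1 / ((n : ℝ) - j) ^ (k + 2) ≤ 1 / (c * n) ^ (k + 2) := by gcongr
        _ = (1 / c) ^ (k + 2) * ((n : ℝ) ^ (k + 2))⁻¹ := by
          rw [mul_pow, div_pow, one_pow]; field_simp
        _ ≤ _ := by
          gcongr
          · rw [le_div_iff₀ hc]; linarith
          · omega
    have h5 : 0 ≤ (1 / c) ^ (k + 3) * ((n : ℝ) ^ (k + 2))⁻¹ := by positivity
    have := half_pow_mul_polySum_le k (by linarith : 0 < (n : ℝ) - j)
    linarith
  rw [Finset.mul_sum]
  refine (Finset.sum_le_sum hterm).trans (le_of_eq ?_)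
  rw [Finset.sum_const, Finset.card_range, nsmul_eq_mul]
  ring

lemma abs_iteratedDeriv_gauss {n r : ℕ} (hrn : r ≤ n) (k : ℕ) :
    |iteratedDeriv (k + 3) (gaussCumulantFun n r) 0| = (k + 2).factorial *
      ((1 / 2) ^ (k + 3) * ∑ j ∈ Finset.range r, polySum (k + 3) (((n : ℝ) - j) / 2)) := by
  have hs : 0 ≤ ∑ j ∈ Finset.range r, polySum (k + 3) (((n : ℝ) - j) / 2) :=
    Finset.sum_nonneg fun j hj => polySum_nonneg _ (by linarith [half_pos_of_mem_range hrn hj])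
  rw [iteratedDeriv_gaussCumulantFun hrn (k + 1), abs_mul, abs_mul, abs_pow, abs_neg, abs_one,
    one_pow, one_mul, Nat.abs_cast, abs_of_nonneg (by positivity)]

/-- The contributions to the cumulants in the Beta and spherical models, in absolute value. -/
lemma abs_iteratedDeriv_beta_le {n r : ℕ} (hn : 4 ≤ n) (hr : 1 ≤ r) (hrn : r ≤ n) {ν : ℝ}
    (hν : 0 ≤ ν) (k : ℕ) :
    |iteratedDeriv (k + 3) (betaCumulantFun n r ν) 0| ≤ (k + 2).factorial *
      ((1 / 2) ^ (k + 3) * ∑ j ∈ Finset.range r, polySum (k + 3) (((n : ℝ) - j) / 2) +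
        (r * ((n : ℝ) ^ (k + 2))⁻¹ + (k + 3) * 2 ^ (k + 1) * ((n : ℝ) ^ (k + 2))⁻¹)) := by
  have hn4 : (4 : ℝ) ≤ n := by exact_mod_cast hn
  have hr1 : (1 : ℝ) ≤ r := by exact_mod_cast hr
  have hs : 0 ≤ ∑ j ∈ Finset.range r, polySum (k + 3) (((n : ℝ) - j) / 2) :=
    Finset.sum_nonneg fun j hj => polySum_nonneg _ (by linarith [half_pos_of_mem_range hrn hj])
  have hpa : 0 ≤ polySum (k + 3) (((n : ℝ) + ν) / 2) := polySum_nonneg _ (by linarith)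
  have hA : 1 ≤ ((r : ℝ) + 1) * (((n : ℝ) + ν) / 2 - 1) + 1 := beta_arg_pos (by omega) hν
  have hpA : 0 ≤ polySum (k + 3) (((r : ℝ) + 1) * (((n : ℝ) + ν) / 2 - 1) + 1) :=
    polySum_nonneg _ (by linarith)
  have h1 := half_pow_mul_polySum_le' k hn4 (by linarith : (n : ℝ) ≤ n + ν)
  have h2 := half_pow_mul_polySum_le' k (y := (r + 1) * ((n : ℝ) / 2))
    (x := 2 * (((r : ℝ) + 1) * (((n : ℝ) + ν) / 2 - 1) + 1)) (by nlinarith) (by nlinarith)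
  rw [mul_div_cancel_left₀ _ two_ne_zero] at h2
  have hd0 : 0 ≤ ((r : ℝ) + 1) ^ (k + 3) - (r : ℝ) ^ (k + 3) :=
    sub_nonneg.2 (pow_le_pow_left₀ (by positivity) (by linarith) _)
  have hd : ((r : ℝ) + 1) ^ (k + 3) - (r : ℝ) ^ (k + 3) ≤ (k + 3) * (r + 1) ^ (k + 2) := by
    have h := abs_pow_sub_pow_le ((r : ℝ) + 1) r (k + 3)
    rw [abs_of_nonneg hd0, add_sub_cancel_left, abs_one, one_mul,
      abs_of_nonneg (by positivity : (0 : ℝ) ≤ r + 1), abs_of_nonneg (by positivity : (0 : ℝ) ≤ r),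
      max_eq_left (by linarith)] at h
    push_cast at h
    exact h
  rw [iteratedDeriv_betaCumulantFun (by omega) hrn hν (k + 1), abs_mul, abs_mul, abs_pow, abs_neg,
    abs_one, one_pow, one_mul, Nat.abs_cast]
  refine mul_le_mul_of_nonneg_left ?_ (by positivity)
  change |(1 / 2) ^ (k + 3) * (∑ j ∈ Finset.range r, polySum (k + 3) (((n : ℝ) - j) / 2) -
    (r + 1) * polySum (k + 3) (((n : ℝ) + ν) / 2) + (((r : ℝ) + 1) ^ (k + 3) - (r : ℝ) ^ (k + 3)) *
    polySum (k + 3) (((r : ℝ) + 1) * (((n : ℝ) + ν) / 2 - 1) + 1))| ≤ _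
  generalize ∑ j ∈ Finset.range r, polySum (k + 3) (((n : ℝ) - j) / 2) = S at *
  generalize polySum (k + 3) (((n : ℝ) + ν) / 2) = pa at *
  generalize polySum (k + 3) (((r : ℝ) + 1) * (((n : ℝ) + ν) / 2 - 1) + 1) = pA at *
  generalize ((r : ℝ) + 1) ^ (k + 3) - (r : ℝ) ^ (k + 3) = d at *
  have e1 : (1 / 2) ^ (k + 3) * ((r + 1) * pa) ≤ r * ((n : ℝ) ^ (k + 2))⁻¹ := by
    calc (1 / 2) ^ (k + 3) * ((r + 1) * pa) = (r + 1) * ((1 / 2) ^ (k + 3) * pa) := by ring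
      _ ≤ (r + r) * (1 / 2 * (1 / (n : ℝ) ^ (k + 2))) := by gcongr
      _ = _ := by rw [one_div ((n : ℝ) ^ (k + 2))]; ring
  have e2 : (1 / 2) ^ (k + 3) * (d * pA) ≤ (k + 3) * 2 ^ (k + 1) * ((n : ℝ) ^ (k + 2))⁻¹ := by
    calc (1 / 2) ^ (k + 3) * (d * pA) = d * ((1 / 2) ^ (k + 3) * pA) := by ring
      _ ≤ ((k + 3) * (r + 1) ^ (k + 2)) * (1 / 2 * (1 / (((r : ℝ) + 1) * (n / 2)) ^ (k + 2))) := by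
          gcongr
      _ = _ := by
          rw [mul_pow, div_pow, pow_succ 2 (k + 1)]
          field_simp
  have f0 : 0 ≤ (1 / 2) ^ (k + 3) * S := by positivity
  have f1 : 0 ≤ (1 / 2) ^ (k + 3) * ((r + 1) * pa) := by positivity
  have f2 : 0 ≤ (1 / 2) ^ (k + 3) * (d * pA) := by positivity
  rw [mul_add, mul_sub, abs_le]
  constructor <;> linarith

lemma zpow_one_sub_natCast (x : ℝ) (k : ℕ) : x ^ (1 - ((k + 3 : ℕ) : ℤ)) = (x ^ (k + 2))⁻¹ := by
  rw [show 1 - ((k + 3 : ℕ) : ℤ) = -((k + 2 : ℕ) : ℤ) by push_cast; ring, zpow_neg, zpow_natCast]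

section

variable {n r m : ℕ}

lemma abs_cumulant_gauss_le (hn : 1 ≤ n) (hrn : r ≤ n) (hm : 3 ≤ m) :
    |iteratedDeriv m (gaussCumulantFun n r) 0| ≤ 2 * ((m - 1).factorial : ℝ) := by
  obtain ⟨k, rfl⟩ : ∃ k, m = k + 3 := ⟨m - 3, by omega⟩
  rw [abs_iteratedDeriv_gauss hrn, mul_comm, show k + 3 - 1 = k + 2 by omega]
  gcongr
  exact sum_polySum_le_two hn hrn k

lemma abs_cumulant_gauss_le_of_le_sub (hn : 1 ≤ n) (hrn : r ≤ n) (hm : 3 ≤ m) {c : ℝ} (hc : 0 < c)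
    (hc1 : c ≤ 1) (hcn : c * n ≤ (n : ℝ) - r + 1) :
    |iteratedDeriv m (gaussCumulantFun n r) 0| ≤
      (2 / c) ^ m * ((m - 1).factorial : ℝ) * r * (n : ℝ) ^ (1 - (m : ℤ)) := by
  obtain ⟨k, rfl⟩ : ∃ k, m = k + 3 := ⟨m - 3, by omega⟩
  rw [abs_iteratedDeriv_gauss hrn, zpow_one_sub_natCast, show k + 3 - 1 = k + 2 by omega]
  have h1 := sum_polySum_le_of_le_sub hn k hc hc1 hcn
  have h2 : (2 : ℝ) ≤ 2 ^ (k + 3) := le_self_pow₀ (by norm_num) (by omega)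
  calc _ ≤ ((k + 2).factorial : ℝ) * (2 ^ (k + 3) * (1 / c) ^ (k + 3) *
        (r * ((n : ℝ) ^ (k + 2))⁻¹)) :=
        mul_le_mul_of_nonneg_left (h1.trans (by gcongr)) (by positivity)
    _ = _ := by rw [← mul_pow, mul_one_div]; ring

variable {ν : ℝ}

lemma abs_cumulant_beta_le (hn : 4 ≤ n) (hr : 1 ≤ r) (hrn : r ≤ n) (hν : 0 ≤ ν) (hm : 3 ≤ m) :
    |iteratedDeriv m (betaCumulantFun n r ν) 0| ≤ 2 * 4 ^ m * (m.factorial : ℝ) := by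
  obtain ⟨k, rfl⟩ : ∃ k, m = k + 3 := ⟨m - 3, by omega⟩
  refine (abs_iteratedDeriv_beta_le hn hr hrn hν k).trans ?_
  have hn1 : (1 : ℝ) ≤ n := by exact_mod_cast (by omega : 1 ≤ n)
  have hrn' : (r : ℝ) ≤ n := by exact_mod_cast hrn
  have h1 := sum_polySum_le_two (by omega : 1 ≤ n) hrn k
  have h2 : (r : ℝ) * ((n : ℝ) ^ (k + 2))⁻¹ ≤ 1 := by
    rw [← div_eq_mul_inv, div_le_one (by positivity)]
    exact hrn'.trans (le_self_pow₀ hn1 (by omega))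
  have h3 : ((k : ℝ) + 3) * 2 ^ (k + 1) * ((n : ℝ) ^ (k + 2))⁻¹ ≤ (k + 3) * 2 ^ (k + 1) :=
    mul_le_of_le_one_right (by positivity) (inv_le_one_of_one_le₀ (one_le_pow₀ hn1))
  have h4 : (2 : ℝ) ^ (k + 1) ≤ 4 ^ (k + 3) := by
    calc (2 : ℝ) ^ (k + 1) ≤ 4 ^ (k + 1) := by gcongr; norm_num
      _ ≤ 4 ^ (k + 3) := by gcongr <;> norm_num
  have h5 : (1 : ℝ) ≤ 4 ^ (k + 3) := one_le_pow₀ (by norm_num)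
  rw [show (k + 3).factorial = (k + 3) * (k + 2).factorial from Nat.factorial_succ (k + 2)]
  push_cast
  calc _ ≤ ((k + 2).factorial : ℝ) * (2 + (1 + (k + 3) * 2 ^ (k + 1))) :=
        mul_le_mul_of_nonneg_left (by linarith) (by positivity)
    _ ≤ ((k + 2).factorial : ℝ) * (2 * 4 ^ (k + 3) * (k + 3)) := by
        gcongr
        have hk : (0 : ℝ) ≤ k := by positivity
        nlinarith
    _ = _ := by ring

lemma abs_cumulant_beta_le_of_le_sub (hn : 4 ≤ n) (hr : 1 ≤ r) (hrn : r ≤ n) (hν : 0 ≤ ν)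
    (hm : 3 ≤ m) {c : ℝ} (hc : 0 < c) (hc1 : c ≤ 1) (hcn : c * n ≤ (n : ℝ) - r + 1) :
    |iteratedDeriv m (betaCumulantFun n r ν) 0| ≤
      (4 / c) ^ m * (m.factorial : ℝ) * r * (n : ℝ) ^ (1 - (m : ℤ)) := by
  obtain ⟨k, rfl⟩ : ∃ k, m = k + 3 := ⟨m - 3, by omega⟩
  refine (abs_iteratedDeriv_beta_le hn hr hrn hν k).trans ?_
  have hr1 : (1 : ℝ) ≤ r := by exact_mod_cast hr
  have h1 := sum_polySum_le_of_le_sub (by omega : 1 ≤ n) k hc hc1 hcn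
  rw [zpow_one_sub_natCast,
    show (k + 3).factorial = (k + 3) * (k + 2).factorial from Nat.factorial_succ (k + 2)]
  push_cast
  have hX : 0 ≤ (r : ℝ) * ((n : ℝ) ^ (k + 2))⁻¹ := by positivity
  have h3 : ((k : ℝ) + 3) * 2 ^ (k + 1) * ((n : ℝ) ^ (k + 2))⁻¹ ≤
      (k + 3) * 2 ^ (k + 1) * (r * ((n : ℝ) ^ (k + 2))⁻¹) := by
    gcongr
    exact le_mul_of_one_le_left (by positivity) hr1
  have hD : 1 ≤ (1 / c) ^ (k + 3) := one_le_pow₀ (by rw [le_div_iff₀ hc]; linarith)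
  have hk : (0 : ℝ) ≤ k := by positivity
  have h4 : 3 + (2 : ℝ) ^ (k + 1) ≤ 4 ^ (k + 3) := by
    have h5 : (2 : ℝ) ^ k ≤ 4 ^ k := by gcongr; norm_num
    have h6 : (1 : ℝ) ≤ 4 ^ k := one_le_pow₀ (by norm_num)
    rw [pow_succ, pow_add]
    linarith
  have h7 : 2 * (1 / c) ^ (k + 3) + 1 + (k + 3) * 2 ^ (k + 1) ≤ (k + 3) * (4 / c) ^ (k + 3) := by
    rw [show (4 : ℝ) / c = 4 * (1 / c) by ring, mul_pow]
    have hp : (0 : ℝ) ≤ 2 ^ (k + 1) := by positivity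
    generalize (1 / c) ^ (k + 3) = D at *
    generalize (2 : ℝ) ^ (k + 1) = p at *
    calc 2 * D + 1 + ((k : ℝ) + 3) * p ≤ (k + 3) * ((3 + p) * D) := by
          have h8 : ((k : ℝ) + 3) * p ≤ (k + 3) * p * D :=
            le_mul_of_one_le_right (mul_nonneg (by positivity) hp) hD
          have h9 : 0 ≤ k * D := mul_nonneg hk (by linarith)
          linarith
      _ ≤ _ := by gcongr
  calc _ ≤ ((k + 2).factorial : ℝ) * (2 * (1 / c) ^ (k + 3) * (r * ((n : ℝ) ^ (k + 2))⁻¹) +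
        (r * ((n : ℝ) ^ (k + 2))⁻¹ + (k + 3) * 2 ^ (k + 1) * (r * ((n : ℝ) ^ (k + 2))⁻¹))) :=
        mul_le_mul_of_nonneg_left (by linarith) (by positivity)
    _ = ((k + 2).factorial : ℝ) * ((2 * (1 / c) ^ (k + 3) + 1 + (k + 3) * 2 ^ (k + 1)) *
        (r * ((n : ℝ) ^ (k + 2))⁻¹)) := by ring
    _ ≤ ((k + 2).factorial : ℝ) * (((k + 3) * (4 / c) ^ (k + 3)) * (r * ((n : ℝ) ^ (k + 2))⁻¹)) := by
        gcongr
    _ = _ := by ring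

end

end RandomSimplex

/-! ### Moments and cumulants of the logarithmic volume -/

theorem mainTheorem3 {Ω : ℕ → Type*} [∀ n, MeasurableSpace (Ω n)]
    (P : ∀ n, Measure (Ω n)) [∀ n, IsProbabilityMeasure (P n)]
    (r : ℕ → ℕ) (hr : ∀ n, 1 ≤ n → 1 ≤ r n ∧ r n ≤ n) :
    -- (a) the Gaussian model
    (∀ X : ∀ n, Fin (r n + 1) → Ω n → EuclideanSpace ℝ (Fin n),
      (∀ n, 1 ≤ n →
        RandomSimplex.IsIIDSample (P n) (stdGaussian (EuclideanSpace ℝ (Fin n))) (X n)) →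
      -- `L = log (r! V)` is well defined and has moments of all orders
      (∀ n, 1 ≤ n →
        (∀ᵐ ω ∂(P n), 0 < RandomSimplex.simplexVolume fun i => X n i ω) ∧
        ∀ p : ℕ, MemLp (RandomSimplex.logVolume (X n)) p (P n)) ∧
      -- expectation
      (fun n => ∫ ω, RandomSimplex.logVolume (X n) ω ∂(P n))
        ~[atTop] (fun n => (r n : ℝ) / 2 * Real.log n) ∧
      -- variance
      ((fun n => (r n : ℝ)) =o[atTop] (fun n => (n : ℝ)) →
        (fun n => Var[RandomSimplex.logVolume (X n); P n])
          ~[atTop] (fun n => (r n : ℝ) / (2 * n))) ∧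
      (∀ α : ℝ, 0 < α → α < 1 → (fun n => (r n : ℝ)) ~[atTop] (fun n => α * (n : ℝ)) →
        (fun n => Var[RandomSimplex.logVolume (X n); P n])
          ~[atTop] (fun _ => 1 / 2 * Real.log (1 / (1 - α)))) ∧
      ((fun n : ℕ => (n : ℝ) - r n) =o[atTop] (fun n => (n : ℝ)) →
        (fun n => Var[RandomSimplex.logVolume (X n); P n])
          ~[atTop] (fun n => 1 / 2 * Real.log ((n : ℝ) / ((n : ℝ) - r n + 1)))) ∧
      -- cumulants
      ((fun n => (r n : ℝ)) =o[atTop] (fun n => (n : ℝ)) ∨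
          (∃ α : ℝ, 0 < α ∧ α < 1 ∧ (fun n => (r n : ℝ)) ~[atTop] (fun n => α * (n : ℝ))) →
        ∃ C : ℝ, 0 < C ∧ ∀ n m : ℕ, 1 ≤ n → 3 ≤ m →
          ‖RandomSimplex.cumulant m (RandomSimplex.logVolume (X n)) (P n)‖ ≤
            C ^ m * ((m - 1).factorial : ℝ) * r n * (n : ℝ) ^ (1 - (m : ℤ))) ∧
      (∀ n m : ℕ, 1 ≤ n → 3 ≤ m →
        ‖RandomSimplex.cumulant m (RandomSimplex.logVolume (X n)) (P n)‖ ≤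
          2 * ((m - 1).factorial : ℝ))) ∧
    -- (b) the Beta model (`ν > 0`) and the spherical model (`ν = 0`)
    (∀ ν : ℝ, 0 ≤ ν → ∀ X : ∀ n, Fin (r n + 1) → Ω n → EuclideanSpace ℝ (Fin n),
      (∀ n, 1 ≤ n →
        RandomSimplex.IsIIDSample (P n) (RandomSimplex.betaSphericalModel n ν) (X n)) →
      -- `L = log (r! V)` is well defined and has moments of all orders
      (∀ n, 4 ≤ n →
        (∀ᵐ ω ∂(P n), 0 < RandomSimplex.simplexVolume fun i => X n i ω) ∧
        ∀ p : ℕ, MemLp (RandomSimplex.logVolume (X n)) p (P n)) ∧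
      -- variance
      ((∀ᶠ n in atTop, r n < n) →
        (fun n => Var[RandomSimplex.logVolume (X n); P n])
          ~[atTop] (fun n => 1 / 2 * Real.log ((n : ℝ) / ((n : ℝ) - r n)) -
            (r n : ℝ) ^ 2 / (2 * n * (r n + 1)))) ∧
      ((fun n => (r n : ℝ)) =o[atTop] (fun n => √(n : ℝ)) →
        (fun n => Var[RandomSimplex.logVolume (X n); P n])
          ~[atTop] (fun n => (r n : ℝ) / (2 * (r n + 1) * n))) ∧
      (∀ α : ℝ, 0 < α → α < 1 → (fun n => (r n : ℝ)) ~[atTop] (fun n => α * (n : ℝ)) →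
        (fun n => Var[RandomSimplex.logVolume (X n); P n])
          ~[atTop] (fun _ => 1 / 2 * Real.log (1 / (1 - α)) - α / 2)) ∧
      ((fun n : ℕ => (n : ℝ) - r n) =o[atTop] (fun n => (n : ℝ)) →
        (fun n => Var[RandomSimplex.logVolume (X n); P n])
          ~[atTop] (fun n => 1 / 2 * Real.log ((n : ℝ) / ((n : ℝ) - r n + 1)))) ∧
      -- cumulants, for arbitrary `r`
      (∀ n m : ℕ, 4 ≤ n → 3 ≤ m →
        ‖RandomSimplex.cumulant m (RandomSimplex.logVolume (X n)) (P n)‖ ≤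
          2 * 4 ^ m * (m.factorial : ℝ))) ∧
    -- cumulants in the Beta and spherical models, with a constant that does not depend on `ν`
    ((fun n => (r n : ℝ)) =o[atTop] (fun n => (n : ℝ)) ∨
        (∃ α : ℝ, 0 < α ∧ α < 1 ∧ (fun n => (r n : ℝ)) ~[atTop] (fun n => α * (n : ℝ))) →
      ∃ C : ℝ, 0 < C ∧
        ∀ ν : ℝ, 0 ≤ ν → ∀ X : ∀ n, Fin (r n + 1) → Ω n → EuclideanSpace ℝ (Fin n),
          (∀ n, 1 ≤ n →
            RandomSimplex.IsIIDSample (P n) (RandomSimplex.betaSphericalModel n ν) (X n)) →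
          ∀ n m : ℕ, 4 ≤ n → 3 ≤ m →
            ‖RandomSimplex.cumulant m (RandomSimplex.logVolume (X n)) (P n)‖ ≤
              C ^ m * (m.factorial : ℝ) * r n * (n : ℝ) ^ (1 - (m : ℤ))) := by
  refine ⟨fun X hX => ?_, fun ν hν X hX => ?_, fun hrα => ?_⟩
  · have hG : ∀ n, 1 ≤ n → (∀ᵐ ω ∂(P n), 0 < RandomSimplex.simplexVolume fun i => X n i ω) ∧
        RandomSimplex.HasCumulantFunction (RandomSimplex.logVolume (X n)) (P n)
          (RandomSimplex.gaussCumulantFun n (r n)) := fun n hn => (hX n hn).gaussian (hr n hn).2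
    have hV : ∀ᶠ n : ℕ in atTop, |Var[RandomSimplex.logVolume (X n); P n] -
        1 / 2 * Real.log (((n : ℝ) + 1) / (n - r n + 1))| ≤
        5 / 2 * (r n / (n * ((n : ℝ) - r n + 1))) := by
      filter_upwards [eventually_ge_atTop 1] with n hn
      rw [(hG n hn).2.variance_eq]
      exact RandomSimplex.abs_variance_gauss_sub_le hn (hr n hn).2
    have hc : ∀ n m : ℕ, 1 ≤ n → 3 ≤ m →
        ‖RandomSimplex.cumulant m (RandomSimplex.logVolume (X n)) (P n)‖ =
          |iteratedDeriv m (RandomSimplex.gaussCumulantFun n (r n)) 0| := fun n m hn hm => by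
      rw [(hG n hn).2.cumulant_eq (by omega), Complex.norm_real, Real.norm_eq_abs]
    refine ⟨fun n hn => ⟨(hG n hn).1, (hG n hn).2.memLp⟩, ?_, fun h => ?_, fun α h0 h1 h => ?_,
      fun h => ?_, fun h => ?_, fun n m hn hm => ?_⟩
    · refine RandomSimplex.mean_equiv hr ?_
      filter_upwards [eventually_ge_atTop 1] with n hn
      exact (hG n hn).2.integral_eq
    · exact RandomSimplex.variance_equiv_of_isLittleO hr (by norm_num) hV h
    · exact RandomSimplex.variance_equiv_of_proportional hV h0 h1 h
    · refine RandomSimplex.variance_equiv_of_sub_isLittleO hr (B := 5 / 2) ?_ h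
      filter_upwards [hV, eventually_ge_atTop 1] with n h1 hn
      exact h1.trans (mul_le_of_le_one_right (by norm_num)
        (RandomSimplex.ratio_le_one hn (hr n hn).2))
    · obtain ⟨c, hc0, hc1, hcn⟩ := RandomSimplex.exists_le_sub hr h
      refine ⟨2 / c, by positivity, fun n m hn hm => ?_⟩
      rw [hc n m hn hm]
      exact RandomSimplex.abs_cumulant_gauss_le_of_le_sub hn (hr n hn).2 hm hc0 hc1 (hcn n hn)
    · rw [hc n m hn hm]
      exact RandomSimplex.abs_cumulant_gauss_le hn (hr n hn).2 hm
  · have hG : ∀ n, 4 ≤ n → (∀ᵐ ω ∂(P n), 0 < RandomSimplex.simplexVolume fun i => X n i ω) ∧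
        RandomSimplex.HasCumulantFunction (RandomSimplex.logVolume (X n)) (P n)
          (RandomSimplex.betaCumulantFun n (r n) ν) := fun n hn =>
      (hX n (by omega)).betaSpherical (by omega) (hr n (by omega)).2 hν
    have hV : ∀ᶠ n : ℕ in atTop, |Var[RandomSimplex.logVolume (X n); P n] -
        (1 / 2 * Real.log (((n : ℝ) + 1) / (n - r n + 1)) -
          (r n : ℝ) ^ 2 / (2 * n * (r n + 1)))| ≤
        (4 * ν + 19) * (r n / (n * ((n : ℝ) - r n + 1))) := by
      filter_upwards [eventually_ge_atTop 4] with n hn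
      rw [(hG n hn).2.variance_eq]
      exact RandomSimplex.abs_variance_beta_sub_le hn (hr n (by omega)).1 (hr n (by omega)).2 hν
    have hmain := RandomSimplex.variance_beta_equiv hr (by linarith) hV
    refine ⟨fun n hn => ⟨(hG n hn).1, (hG n hn).2.memLp⟩, hmain, fun h => ?_, fun α h0 h1 h => ?_,
      fun h => ?_, fun n m hn hm => ?_⟩
    · have hlt := RandomSimplex.eventually_lt_of_tendsto_div one_pos
        (RandomSimplex.tendsto_div_of_isLittleO (RandomSimplex.isLittleO_of_isLittleO_sqrt h))
      exact (hmain hlt).trans (RandomSimplex.betaVarianceTerm_equiv_of_isLittleO_sqrt hr h)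
    · have hlt := RandomSimplex.eventually_lt_of_tendsto_div h1
        (RandomSimplex.tendsto_div_of_isEquivalent h)
      exact (hmain hlt).trans (RandomSimplex.betaVarianceTerm_equiv_of_proportional h0 h1 h)
    · refine RandomSimplex.variance_equiv_of_sub_isLittleO hr (B := 4 * ν + 19 + 1) ?_ h
      filter_upwards [hV, eventually_ge_atTop 1] with n h1 hn
      have h2 : (4 * ν + 19) * ((r n : ℝ) / (n * ((n : ℝ) - r n + 1))) ≤ 4 * ν + 19 :=
        mul_le_of_le_one_right (by linarith) (RandomSimplex.ratio_le_one hn (hr n hn).2)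
      have h3 : (r n : ℝ) ≤ n := by exact_mod_cast (hr n hn).2
      have hn' : (0 : ℝ) < n := by exact_mod_cast hn
      have h4 : (r n : ℝ) ^ 2 / (2 * n * (r n + 1)) ≤ 1 := by
        rw [div_le_one (by positivity)]
        nlinarith [mul_nonneg (Nat.cast_nonneg (α := ℝ) (r n)) hn'.le,
          mul_le_mul_of_nonneg_left h3 (Nat.cast_nonneg (α := ℝ) (r n))]
      have h5 : 0 ≤ (r n : ℝ) ^ 2 / (2 * n * (r n + 1)) := by positivity
      rw [abs_le] at h1 ⊢
      constructor <;> linarith [h1.1, h1.2]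
    · rw [(hG n hn).2.cumulant_eq (by omega), Complex.norm_real, Real.norm_eq_abs]
      exact RandomSimplex.abs_cumulant_beta_le hn (hr n (by omega)).1 (hr n (by omega)).2 hν hm
  · obtain ⟨c, hc0, hc1, hcn⟩ := RandomSimplex.exists_le_sub hr hrα
    refine ⟨4 / c, by positivity, fun ν hν X hX n m hn hm => ?_⟩
    obtain ⟨hr1, hrn⟩ := hr n (by omega)
    rw [((hX n (by omega)).betaSpherical (by omega) hrn hν).2.cumulant_eq (by omega),
      Complex.norm_real, Real.norm_eq_abs]
    exact RandomSimplex.abs_cumulant_beta_le_of_le_sub hn hr1 hrn hν hm hc0 hc1 (hcn n (by omega))
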